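/- Let $G=(V,E)$ be a finite graph and $k$ a non-negative integer. In the localization game with $k$ sensors, in each round $t=1,2,\dots$ the cops choose a set $S_t\subseteq V$ with $|S_t|=k$, depending only on the information received in earlier rounds; an invisible robber then chooses a vertex $v_t$ (arbitrary if $t=1$, and equal or adjacent to $v_{t-1}$ if $t\ge 2$); and the cops learn the distances from the vertices of $S_t$ to $v_t$. The cops win in round $t$ if the information received in rounds $1,\dots,t$ determines $v_t$. The localization number $\zeta(G)$ is the least $k$ for which the cops have a strategy that wins in finitely many rounds against every behaviour of the robber. The random graph $\mathcal G(n,p)$ has vertex set $\{1,\dots,n\}$, each pair of vertices being an edge independently with probability $p$; an event holds a.a.s. if its probability tends to $1$ as $n\to\infty$. We write $f\ll g$ if $f/g\to 0$ as $n\to\infty$, and $\log$ is the natural logarithm. **Theorem.** Let $A>0$ be a real number. (1) Let $p=p(n)\in[0,1]$ and $i=i(n)\in\mathbb N$ be such that $d=d(n):=pn$ satisfies $\log^3 n\ll d\ll n$ and $d^i/n\to A$. Then there is a function $\delta=\delta(n)$ with $\delta(n)\to 0$ as $n\to\infty$ such that a.a.s. $G\in\mathcal G(n,p)$ satisfies $$\left(\log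 d-3\log\log n\right)\frac1A\;\le\;\zeta(G)\;\le\;(1+\delta(n))\left(\log d+2\log\log n\right)\frac{e^A}{1-e^{-A}}.$$ (2) For every $\varepsilon>0$ there are constants $a,b>0$, depending only on $A$ and $\varepsilon$, such that for all $p$ and $i$ as in (1) with $d\ge(\log n)^{3+\varepsilon}$ for all sufficiently large $n$, a.a.s. $G\in\mathcal G(n,p)$ satisfies $$a\,\frac{n\log d}{d^i}\;\le\;\zeta(G)\;\le\; b\,\frac{n\log d}{d^i}.$$ -/

import Mathlib

open Filter Topology Asymptotics

namespace Localization

variable {V : Type*}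

open Classical in
/-- The `S`-signature of a vertex `v`: the vector of distances from the sensors `s ∈ S` to `v`
(vertices that carry no sensor give `none`). Distances are extended distances, so vertices in
different components are at distance `⊤`. -/
noncomputable def signature (G : SimpleGraph V) (S : Finset V) (v : V) : V → Option ℕ∞ :=
  fun s => if s ∈ S then some (G.edist s v) else none

/-- A strategy of the cops with `k` sensors: given the signatures received in all the previous
rounds (oldest first), it chooses the set of `k` sensor locations of the current round. -/
structure CopStrategy (V : Type*) (k : ℕ) where
  sensors : List (V → Option ℕ∞) → Finset V
  card_sensors : ∀ h, (sensors h).card = k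

/-- The signatures received in rounds `0, …, t - 1` if the cops play `σ` and the robber is at
`v j` in round `j`. -/
noncomputable def infoTrail (G : SimpleGraph V) {k : ℕ} (σ : CopStrategy V k) (v : ℕ → V) :
    ℕ → List (V → Option ℕ∞)
  | 0 => []
  | t + 1 => infoTrail G σ v t ++ [signature G (σ.sensors (infoTrail G σ v t)) (v t)]

/-- The sensor locations in round `t` if the cops play `σ` against the robber's walk `v`. -/
noncomputable def sensorsAt (G : SimpleGraph V) {k : ℕ} (σ : CopStrategy V k) (v : ℕ → V)
    (t : ℕ) : Finset V :=
  σ.sensors (infoTrail G σ v t)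

/-- The robber starts anywhere, and in every round stays or moves along an edge. -/
def IsRobberWalk (G : SimpleGraph V) (v : ℕ → V) : Prop :=
  ∀ t, v (t + 1) = v t ∨ G.Adj (v t) (v (t + 1))

/-- The information received up to and including round `t` determines the position of the robber
in round `t`: every walk with the same info trail, with respect to the sensor locations that were
used, is at the same vertex in round `t`. -/
def LocatedAt (G : SimpleGraph V) {k : ℕ} (σ : CopStrategy V k) (v : ℕ → V) (t : ℕ) : Prop :=
  ∀ w : ℕ → V, IsRobberWalk G w →
    (∀ j ≤ t, signature G (sensorsAt G σ v j) (w j) = signature G (sensorsAt G σ v j) (v j)) →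
      w t = v t

/-- The cops can win the localization game with `k` sensors: they have a strategy that locates the
robber after finitely many rounds, whatever the robber does. -/
def CopsWin (G : SimpleGraph V) (k : ℕ) : Prop :=
  ∃ σ : CopStrategy V k, ∀ v : ℕ → V, IsRobberWalk G v → ∃ t, LocatedAt G σ v t

/-- The localization number `ζ(G)`. -/
noncomputable def localizationNumber (G : SimpleGraph V) : ℕ :=
  sInf {k | CopsWin G k}

/-- With a sensor on every vertex the cops win at once, so on a finite graph the set whose infimum
defines the localization number is non-empty. -/
theorem copsWin_card [Fintype V] (G : SimpleGraph V) : CopsWin G (Fintype.card V) := by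
  refine ⟨⟨fun _ => Finset.univ, fun _ => rfl⟩, fun v _ => ⟨0, fun w _ h => ?_⟩⟩
  have h0 := congrFun (h 0 le_rfl) (v 0)
  simp only [signature, sensorsAt, Finset.mem_univ, if_true, SimpleGraph.edist_self,
    Option.some.injEq, SimpleGraph.edist_eq_zero_iff] at h0
  exact h0.symm

/-- A property of graphs holds asymptotically almost surely for the binomial random graph on `n`
vertices with edge probability `p n`. -/
def HoldsAAS (p : ℕ → unitInterval) (P : ∀ n : ℕ, SimpleGraph (Fin n) → Prop) : Prop :=
  Tendsto (fun n => SimpleGraph.binomialRandom (Fin n) (p n) {G | P n G}) atTop (𝓝 1)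

/-- `d(n) = p(n) · n`. -/
noncomputable def degreeParam (p : ℕ → unitInterval) (n : ℕ) : ℝ :=
  (p n : ℝ) * n

/-- `log³ n ≪ d ≪ n` and `d ^ i / n → A`. -/
def InRegime (A : ℝ) (p : ℕ → unitInterval) (i : ℕ → ℕ) : Prop :=
  (fun n : ℕ => Real.log n ^ 3) =o[atTop] degreeParam p ∧
  degreeParam p =o[atTop] (fun n : ℕ => (n : ℝ)) ∧
  Tendsto (fun n : ℕ => degreeParam p n ^ i n / n) atTop (𝓝 A)

end Localization

/-!
Write `d = p n`, `L = log n`, `D = d ^ (i - 1)` and `x = exp (-A)`, so that `p D → A`. In the regime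
of the theorem the balls of radius `i - 1` have about `D` elements, and a vertex is at distance
larger than `i` from a given sensor if it has no neighbour in such a ball, that is, with probability
about `x`. Nearly all the other vertices are at distance `i`, and nearly all the vertices beyond are
at distance `i + 1`. So a sensor reveals about one bit, which takes its two values with
probabilities `1 - x` and `x`, and different sensors behave almost independently.

The random graph enters only through properties of all vertex sets at once, proved by union bounds:
bounded degrees (`DegreeLE`), the expected number of vertices that have a neighbour in `W₁` and none
in `W₂` (`Expanding`, `Avoidable`), edges between large sets (`Joined`), and a collision property
of the neighbourhoods (`Colliding`). As they hold for all sets, no exposure of the graph in the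
course of a breadth-first search is needed: they are applied to the balls around the sensors.

*Upper bound.* Two vertices `u ≠ v` have nearly disjoint balls of radius `i - 1`, hence are
distinguished by a proportion of about `q = 2 x (1 - x)` of all sensors
(`RegimeAt.le_card_distinguishing`). By averaging, `k` greedily chosen sensors leave at most
`(1 - q) ^ k |X| ^ 2` pairs of a candidate set `X` undistinguished, so the signature classes have at
most about `(1 - q) ^ (k / 2) |X|` elements. After the robber's move the candidate set grows by a
factor of at most `1 + d (1 + o(1))`, and it shrinks in every round once
`k > (2 log d + O(1)) / -log (1 - q)`. Since `-log (1 - q) ≥ q`, about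
`2 log d / q = log d * exp A / (1 - exp (-A))` sensors suffice (`copsWin_of_distinguishing`).

*Lower bound.* The robber survives if for every vertex `v` and every set `S` of `k` sensors two
neighbours of `v` have the same signature (`not_copsWin_of_collision`). The distances in `G` between
the sensors and the neighbours of `v` are functions of those in `G - v`
(`edist_eq_of_isolate_edist_eq`), and the neighbourhood of `v` is a random set independent of
`G - v`. Colour the vertices `u` at distance `i` or `i + 1` from all sensors by the set `T u` of
sensors at distance `i + 1`. The expected number of monochromatic pairs of neighbours of `v` is of
order `p ^ 2` times the number of all monochromatic pairs, and if it is at least of order `L ^ 6`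
then no collision occurs with probability only `exp (-L ^ 3 / 64)`
(`prob_isolate_noCollision_le`, `le_totalRate`), which beats the number `exp (O(L ^ 2))` of choices
of `v` and `S`. What is needed is therefore that about `n ^ 2 x ^ (2 k)` pairs are monochromatic,
because `p n x ^ k ≥ L ^ 3` for `k ≤ (log d - 3 log L) / A`.

The convergence `d ^ i / n → A` may be arbitrarily slow, so that `x ^ k` is not known up to a
constant factor for `k` of order `log d`, and the size of a single colour class is not sufficiently
controlled. There is, however, room in the count: with a weight `c`, the Cauchy–Schwarz inequality
(`sq_sum_pow_card_le`) bounds the number of monochromatic pairs below by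
`(∑ u, c ^ |T u|) ^ 2 / (1 + c ^ 2) ^ k`, where `∑ u, c ^ |T u|` is about
`n (1 + (c - 1) x) ^ k`. For `c = 1 / (1 - x)` one has `(1 + (c - 1) x) ^ 2 > x ^ 2 (1 + c ^ 2)`, a
strict inequality which absorbs all errors (`RegimeAt.le_totalRate`).

Both bounds hold with a small constant `κ` in the role of the error terms as soon as `n` is large
(`InRegime.holdsAAS_bounds`); a diagonal argument (`exists_tendsto_zero_holdsAAS`) lets the relative
error of the upper bound tend to zero. If `d ≥ L ^ (3 + ε)` then `log d - 3 log L` is of order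
`log d`, which gives the second part.
-/

namespace Localization

section RandomSubset

open scoped Classical

/-! ### Random subsets of a finite set -/

variable {ι : Type*} [Fintype ι]

/-- The probability that the random subset of `ι` containing every element independently with
probability `p` is equal to `F`. -/
noncomputable def subsetWeight (p : ℝ) (F : Finset ι) : ℝ :=
  ∏ e, if e ∈ F then p else 1 - p

/-- The expectation of `f` on the `p`-random subset of `ι`. -/
noncomputable def expect (p : ℝ) (f : Finset ι → ℝ) : ℝ :=
  ∑ F, subsetWeight p F * f F

/-- The probability of the event `A` for the `p`-random subset of `ι`. -/
noncomputable def prob (p : ℝ) (A : Finset ι → Prop) : ℝ :=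
  expect p fun F => if A F then 1 else 0

/-- The value of `f` at a subset is determined by the trace of this subset on `S`. -/
def DeterminedOn {β : Type*} (S : Finset ι) (f : Finset ι → β) : Prop :=
  ∀ F F', (∀ e ∈ S, e ∈ F ↔ e ∈ F') → f F = f F'

/-- The set that agrees with `F` on `S` and with `F'` outside `S`. -/
noncomputable def splice (S F F' : Finset ι) : Finset ι :=
  (F ∩ S) ∪ (F' \ S)

lemma mem_splice {ι : Type*} {S F F' : Finset ι} {e : ι} :
    e ∈ splice S F F' ↔ (e ∈ S ∧ e ∈ F) ∨ (e ∉ S ∧ e ∈ F') := by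
  simp only [splice, Finset.mem_union, Finset.mem_inter, Finset.mem_sdiff]
  tauto

lemma sum_prod_ite (a b : ι → ℝ) :
    ∑ F : Finset ι, ∏ e, (if e ∈ F then a e else b e) = ∏ e, (a e + b e) := by
  rw [Finset.prod_add, Finset.powerset_univ]
  refine Finset.sum_congr rfl fun F _ => ?_
  rw [Finset.prod_ite, Finset.filter_mem_eq_inter, Finset.univ_inter]
  congr 2
  ext e; simp

lemma sum_subsetWeight (p : ℝ) : ∑ F : Finset ι, subsetWeight p F = 1 := by
  unfold subsetWeight
  rw [sum_prod_ite (fun _ => p) (fun _ => 1 - p)]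
  simp

lemma subsetWeight_nonneg {p : ℝ} (h0 : 0 ≤ p) (h1 : p ≤ 1) (F : Finset ι) :
    0 ≤ subsetWeight p F :=
  Finset.prod_nonneg fun e _ => by split_ifs <;> linarith

lemma expect_const (p c : ℝ) : expect p (fun _ : Finset ι => c) = c := by
  simp [expect, ← Finset.sum_mul, sum_subsetWeight]

lemma expect_mono {p : ℝ} (h0 : 0 ≤ p) (h1 : p ≤ 1) {f g : Finset ι → ℝ} (h : ∀ F, f F ≤ g F) :
    expect p f ≤ expect p g :=
  Finset.sum_le_sum fun F _ => mul_le_mul_of_nonneg_left (h F) (subsetWeight_nonneg h0 h1 F)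

lemma expect_const_mul (p c : ℝ) (f : Finset ι → ℝ) :
    expect p (fun F => c * f F) = c * expect p f := by
  simp only [expect, Finset.mul_sum]
  exact Finset.sum_congr rfl fun F _ => by ring

lemma expect_add (p : ℝ) (f g : Finset ι → ℝ) :
    expect p (fun F => f F + g F) = expect p f + expect p g := by
  simp only [expect, mul_add, Finset.sum_add_distrib]

lemma expect_sum {κ : Type*} (p : ℝ) (T : Finset κ) (f : κ → Finset ι → ℝ) :
    expect p (fun F => ∑ t ∈ T, f t F) = ∑ t ∈ T, expect p (f t) := by
  simp only [expect, Finset.mul_sum]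
  exact Finset.sum_comm

lemma prob_congr {p : ℝ} {A B : Finset ι → Prop} (h : ∀ F, A F ↔ B F) : prob p A = prob p B := by
  rw [show A = B from funext fun F => propext (h F)]

lemma prob_nonneg {p : ℝ} (h0 : 0 ≤ p) (h1 : p ≤ 1) (A : Finset ι → Prop) : 0 ≤ prob p A :=
  Finset.sum_nonneg fun F _ => mul_nonneg (subsetWeight_nonneg h0 h1 F) (by
    dsimp only; split_ifs <;> simp)

lemma prob_mono {p : ℝ} (h0 : 0 ≤ p) (h1 : p ≤ 1) {A B : Finset ι → Prop} (h : ∀ F, A F → B F) :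
    prob p A ≤ prob p B :=
  expect_mono h0 h1 fun F => by
    by_cases hA : A F
    · simp [hA, h F hA]
    · simp only [hA, if_false]; split_ifs <;> simp

lemma prob_not (p : ℝ) (A : Finset ι → Prop) : prob p (fun F => ¬ A F) = 1 - prob p A := by
  rw [eq_sub_iff_add_eq, prob, prob, ← expect_add]
  refine Eq.trans ?_ (expect_const (ι := ι) p 1)
  congr 1
  ext F
  by_cases h : A F <;> simp [h]

lemma prob_exists_le {κ : Type*} {p : ℝ} (h0 : 0 ≤ p) (h1 : p ≤ 1) (T : Finset κ)
    (A : κ → Finset ι → Prop) :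
    prob p (fun F => ∃ t ∈ T, A t F) ≤ ∑ t ∈ T, prob p (A t) := by
  unfold prob
  rw [← expect_sum]
  refine expect_mono h0 h1 fun F => ?_
  split_ifs with h
  · obtain ⟨t, ht, hA⟩ := h
    refine le_trans ?_ (Finset.single_le_sum (f := fun t => if A t F then (1 : ℝ) else 0)
      (fun _ _ => by split_ifs <;> simp) ht)
    simp [hA]
  · exact Finset.sum_nonneg fun _ _ => by split_ifs <;> simp

lemma prob_or_le {p : ℝ} (h0 : 0 ≤ p) (h1 : p ≤ 1) (A B : Finset ι → Prop) :
    prob p (fun F => A F ∨ B F) ≤ prob p A + prob p B := by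
  unfold prob
  rw [← expect_add]
  refine expect_mono h0 h1 fun F => ?_
  by_cases hA : A F <;> by_cases hB : B F <;> simp [hA, hB]

/-- Markov's inequality. -/
lemma prob_le_expect {p : ℝ} (h0 : 0 ≤ p) (h1 : p ≤ 1) {A : Finset ι → Prop} {f : Finset ι → ℝ}
    (hf : ∀ F, 0 ≤ f F) (h : ∀ F, A F → 1 ≤ f F) : prob p A ≤ expect p f :=
  expect_mono h0 h1 fun F => by
    split_ifs with hA
    exacts [h F hA, hf F]

/-- Resampling the elements outside `S` does not change the distribution: exchanging the traces
of two independent copies on `S` preserves the joint weight. -/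
lemma expect_splice (p : ℝ) (S : Finset ι) (f : Finset ι → ℝ) :
    expect p f = expect p fun F => expect p fun F' => f (splice S F F') := by
  have hw : ∀ F F' : Finset ι, subsetWeight p (splice S F F') * subsetWeight p (splice S F' F) =
      subsetWeight p F * subsetWeight p F' := fun F F' => by
    simp only [subsetWeight, ← Finset.prod_mul_distrib, mem_splice]
    refine Finset.prod_congr rfl fun e _ => ?_
    by_cases hS : e ∈ S <;> simp [hS, mul_comm]
  have hinv : ∀ F F' : Finset ι, splice S (splice S F F') (splice S F' F) = F := fun F F' => by
    ext e
    simp only [mem_splice]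
    tauto
  calc expect p f = ∑ F, ∑ F', subsetWeight p F * subsetWeight p F' * f F := by
        refine Finset.sum_congr rfl fun F _ => ?_
        rw [← Finset.sum_mul, ← Finset.mul_sum, sum_subsetWeight, mul_one]
    _ = ∑ x : Finset ι × Finset ι, subsetWeight p x.1 * subsetWeight p x.2 * f x.1 :=
        (Fintype.sum_prod_type' fun F F' => subsetWeight p F * subsetWeight p F' * f F).symm
    _ = ∑ x : Finset ι × Finset ι,
          subsetWeight p x.1 * subsetWeight p x.2 * f (splice S x.1 x.2) := by
        refine Finset.sum_bij' (fun x _ => (splice S x.1 x.2, splice S x.2 x.1))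
          (fun x _ => (splice S x.1 x.2, splice S x.2 x.1)) (by simp) (by simp)
          (fun x _ => ?_) (fun x _ => ?_) (fun x _ => ?_)
        · simp [hinv]
        · simp [hinv]
        · simp [hinv, hw]
    _ = _ := by
        rw [Fintype.sum_prod_type]
        simp only [expect, Finset.mul_sum]
        exact Finset.sum_congr rfl fun F _ => Finset.sum_congr rfl fun F' _ => by ring

lemma expect_mul_of_determinedOn (p : ℝ) {S S' : Finset ι} (hS : Disjoint S S')
    {f g : Finset ι → ℝ} (hf : DeterminedOn S f) (hg : DeterminedOn S' g) :
    expect p (fun F => f F * g F) = expect p f * expect p g := by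
  rw [expect_splice p S]
  have h : ∀ F F', f (splice S F F') * g (splice S F F') = f F * g F' := fun F F' => by
    rw [hf (splice S F F') F fun e he => by simp [mem_splice, he],
      hg (splice S F F') F' fun e he => by
        simp [mem_splice, Finset.disjoint_right.1 hS he]]
  simp only [h, expect_const_mul]
  simp only [mul_comm _ (expect p g), expect_const_mul]

/-- Functions that are determined by the traces on disjoint sets are independent. -/
lemma expect_prod_of_determinedOn {κ : Type*} (p : ℝ) (T : Finset κ) (S : κ → Finset ι)
    (f : κ → Finset ι → ℝ) (hS : (T : Set κ).PairwiseDisjoint S)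
    (hf : ∀ t ∈ T, DeterminedOn (S t) (f t)) :
    expect p (fun F => ∏ t ∈ T, f t F) = ∏ t ∈ T, expect p (f t) := by
  induction T using Finset.induction_on with
  | empty => simp [expect_const]
  | insert a T ha ih =>
    simp only [Finset.prod_insert ha]
    rw [expect_mul_of_determinedOn p (S := S a) (S' := T.biUnion S),
      ih (hS.subset (by simp)) fun t ht => hf t (Finset.mem_insert_of_mem ht)]
    · rw [Finset.disjoint_biUnion_right]
      intro t ht
      exact hS (by simp) (by simp [ht]) (by rintro rfl; exact ha ht)
    · exact hf a (by simp)
    · intro F F' h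
      refine Finset.prod_congr rfl fun t ht =>
        hf t (Finset.mem_insert_of_mem ht) F F' fun e he => ?_
      exact h e (Finset.mem_biUnion.2 ⟨t, ht, he⟩)

lemma DeterminedOn.ite {ι : Type*} {S : Finset ι} {A : Finset ι → Prop} (h : DeterminedOn S A)
    (a b : ℝ) :
    DeterminedOn S fun F => if A F then a else b := fun F F' hF => by
  simp only [h F F' hF]

lemma prob_subset_and_disjoint (p : ℝ) {B A : Finset ι} (h : Disjoint B A) :
    prob p (fun F => (∀ e ∈ B, e ∈ F) ∧ ∀ e ∈ A, e ∉ F) = p ^ B.card * (1 - p) ^ A.card := by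
  have h1 : ∀ F : Finset ι, subsetWeight p F *
      (if (∀ e ∈ B, e ∈ F) ∧ ∀ e ∈ A, e ∉ F then (1 : ℝ) else 0) =
      ∏ e, (if e ∈ F then (if e ∈ A then 0 else p) else (if e ∈ B then 0 else 1 - p)) := by
    intro F
    split_ifs with hF
    · rw [mul_one]
      refine Finset.prod_congr rfl fun e _ => ?_
      have h1 := hF.1 e
      have h2 := hF.2 e
      by_cases he : e ∈ F
      · have : e ∉ A := fun hA => h2 hA he
        simp [he, this]
      · have : e ∉ B := fun hB => he (h1 hB)
        simp [he, this]
    · rw [mul_zero, eq_comm, Finset.prod_eq_zero_iff]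
      rw [not_and_or] at hF
      push Not at hF
      rcases hF with ⟨e, he, heF⟩ | ⟨e, he, heF⟩
      · exact ⟨e, Finset.mem_univ _, by simp [he, heF]⟩
      · exact ⟨e, Finset.mem_univ _, by simp [he, heF]⟩
  have h3 : prob p (fun F => (∀ e ∈ B, e ∈ F) ∧ ∀ e ∈ A, e ∉ F) = _ :=
    Finset.sum_congr rfl fun F _ => (by convert h1 F)
  rw [h3, sum_prod_ite]
  have h2 : ∀ e : ι, ((if e ∈ A then 0 else p) + (if e ∈ B then 0 else 1 - p)) =
      (if e ∈ B then p else 1) * (if e ∈ A then 1 - p else 1) := by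
    intro e
    by_cases hB : e ∈ B
    · simp [hB, Finset.disjoint_left.1 h hB]
    · by_cases hA : e ∈ A <;> simp [hA, hB]
  rw [Finset.prod_congr rfl fun e _ => h2 e, Finset.prod_mul_distrib]
  simp

/-! ### Chernoff bounds -/

variable {κ : Type*}

/-- The exponential moment of the number of successes among independent events, each of
probability at least (for `s ≥ 0`) or at most (for `s ≤ 0`) `q`. -/
lemma expect_exp_neg_card_le {p q : ℝ} (h0 : 0 ≤ p) (h1 : p ≤ 1) (T : Finset κ)
    (S : κ → Finset ι) (A : κ → Finset ι → Prop) (hS : (T : Set κ).PairwiseDisjoint S)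
    (hA : ∀ t ∈ T, DeterminedOn (S t) (A t)) (s : ℝ)
    (hq : ∀ t ∈ T, (Real.exp (-s) - 1) * prob p (A t) ≤ (Real.exp (-s) - 1) * q) :
    expect p (fun F => Real.exp (-s * (T.filter fun t => A t F).card)) ≤
      Real.exp ((Real.exp (-s) - 1) * (T.card * q)) := by
  have h : ∀ F, Real.exp (-s * (T.filter fun t => A t F).card) =
      ∏ t ∈ T, (if A t F then Real.exp (-s) else 1) := by
    intro F
    rw [Finset.prod_ite, Finset.prod_const_one, mul_one, Finset.prod_const, mul_comm,
      Real.exp_nat_mul]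
  simp only [h]
  rw [expect_prod_of_determinedOn p T S _ hS fun t ht => (hA t ht).ite _ _]
  have h2 : ∀ t ∈ T, expect p (fun F => if A t F then Real.exp (-s) else 1) ≤
      Real.exp ((Real.exp (-s) - 1) * q) := by
    intro t ht
    have : ∀ F, (if A t F then Real.exp (-s) else 1) =
        1 + (Real.exp (-s) - 1) * (if A t F then 1 else 0) := by
      intro F; split_ifs <;> ring
    simp only [this]
    rw [expect_add, expect_const, expect_const_mul]
    have := hq t ht
    have h3 := Real.add_one_le_exp ((Real.exp (-s) - 1) * q)
    rw [prob] at this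
    linarith
  refine (Finset.prod_le_prod (fun t _ => ?_) h2).trans ?_
  · refine Finset.sum_nonneg fun F _ => mul_nonneg (subsetWeight_nonneg h0 h1 F) ?_
    dsimp only
    split_ifs <;> positivity
  · rw [Finset.prod_const, ← Real.exp_nat_mul]
    apply le_of_eq; ring_nf

lemma exp_neg_le {t : ℝ} (ht : 0 ≤ t) : Real.exp (-t) ≤ 1 - t + t ^ 2 / 2 := by
  rw [Real.exp_neg]
  have h := Real.quadratic_le_exp_of_nonneg ht
  have h2 : (0 : ℝ) < 1 + t + t ^ 2 / 2 := by positivity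
  refine (inv_anti₀ h2 h).trans ?_
  rw [inv_le_iff_one_le_mul₀ h2]
  nlinarith [sq_nonneg (t ^ 2)]

/-- Chernoff's bound for the lower tail. -/
lemma prob_card_lt_le {p q δ : ℝ} (h0 : 0 ≤ p) (h1 : p ≤ 1) (hδ : 0 ≤ δ) (hq0 : 0 ≤ q)
    (T : Finset κ) (S : κ → Finset ι) (A : κ → Finset ι → Prop)
    (hS : (T : Set κ).PairwiseDisjoint S) (hA : ∀ t ∈ T, DeterminedOn (S t) (A t))
    (hq : ∀ t ∈ T, q ≤ prob p (A t)) :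
    prob p (fun F => ((T.filter fun t => A t F).card : ℝ) < (1 - δ) * (T.card * q)) ≤
      Real.exp (-(δ ^ 2 * (T.card * q) / 2)) := by
  set μ : ℝ := T.card * q
  have hμ : 0 ≤ μ := by positivity
  have hE := expect_exp_neg_card_le h0 h1 T S A hS hA δ (q := q) fun t ht =>
    mul_le_mul_of_nonpos_left (hq t ht) (by
      have := Real.exp_le_one_iff.2 (neg_nonpos.2 hδ); linarith)
  refine (prob_le_expect h0 h1 (f := fun F => Real.exp (δ * ((1 - δ) * μ)) *
    Real.exp (-δ * (T.filter fun t => A t F).card)) (fun F => by positivity)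
    fun F hF => ?_).trans ?_
  · rw [← Real.exp_add]
    apply Real.one_le_exp
    nlinarith
  · rw [expect_const_mul]
    refine (mul_le_mul_of_nonneg_left hE (by positivity)).trans ?_
    rw [← Real.exp_add]
    apply Real.exp_le_exp.2
    have := exp_neg_le hδ
    nlinarith

/-- Chernoff's bound for the upper tail. -/
lemma prob_lt_card_le {p q m δ : ℝ} (h0 : 0 ≤ p) (h1 : p ≤ 1) (hδ : 0 ≤ δ) (hδ1 : δ ≤ 1)
    (T : Finset κ) (S : κ → Finset ι) (A : κ → Finset ι → Prop)
    (hS : (T : Set κ).PairwiseDisjoint S) (hA : ∀ t ∈ T, DeterminedOn (S t) (A t))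
    (hq : ∀ t ∈ T, prob p (A t) ≤ q) (hm : T.card * q ≤ m) (hm0 : 0 ≤ m) :
    prob p (fun F => (1 + δ) * m < (T.filter fun t => A t F).card) ≤
      Real.exp (-(δ ^ 2 * m / 4)) := by
  have he : Real.exp (δ / 2) - 1 ≤ δ / 2 + (δ / 2) ^ 2 := by
    have := Real.abs_exp_sub_one_sub_id_le (x := δ / 2) (by rw [abs_le]; constructor <;> linarith)
    linarith [(abs_le.1 this).2]
  have he0 : 0 ≤ Real.exp (δ / 2) - 1 := by
    have := Real.one_le_exp (x := δ / 2) (by linarith); linarith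
  have hE := expect_exp_neg_card_le h0 h1 T S A hS hA (-(δ / 2)) (q := q) fun t ht => by
    rw [neg_neg]
    exact mul_le_mul_of_nonneg_left (hq t ht) he0
  rw [neg_neg] at hE
  refine (prob_le_expect h0 h1 (f := fun F => Real.exp (-(δ / 2 * ((1 + δ) * m))) *
    Real.exp (δ / 2 * (T.filter fun t => A t F).card)) (fun F => by positivity)
    fun F hF => ?_).trans ?_
  · rw [← Real.exp_add]
    apply Real.one_le_exp
    nlinarith
  · rw [expect_const_mul]
    refine (mul_le_mul_of_nonneg_left hE (by positivity)).trans ?_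
    rw [← Real.exp_add]
    apply Real.exp_le_exp.2
    have h3 : (Real.exp (δ / 2) - 1) * (T.card * q) ≤ (δ / 2 + (δ / 2) ^ 2) * m :=
      (mul_le_mul_of_nonneg_left hm he0).trans (mul_le_mul_of_nonneg_right he hm0)
    nlinarith

end RandomSubset

section RandomGraph

open scoped Classical

/-! ### The binomial random graph as a random subset of the set of pairs -/

variable {V : Type*} [Fintype V]

/-- The graph whose edges are the off-diagonal elements of `F`. -/
def graphOf {V : Type*} (F : Finset (Sym2 V)) : SimpleGraph V :=
  SimpleGraph.fromEdgeSet (F : Set (Sym2 V))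

lemma graphOf_adj {V : Type*} {F : Finset (Sym2 V)} {u v : V} :
    (graphOf F).Adj u v ↔ s(u, v) ∈ F ∧ u ≠ v := by
  simp [graphOf]

/-- The coins at the diagonal of `Sym2 V` do not influence the graph. -/
lemma prob_graphOf_eq (p : ℝ) (G : SimpleGraph V) :
    prob p (fun F => graphOf F = G) =
      p ^ G.edgeSet.ncard * (1 - p) ^ ((Nat.card V).choose 2 - G.edgeSet.ncard) := by
  have hc : (Nat.card V).choose 2 - G.edgeSet.ncard =
      (Finset.univ.filter fun e : Sym2 V => ¬ e.IsDiag ∧ e ∉ G.edgeSet).card := by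
    rw [Nat.card_eq_fintype_card, ← Sym2.card_diagSet_compl, Fintype.card_eq_nat_card,
      ← Nat.card_coe_set_eq, Nat.card_coe_set_eq, Nat.card_coe_set_eq, ← Set.ncard_sdiff (by simp),
      ← Set.ncard_coe_finset]
    congr 1
    ext e; simp
  have hc' : G.edgeSet.ncard = (Finset.univ.filter fun e : Sym2 V => e ∈ G.edgeSet).card := by
    rw [← Set.ncard_coe_finset]
    congr 1
    ext e; simp
  rw [hc, hc', ← prob_subset_and_disjoint]
  · refine prob_congr fun F => ?_
    constructor
    · rintro rfl
      constructor
      · intro e he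
        induction e with | _ u v =>
        have : (graphOf F).Adj u v := by simpa using he
        exact (graphOf_adj.1 this).1
      · intro e he heF
        induction e with | _ u v =>
        simp only [Finset.mem_filter, Finset.mem_univ, true_and, SimpleGraph.mem_edgeSet,
          Sym2.mk_isDiag_iff] at he
        exact he.2 (graphOf_adj.2 ⟨heF, he.1⟩)
    · rintro ⟨h1, h2⟩
      ext u v
      rw [graphOf_adj]
      constructor
      · rintro ⟨huv, hne⟩
        by_contra h
        exact h2 s(u, v) (by simp [hne, h]) huv
      · intro h
        exact ⟨h1 s(u, v) (by simpa using h), h.ne⟩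
  · rw [Finset.disjoint_left]
    intro e he he'
    simp only [Finset.mem_filter, Finset.mem_univ, true_and] at he he'
    exact he'.2 he

lemma binomialRandom_real_eq_prob (p : unitInterval) (A : SimpleGraph V → Prop) :
    (SimpleGraph.binomialRandom V p).real {G | A G} = prob (p : ℝ) fun F => A (graphOf F) := by
  have : Fintype (SimpleGraph V) := Fintype.ofFinite _
  have : MeasurableSingletonClass (SimpleGraph V) := ⟨fun G => by
    convert SimpleGraph.measurable_edgeSet (MeasurableSet.singleton G.edgeSet)
    ext H; simp⟩
  have h1 : ∀ G : SimpleGraph V, (SimpleGraph.binomialRandom V p).real {G} =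
      prob (p : ℝ) (fun F => graphOf F = G) := by
    intro G
    rw [prob_graphOf_eq, MeasureTheory.measureReal_def, SimpleGraph.binomialRandom_singleton]
    simp
  have h2 : {G : SimpleGraph V | A G} =
      ((Finset.univ.filter A : Finset (SimpleGraph V)) : Set _) := by
    ext; simp
  rw [h2, ← MeasureTheory.sum_measureReal_singleton, Finset.sum_congr rfl fun G _ => h1 G]
  unfold prob
  rw [← expect_sum]
  congr 1
  ext F
  rw [Finset.sum_ite_eq]
  simp

/-- An event holds a.a.s. as soon as the probability of its failure is eventually bounded by a
null sequence. -/
lemma holdsAAS_of_prob_not_le {p : ℕ → unitInterval} {P : ∀ n : ℕ, SimpleGraph (Fin n) → Prop}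
    {f : ℕ → ℝ} (hf : Tendsto f atTop (𝓝 0))
    (h : ∀ᶠ n in atTop, prob (p n : ℝ) (fun F => ¬ P n (graphOf F)) ≤ f n) : HoldsAAS p P := by
  have h1 : ∀ n, SimpleGraph.binomialRandom (Fin n) (p n) {G | P n G} =
      ENNReal.ofReal (1 - prob (p n : ℝ) (fun F => ¬ P n (graphOf F))) := by
    intro n
    rw [prob_not, sub_sub_cancel, ← binomialRandom_real_eq_prob, MeasureTheory.measureReal_def,
      ENNReal.ofReal_toReal (by simp)]
  unfold HoldsAAS
  simp only [h1]
  rw [← ENNReal.ofReal_one]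
  refine ENNReal.tendsto_ofReal ?_
  have h2 : Tendsto (fun n => prob (p n : ℝ) (fun F => ¬ P n (graphOf F))) atTop (𝓝 0) :=
    tendsto_of_tendsto_of_tendsto_of_le_of_le' tendsto_const_nhds hf
      (Eventually.of_forall fun n => prob_nonneg (p n).2.1 (p n).2.2 _) h
  simpa using tendsto_const_nhds.sub h2

lemma HoldsAAS.mono {p : ℕ → unitInterval} {P Q : ∀ n : ℕ, SimpleGraph (Fin n) → Prop}
    (hP : HoldsAAS p P) (h : ∀ᶠ n in atTop, ∀ G, P n G → Q n G) : HoldsAAS p Q := by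
  refine tendsto_of_tendsto_of_tendsto_of_le_of_le' hP tendsto_const_nhds
    (h.mono fun n hn => MeasureTheory.measure_mono (hn ·)) (Eventually.of_forall fun n => ?_)
  exact MeasureTheory.prob_le_one

lemma HoldsAAS.tendsto_prob_not {p : ℕ → unitInterval}
    {P : ∀ n : ℕ, SimpleGraph (Fin n) → Prop} (hP : HoldsAAS p P) :
    Tendsto (fun n => prob (p n : ℝ) (fun F => ¬ P n (graphOf F))) atTop (𝓝 0) := by
  have h1 : ∀ n, prob (p n : ℝ) (fun F => ¬ P n (graphOf F)) =
      1 - (SimpleGraph.binomialRandom (Fin n) (p n) {G | P n G}).toReal := by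
    intro n
    rw [prob_not, ← binomialRandom_real_eq_prob, MeasureTheory.measureReal_def]
  simp only [h1]
  have := (ENNReal.tendsto_toReal ENNReal.one_ne_top).comp hP
  simpa using (tendsto_const_nhds (x := (1 : ℝ))).sub this

lemma HoldsAAS.and {p : ℕ → unitInterval} {P Q : ∀ n : ℕ, SimpleGraph (Fin n) → Prop}
    (hP : HoldsAAS p P) (hQ : HoldsAAS p Q) : HoldsAAS p fun n G => P n G ∧ Q n G := by
  have h := hP.tendsto_prob_not.add hQ.tendsto_prob_not
  rw [add_zero] at h
  refine holdsAAS_of_prob_not_le h (Eventually.of_forall fun n => ?_)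
  refine le_trans (prob_mono (p n).2.1 (p n).2.2 fun F hF => ?_)
    (prob_or_le (p n).2.1 (p n).2.2 _ _)
  tauto

end RandomGraph

section StaticProperties

open scoped Classical

/-! ### Adjacency patterns of the random graph -/

variable {V : Type*}

/-- The pairs consisting of `s` and an element of `W`. -/
noncomputable def starPairs (s : V) (W : Finset V) : Finset (Sym2 V) :=
  W.image fun w => s(s, w)

lemma mem_starPairs {s w : V} {W : Finset V} (hw : w ∈ W) : s(s, w) ∈ starPairs s W :=
  Finset.mem_image_of_mem _ hw

lemma card_starPairs (s : V) (W : Finset V) : (starPairs s W).card = W.card :=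
  Finset.card_image_of_injective _ fun _ _ h => Sym2.congr_right.1 h

lemma disjoint_starPairs {s s' : V} {W : Finset V} (hs : s ∉ W) (h : s ≠ s') :
    Disjoint (starPairs s W) (starPairs s' W) := by
  simp only [starPairs, Finset.disjoint_left, Finset.mem_image]
  rintro e ⟨w, hw, rfl⟩ ⟨w', hw', he⟩
  simp only [Sym2.eq_iff] at he
  rcases he with ⟨he, -⟩ | ⟨-, he⟩
  exacts [h he.symm, hs (he ▸ hw')]

lemma disjoint_starPairs' {s : V} {W W' : Finset V} (h : Disjoint W W') :
    Disjoint (starPairs s W) (starPairs s W') := by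
  simp only [starPairs, Finset.disjoint_left, Finset.mem_image]
  rintro e ⟨w, hw, rfl⟩ ⟨w', hw', he⟩
  have : w' = w := Sym2.congr_right.1 he
  exact Finset.disjoint_left.1 h hw (this ▸ hw')

lemma determinedOn_adj {s : V} {W : Finset V} (P : (V → Prop) → Prop)
    (hP : ∀ f g : V → Prop, (∀ w ∈ W, f w ↔ g w) → (P f ↔ P g)) :
    DeterminedOn (starPairs s W) fun F => P fun w => (graphOf F).Adj s w := by
  intro F F' h
  refine propext (hP _ _ fun w hw => ?_)
  rw [graphOf_adj, graphOf_adj, h _ (mem_starPairs hw)]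

variable [Fintype V]

lemma prob_forall_not_adj (p : ℝ) {s : V} {W : Finset V} (hs : s ∉ W) :
    prob p (fun F => ∀ w ∈ W, ¬ (graphOf F).Adj s w) = (1 - p) ^ W.card := by
  have h := prob_subset_and_disjoint p (Finset.disjoint_empty_left (starPairs s W))
  rw [Finset.card_empty, pow_zero, one_mul, card_starPairs] at h
  rw [← h]
  refine prob_congr fun F => ?_
  simp only [graphOf_adj, starPairs, Finset.mem_image, Finset.notMem_empty, false_imp_iff,
    implies_true, true_and, forall_exists_index, and_imp, forall_apply_eq_imp_iff₂]
  refine forall₂_congr fun w hw => ?_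
  have : s ≠ w := by rintro rfl; exact hs hw
  simp [this]

lemma prob_adj_and_forall_not_adj (p : ℝ) {s u : V} {W : Finset V} (hs : s ∉ W) (hu : u ∉ W)
    (hsu : s ≠ u) :
    prob p (fun F => (graphOf F).Adj s u ∧ ∀ w ∈ W, ¬ (graphOf F).Adj s w) =
      p * (1 - p) ^ W.card := by
  have h := prob_subset_and_disjoint p (B := starPairs s {u}) (A := starPairs s W)
    (disjoint_starPairs' (by simpa using hu))
  rw [card_starPairs, card_starPairs, Finset.card_singleton, pow_one] at h
  rw [← h]
  refine prob_congr fun F => ?_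
  simp only [graphOf_adj, starPairs, Finset.mem_image, Finset.mem_singleton, exists_eq_left,
    forall_exists_index, and_imp, forall_apply_eq_imp_iff₂, forall_eq']
  refine and_congr (by simp [hsu]) (forall₂_congr fun w hw => ?_)
  have : s ≠ w := by rintro rfl; exact hs hw
  simp [this]

lemma prob_adj (p : ℝ) {s u : V} (hsu : s ≠ u) :
    prob p (fun F => (graphOf F).Adj s u) = p := by
  have := prob_adj_and_forall_not_adj p (W := ∅) (Finset.notMem_empty s) (Finset.notMem_empty u) hsu
  simpa using this

lemma prob_exists_adj_and_forall_not_adj (p : ℝ) {s : V} {W₁ W₂ : Finset V}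
    (hW : Disjoint W₁ W₂) (h1 : s ∉ W₁) (h2 : s ∉ W₂) :
    prob p (fun F => (∃ w ∈ W₁, (graphOf F).Adj s w) ∧ ∀ w ∈ W₂, ¬ (graphOf F).Adj s w) =
      (1 - (1 - p) ^ W₁.card) * (1 - p) ^ W₂.card := by
  have h : prob p (fun F => (∃ w ∈ W₁, (graphOf F).Adj s w) ∧ ∀ w ∈ W₂, ¬ (graphOf F).Adj s w) +
      prob p (fun F => ∀ w ∈ W₁ ∪ W₂, ¬ (graphOf F).Adj s w) =
      prob p (fun F => ∀ w ∈ W₂, ¬ (graphOf F).Adj s w) := by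
    unfold prob
    rw [← expect_add]
    congr 1
    ext F
    by_cases hA : ∀ w ∈ W₂, ¬ (graphOf F).Adj s w
    · by_cases hB : ∃ w ∈ W₁, (graphOf F).Adj s w
      · have : ¬ ∀ w ∈ W₁ ∪ W₂, ¬ (graphOf F).Adj s w := by
          obtain ⟨w, hw, hB⟩ := hB
          exact fun h => h w (Finset.mem_union_left _ hw) hB
        rw [if_pos ⟨hB, hA⟩, if_neg this, if_pos hA, add_zero]
      · have : ∀ w ∈ W₁ ∪ W₂, ¬ (graphOf F).Adj s w := by
          intro w hw hadj
          rcases Finset.mem_union.1 hw with hw | hw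
          exacts [hB ⟨w, hw, hadj⟩, hA w hw hadj]
        rw [if_neg fun h => hB h.1, if_pos this, if_pos hA, zero_add]
    · have : ¬ ∀ w ∈ W₁ ∪ W₂, ¬ (graphOf F).Adj s w :=
        fun h => hA fun w hw => h w (Finset.mem_union_right _ hw)
      rw [if_neg fun h => hA h.2, if_neg this, if_neg hA, zero_add]
  rw [prob_forall_not_adj p h2, prob_forall_not_adj p (by simp [h1, h2]),
    Finset.card_union_of_disjoint hW, pow_add] at h
  linear_combination h

/-! ### Properties that hold simultaneously for all vertex sets -/

/-- The vertices outside `W₁ ∪ W₂` with a neighbour in `W₁` and none in `W₂`. -/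
noncomputable def exclusiveNbrs (G : SimpleGraph V) (W₁ W₂ : Finset V) : Finset V :=
  (W₁ ∪ W₂)ᶜ.filter fun s => (∃ w ∈ W₁, G.Adj s w) ∧ ∀ w ∈ W₂, ¬ G.Adj s w

/-- The vertices outside `W` without a neighbour in `W`. -/
noncomputable def nonNbrs (G : SimpleGraph V) (W : Finset V) : Finset V :=
  Wᶜ.filter fun s => ∀ w ∈ W, ¬ G.Adj s w

/-- All degrees are at most `D`. -/
def DegreeLE (G : SimpleGraph V) (D : ℝ) : Prop :=
  ∀ v, ((Finset.univ.filter fun u => G.Adj v u).card : ℝ) ≤ D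

/-- The expected number of vertices that have a neighbour in a set of size `m₁`, and none in a
disjoint set of size `m₂`. -/
noncomputable def exclusiveMean (n : ℕ) (p : ℝ) (m₁ m₂ : ℕ) : ℝ :=
  (n - m₁ - m₂) * ((1 - (1 - p) ^ m₁) * (1 - p) ^ m₂)

/-- The number of exclusive neighbours is at least `1 - δ` times its expectation, for all pairs of
sets for which this expectation is large enough for a union bound over all pairs of sets. -/
def Expanding (G : SimpleGraph V) (p δ : ℝ) : Prop :=
  ∀ W₁ W₂ : Finset V, Disjoint W₁ W₂ → (W₁ ∪ W₂).Nonempty →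
    4 * (W₁.card + W₂.card) * Real.log (Fintype.card V) ≤
      δ ^ 2 * exclusiveMean (Fintype.card V) p W₁.card W₂.card →
    (1 - δ) * exclusiveMean (Fintype.card V) p W₁.card W₂.card ≤ (exclusiveNbrs G W₁ W₂).card

/-- The number of vertices without a neighbour in `W` is at least half its expectation, for all
sets `W` for which this expectation is large enough for a union bound over all sets. -/
def Avoidable (G : SimpleGraph V) (p : ℝ) : Prop :=
  ∀ W : Finset V, W.Nonempty →
    16 * W.card * Real.log (Fintype.card V) ≤
      (Fintype.card V - W.card) * (1 - p) ^ W.card →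
    (Fintype.card V - W.card) * (1 - p) ^ W.card / 2 ≤ (nonNbrs G W).card

/-- There is an edge between any two disjoint sets whose expected number of joining edges is at
least twice the number of vertices. -/
def Joined (G : SimpleGraph V) (p : ℝ) : Prop :=
  ∀ W T : Finset V, Disjoint W T → 2 * (Fintype.card V : ℝ) ≤ p * (W.card * T.card) →
    ∃ w ∈ W, ∃ t ∈ T, G.Adj w t

lemma prob_not_degreeLE_le {p δ : ℝ} (h0 : 0 ≤ p) (h1 : p ≤ 1) (hδ : 0 ≤ δ) (hδ1 : δ ≤ 1) :
    prob p (fun F => ¬ DegreeLE (graphOf F : SimpleGraph V) ((1 + δ) * (p * Fintype.card V))) ≤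
      Fintype.card V * Real.exp (-(δ ^ 2 * (p * Fintype.card V) / 4)) := by
  have h : ∀ v : V, prob p (fun F => (1 + δ) * (p * Fintype.card V) <
      (((Finset.univ.erase v).filter fun u => (graphOf F).Adj v u).card : ℝ)) ≤
      Real.exp (-(δ ^ 2 * (p * Fintype.card V) / 4)) := by
    intro v
    refine prob_lt_card_le h0 h1 hδ hδ1 (Finset.univ.erase v) (fun u => starPairs v {u})
      (fun u F => (graphOf F).Adj v u) (q := p) ?_ ?_ ?_ ?_ (by positivity)
    · intro u _ u' _ huu
      exact disjoint_starPairs' (by simpa using huu)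
    · intro u _
      exact determinedOn_adj (fun f => f u) fun f g h => h u (by simp)
    · intro u hu
      rw [prob_adj p (Finset.ne_of_mem_erase hu).symm]
    · rw [mul_comm]
      refine mul_le_mul_of_nonneg_left ?_ h0
      exact_mod_cast Finset.card_le_univ _
  refine (prob_mono h0 h1 (B := fun F => ∃ v ∈ (Finset.univ : Finset V),
    (1 + δ) * (p * Fintype.card V) <
      (((Finset.univ.erase v).filter fun u => (graphOf F).Adj v u).card : ℝ)) fun F hF => ?_).trans
    ((prob_exists_le h0 h1 _ _).trans ((Finset.sum_le_sum fun v _ => h v).trans ?_))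
  · simp only [DegreeLE, not_forall, not_le] at hF
    obtain ⟨v, hv⟩ := hF
    refine ⟨v, Finset.mem_univ _, hv.trans_le (Nat.cast_le.2 (Finset.card_le_card ?_))⟩
    intro u hu
    have hadj : (graphOf F).Adj v u := by simpa using hu
    simp [hadj, hadj.ne']
  · simp

/-- The sum of `n ^ (-2 |W|)` over the non-empty subsets `W` of a set of size `m ≤ 2 n`. -/
lemma one_add_exp_pow_sub_one_le {n m : ℕ} (hn : 0 < n) (hm : 0 < m) (hmn : m ≤ 2 * n)
    (hn2 : 2 ≤ n) :
    (1 + Real.exp (-(2 * Real.log n))) ^ m - 1 ≤ 4 / n := by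
  have hn0 : (0 : ℝ) < n := by exact_mod_cast hn
  have he : Real.exp (-(2 * Real.log n)) = 1 / (n : ℝ) ^ 2 := by
    rw [Real.exp_neg, two_mul, Real.exp_add, Real.exp_log hn0, one_div, sq]
  rw [he]
  have h1 : (1 + 1 / (n : ℝ) ^ 2) ^ m ≤ Real.exp (m * (1 / (n : ℝ) ^ 2)) := by
    rw [Real.exp_nat_mul]
    refine pow_le_pow_left₀ (by positivity) ?_ _
    linarith [Real.add_one_le_exp (1 / (n : ℝ) ^ 2)]
  have h2 : m * (1 / (n : ℝ) ^ 2) ≤ 2 / n := by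
    rw [mul_one_div, div_le_div_iff₀ (by positivity) hn0]
    have : (m : ℝ) ≤ 2 * n := by exact_mod_cast hmn
    nlinarith [mul_le_mul_of_nonneg_right this hn0.le]
  have h3 : (2 : ℝ) / n ≤ 1 := by
    rw [div_le_one hn0]; exact_mod_cast hn2
  have h4 := Real.abs_exp_sub_one_le (x := m * (1 / (n : ℝ) ^ 2))
    (by rw [abs_of_nonneg (by positivity)]; linarith)
  rw [abs_of_nonneg (a := (m : ℝ) * (1 / (n : ℝ) ^ 2)) (by positivity)] at h4
  have h5 := (abs_le.1 h4).2
  have h6 : 4 / (n : ℝ) = 2 * (2 / n) := by ring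
  linarith

lemma sum_pow_card_eq (t : ℝ) : ∑ W : Finset V, t ^ W.card = (1 + t) ^ Fintype.card V := by
  have := Finset.sum_pow_mul_eq_add_pow t 1 (Finset.univ : Finset V)
  simpa [add_comm] using this

/-- For a fixed pair of sets, Chernoff's bound gives a failure probability of at most
`n ^ (-2 (|W₁| + |W₂|))`, and these numbers have a small sum over all pairs. -/
lemma prob_not_expanding_le {p δ : ℝ} (h0 : 0 ≤ p) (h1 : p ≤ 1) (hδ : 0 ≤ δ)
    (hn : 2 ≤ Fintype.card V) :
    prob p (fun F => ¬ Expanding (graphOf F : SimpleGraph V) p δ) ≤ 4 / Fintype.card V := by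
  set n := Fintype.card V with hn_def
  set t := Real.exp (-(2 * Real.log n)) with ht
  set I : Finset (Finset V × Finset V) := Finset.univ.filter fun x =>
    Disjoint x.1 x.2 ∧ (x.1 ∪ x.2).Nonempty ∧
    4 * (x.1.card + x.2.card) * Real.log n ≤ δ ^ 2 * exclusiveMean n p x.1.card x.2.card with hI
  have key : ∀ x ∈ I, prob p (fun F => ((exclusiveNbrs (graphOf F) x.1 x.2).card : ℝ) <
      (1 - δ) * exclusiveMean n p x.1.card x.2.card) ≤ t ^ (x.1.card + x.2.card) := by
    rintro ⟨W₁, W₂⟩ hx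
    simp only [hI, Finset.mem_filter, Finset.mem_univ, true_and] at hx
    obtain ⟨hd, -, hlog⟩ := hx
    have hmean : exclusiveMean n p W₁.card W₂.card = ((W₁ ∪ W₂)ᶜ.card : ℝ) *
        ((1 - (1 - p) ^ W₁.card) * (1 - p) ^ W₂.card) := by
      rw [exclusiveMean, Finset.card_compl, Finset.card_union_of_disjoint hd,
        Nat.cast_sub (by rw [← Finset.card_union_of_disjoint hd]; exact Finset.card_le_univ _)]
      push_cast
      ring
    have hp1 : ∀ m : ℕ, 0 ≤ (1 - p) ^ m := fun m => pow_nonneg (by linarith) m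
    have hp2 : ∀ m : ℕ, (1 - p) ^ m ≤ 1 := fun m => pow_le_one₀ (by linarith) (by linarith)
    have := prob_card_lt_le h0 h1 hδ
      (q := (1 - (1 - p) ^ W₁.card) * (1 - p) ^ W₂.card)
      (mul_nonneg (by linarith [hp2 W₁.card]) (hp1 _))
      (W₁ ∪ W₂)ᶜ (fun s => starPairs s (W₁ ∪ W₂))
      (fun s F => (∃ w ∈ W₁, (graphOf F).Adj s w) ∧ ∀ w ∈ W₂, ¬ (graphOf F).Adj s w)
      (fun s hs s' _ hss => disjoint_starPairs (by simpa using hs) hss)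
      (fun s _ => determinedOn_adj (fun f => (∃ w ∈ W₁, f w) ∧ ∀ w ∈ W₂, ¬ f w) fun f g h => by
        refine and_congr (exists_congr fun w => and_congr_right fun hw => ?_)
          (forall₂_congr fun w hw => not_congr ?_)
        exacts [h w (Finset.mem_union_left _ hw), h w (Finset.mem_union_right _ hw)])
      (fun s hs => by
        simp only [Finset.mem_compl, Finset.mem_union, not_or] at hs
        rw [prob_exists_adj_and_forall_not_adj p hd hs.1 hs.2])
    rw [← hmean] at this
    refine (prob_congr fun F => ?_).trans_le (this.trans ?_)
    · simp only [exclusiveNbrs]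
      congr!
    rw [ht, ← Real.exp_nat_mul]
    apply Real.exp_le_exp.2
    push_cast
    linarith
  refine (prob_mono h0 h1 (B := fun F => ∃ x ∈ I,
    ((exclusiveNbrs (graphOf F) x.1 x.2).card : ℝ) <
      (1 - δ) * exclusiveMean n p x.1.card x.2.card) fun F hF => ?_).trans
    ((prob_exists_le h0 h1 _ _).trans ((Finset.sum_le_sum key).trans ?_))
  · simp only [Expanding, not_forall, not_le] at hF
    obtain ⟨W₁, W₂, hd, hne, hlog, hlt⟩ := hF
    exact ⟨(W₁, W₂), by
      rw [hI, Finset.mem_filter]; exact ⟨Finset.mem_univ _, hd, hne, hlog⟩, hlt⟩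
  · have hsub : I ⊆ Finset.univ.erase (∅, ∅) := by
      intro x hx
      simp only [hI, Finset.mem_filter] at hx
      refine Finset.mem_erase.2 ⟨?_, Finset.mem_univ _⟩
      rintro rfl
      simp at hx
    refine (Finset.sum_le_sum_of_subset_of_nonneg hsub fun _ _ _ => by positivity).trans ?_
    have hsum : ∑ x : Finset V × Finset V, t ^ (x.1.card + x.2.card) = (1 + t) ^ (n + n) := by
      simp only [Fintype.sum_prod_type, pow_add, ← Finset.mul_sum, ← Finset.sum_mul,
        sum_pow_card_eq, hn_def]
    have := Finset.add_sum_erase Finset.univ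
      (fun x : Finset V × Finset V => t ^ (x.1.card + x.2.card)) (Finset.mem_univ (∅, ∅))
    rw [hsum] at this
    simp only [Finset.card_empty, add_zero, pow_zero] at this
    have h5 := one_add_exp_pow_sub_one_le (n := n) (m := n + n) (by omega) (by omega) (by omega) hn
    rw [← ht] at h5
    linarith

lemma prob_not_avoidable_le {p : ℝ} (h0 : 0 ≤ p) (h1 : p ≤ 1) (hn : 2 ≤ Fintype.card V) :
    prob p (fun F => ¬ Avoidable (graphOf F : SimpleGraph V) p) ≤ 4 / Fintype.card V := by
  set n := Fintype.card V with hn_def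
  set t := Real.exp (-(2 * Real.log n)) with ht
  set I : Finset (Finset V) := Finset.univ.filter fun W => W.Nonempty ∧
    16 * W.card * Real.log n ≤ (n - W.card) * (1 - p) ^ W.card with hI
  have key : ∀ W ∈ I, prob p (fun F => ((nonNbrs (graphOf F) W).card : ℝ) <
      (1 - 1 / 2) * ((Wᶜ.card : ℝ) * (1 - p) ^ W.card)) ≤ t ^ W.card := by
    intro W hx
    simp only [hI, Finset.mem_filter, Finset.mem_univ, true_and] at hx
    have hW : (Wᶜ.card : ℝ) = n - W.card := by
      rw [Finset.card_compl, Nat.cast_sub (Finset.card_le_univ _)]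
    have := prob_card_lt_le h0 h1 (δ := 1 / 2) (by norm_num)
      (q := (1 - p) ^ W.card) (pow_nonneg (by linarith) _) Wᶜ (fun s => starPairs s W)
      (fun s F => ∀ w ∈ W, ¬ (graphOf F).Adj s w)
      (fun s hs s' _ hss => disjoint_starPairs (by simpa using hs) hss)
      (fun s _ => determinedOn_adj (fun f => ∀ w ∈ W, ¬ f w) fun f g h =>
        forall₂_congr fun w hw => not_congr (h w hw))
      (fun s hs => by rw [prob_forall_not_adj p (by simpa using hs)])
    refine (prob_congr fun F => ?_).trans_le (this.trans ?_)
    · simp only [nonNbrs]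
      congr!
    rw [ht, ← Real.exp_nat_mul, hW]
    apply Real.exp_le_exp.2
    linarith [hx.2]
  refine (prob_mono h0 h1 (B := fun F => ∃ W ∈ I, ((nonNbrs (graphOf F) W).card : ℝ) <
      (1 - 1 / 2) * ((Wᶜ.card : ℝ) * (1 - p) ^ W.card)) fun F hF => ?_).trans
    ((prob_exists_le h0 h1 _ _).trans ((Finset.sum_le_sum key).trans ?_))
  · simp only [Avoidable, not_forall, not_le] at hF
    obtain ⟨W, hne, hlog, hlt⟩ := hF
    refine ⟨W, by rw [hI, Finset.mem_filter]; exact ⟨Finset.mem_univ _, hne, hlog⟩, ?_⟩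
    rw [Finset.card_compl, Nat.cast_sub (Finset.card_le_univ _)]
    linarith
  · have hsub : I ⊆ Finset.univ.erase ∅ := by
      intro x hx
      simp only [hI, Finset.mem_filter] at hx
      exact Finset.mem_erase.2 ⟨hx.2.1.ne_empty, Finset.mem_univ _⟩
    refine (Finset.sum_le_sum_of_subset_of_nonneg hsub fun _ _ _ => by positivity).trans ?_
    have := Finset.add_sum_erase Finset.univ
      (fun x : Finset V => t ^ x.card) (Finset.mem_univ ∅)
    rw [sum_pow_card_eq, ← hn_def] at this
    simp only [Finset.card_empty, pow_zero] at this
    have h5 := one_add_exp_pow_sub_one_le (n := n) (m := n) (by omega) (by omega) (by omega) hn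
    rw [← ht] at h5
    linarith

/-- For a fixed pair of sets the failure probability is at most `exp (-2 n)`, and there are `4 ^ n`
pairs of sets. -/
lemma prob_not_joined_le {p : ℝ} (h0 : 0 ≤ p) (h1 : p ≤ 1) :
    prob p (fun F => ¬ Joined (graphOf F : SimpleGraph V) p) ≤
      (4 * Real.exp (-2)) ^ Fintype.card V := by
  set n := Fintype.card V with hn_def
  set I : Finset (Finset V × Finset V) := Finset.univ.filter fun x =>
    Disjoint x.1 x.2 ∧ 2 * (n : ℝ) ≤ p * (x.1.card * x.2.card) with hI
  have key : ∀ x ∈ I, prob p (fun F => ∀ w ∈ x.1, ∀ t ∈ x.2, ¬ (graphOf F).Adj w t) ≤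
      Real.exp (-2) ^ n := by
    rintro ⟨W, T⟩ hx
    simp only [hI, Finset.mem_filter, Finset.mem_univ, true_and] at hx
    set E : Finset (Sym2 V) := (W ×ˢ T).image fun y => s(y.1, y.2) with hE
    have hcard : E.card = W.card * T.card := by
      rw [hE, Finset.card_image_of_injOn, Finset.card_product]
      rintro ⟨a, b⟩ hab ⟨a', b'⟩ hab' h
      simp only [Finset.coe_product, Set.mem_prod, Finset.mem_coe] at hab hab'
      simp only [Sym2.eq_iff] at h
      rcases h with ⟨rfl, rfl⟩ | ⟨rfl, rfl⟩
      · rfl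
      · exact absurd hab'.2 (Finset.disjoint_left.1 hx.1 hab.1)
    have h := prob_subset_and_disjoint p (Finset.disjoint_empty_left E)
    rw [Finset.card_empty, pow_zero, one_mul, hcard] at h
    refine (prob_mono h0 h1 fun F hF => ?_).trans (h.le.trans ?_)
    · refine ⟨by simp, fun e he heF => ?_⟩
      simp only [hE, Finset.mem_image, Finset.mem_product] at he
      obtain ⟨⟨a, b⟩, ⟨ha, hb⟩, rfl⟩ := he
      refine hF a ha b hb (graphOf_adj.2 ⟨heF, ?_⟩)
      rintro rfl
      exact Finset.disjoint_left.1 hx.1 ha hb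
    · have h3 : 1 - p ≤ Real.exp (-p) := by linarith [Real.add_one_le_exp (-p)]
      refine (pow_le_pow_left₀ (by linarith) h3 _).trans ?_
      rw [← Real.exp_nat_mul, ← Real.exp_nat_mul]
      apply Real.exp_le_exp.2
      push_cast
      linarith [hx.2]
  refine (prob_mono h0 h1 (B := fun F => ∃ x ∈ I, ∀ w ∈ x.1, ∀ t ∈ x.2,
    ¬ (graphOf F).Adj w t) fun F hF => ?_).trans
    ((prob_exists_le h0 h1 _ _).trans ((Finset.sum_le_sum key).trans ?_))
  · simp only [Joined, not_forall] at hF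
    obtain ⟨W, T, hd, hle, hno⟩ := hF
    push Not at hno
    exact ⟨(W, T), by simp [hI, hd, hle, hn_def], hno⟩
  · rw [Finset.sum_const, nsmul_eq_mul, mul_pow]
    refine mul_le_mul_of_nonneg_right ?_ (by positivity)
    have : I.card ≤ 4 ^ n := by
      refine (Finset.card_le_univ _).trans ?_
      rw [Fintype.card_prod, Fintype.card_finset, ← hn_def, ← mul_pow]
      norm_num
    exact_mod_cast this

end StaticProperties

section Collisions

open scoped Classical

/-! ### Collisions in the neighbourhood of a vertex -/

variable {V : Type*}

/-- The graph `G` with all the edges at vertices of `Z` removed. -/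
def isolate (G : SimpleGraph V) (Z : Finset V) : SimpleGraph V where
  Adj u w := G.Adj u w ∧ u ∉ Z ∧ w ∉ Z
  symm := ⟨fun _ _ h => ⟨h.1.symm, h.2.2, h.2.1⟩⟩
  loopless := ⟨fun _ h => h.1.ne rfl⟩

lemma isolate_adj {G : SimpleGraph V} {Z : Finset V} {u w : V} :
    (isolate G Z).Adj u w ↔ G.Adj u w ∧ u ∉ Z ∧ w ∉ Z := Iff.rfl

lemma isolate_le (G : SimpleGraph V) (Z : Finset V) : isolate G Z ≤ G := fun _ _ h => h.1

/-- No two neighbours of `v` in `U` have the same value under `c`. -/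
def NoCollision {γ : Type*} (G : SimpleGraph V) (v : V) (U : Finset V) (c : V → γ) : Prop :=
  ∀ u ∈ U, ∀ u' ∈ U, G.Adj v u → G.Adj v u' → c u = c u' → u = u'

/-- The exponent in the bound `exp (-collisionRate t)` for the probability that at most one
element of a set of size `a` is chosen, where `t = p (a - 1)`. -/
noncomputable def collisionRate (t : ℝ) : ℝ := t ^ 2 / (2 * (1 + t))

/-- The sum of the collision rates of the colour classes of `c` in `U`. -/
noncomputable def totalRate {γ : Type*} (p : ℝ) (U : Finset V) (c : V → γ) : ℝ :=
  ∑ x ∈ U.image c, collisionRate (p * ((U.filter fun u => c u = x).card - 1))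

/-- The number of ordered pairs of elements of `U` with the same colour. -/
noncomputable def equalPairs {γ : Type*} (U : Finset V) (c : V → γ) : ℝ :=
  ∑ x ∈ U.image c, ((U.filter fun u => c u = x).card : ℝ) ^ 2

/-- Equivalent to `log (1 + t) ≤ sinh (log (1 + t))`. -/
lemma one_add_mul_exp_neg_le {t : ℝ} (ht : 0 ≤ t) :
    (1 + t) * Real.exp (-t) ≤ Real.exp (-collisionRate t) := by
  have h1 : 0 < 1 + t := by linarith
  have hl : 0 ≤ Real.log (1 + t) := Real.log_nonneg (by linarith)
  have h2 := Real.self_le_sinh_iff.2 hl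
  rw [Real.sinh_eq, Real.exp_log h1, Real.exp_neg, Real.exp_log h1] at h2
  have h3 : (1 + t - (1 + t)⁻¹) / 2 = t - collisionRate t := by
    rw [collisionRate]; field_simp; ring
  rw [h3] at h2
  rw [show (1 + t) * Real.exp (-t) = Real.exp (Real.log (1 + t) + -t) by
    rw [Real.exp_add, Real.exp_log h1]]
  exact Real.exp_le_exp.2 (by linarith)

lemma collisionRate_nonneg {t : ℝ} (ht : 0 ≤ t) : 0 ≤ collisionRate t := by
  unfold collisionRate; positivity

variable [Fintype V]

/-- The event that a binomial random variable is at most one has the probability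
`(1 - p) ^ (b + 1) + (b + 1) p (1 - p) ^ b = (1 + p b) (1 - p) ^ b`, where `b + 1` is the number of
trials. -/
lemma prob_at_most_one_le {p : ℝ} (h0 : 0 ≤ p) (h1 : p ≤ 1) {v : V} {U : Finset V} (hv : v ∉ U)
    (hU : U.Nonempty) :
    prob p (fun F => ∀ u ∈ U, ∀ u' ∈ U, (graphOf F).Adj v u → (graphOf F).Adj v u' → u = u') ≤
      Real.exp (-collisionRate (p * (U.card - 1))) := by
  obtain ⟨b, hb⟩ : ∃ b, U.card = b + 1 := ⟨U.card - 1, by have := hU.card_pos; omega⟩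
  have key : ∀ u ∈ U, prob p (fun F => (graphOf F).Adj v u ∧
      ∀ w ∈ U.erase u, ¬ (graphOf F).Adj v w) = p * (1 - p) ^ b := by
    intro u hu
    rw [prob_adj_and_forall_not_adj p (fun h => hv (Finset.mem_of_mem_erase h)) (by simp)
      (fun h => hv (h ▸ hu)), Finset.card_erase_of_mem hu, hb, Nat.add_sub_cancel]
  have h2 : prob p (fun F => ∀ u ∈ U, ∀ u' ∈ U, (graphOf F).Adj v u → (graphOf F).Adj v u' →
      u = u') ≤ (1 - p) ^ (b + 1) + (b + 1) * (p * (1 - p) ^ b) := by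
    refine (prob_mono h0 h1 (B := fun F => (∀ w ∈ U, ¬ (graphOf F).Adj v w) ∨
      ∃ u ∈ U, (graphOf F).Adj v u ∧ ∀ w ∈ U.erase u, ¬ (graphOf F).Adj v w)
      fun F hF => ?_).trans ((prob_or_le h0 h1 _ _).trans (add_le_add ?_
        ((prob_exists_le h0 h1 _ _).trans ?_)))
    · by_cases h : ∀ w ∈ U, ¬ (graphOf F).Adj v w
      · exact Or.inl h
      · push Not at h
        obtain ⟨u, hu, huv⟩ := h
        refine Or.inr ⟨u, hu, huv, fun w hw hwv => ?_⟩
        exact Finset.ne_of_mem_erase hw (hF w (Finset.mem_of_mem_erase hw) u hu hwv huv)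
    · rw [prob_forall_not_adj p hv, hb]
    · rw [Finset.sum_congr rfl key, Finset.sum_const, hb, nsmul_eq_mul]
      push_cast
      exact le_rfl
  refine h2.trans ?_
  have h3 : (U.card : ℝ) - 1 = b := by rw [hb]; push_cast; ring
  rw [h3]
  refine le_trans ?_ (one_add_mul_exp_neg_le (t := p * b) (by positivity))
  have h4 : (1 - p) ^ (b + 1) + (b + 1) * (p * (1 - p) ^ b) = (1 + p * b) * (1 - p) ^ b := by ring
  rw [h4]
  refine mul_le_mul_of_nonneg_left ?_ (by positivity)
  rw [mul_comm, ← mul_neg, Real.exp_nat_mul]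
  exact pow_le_pow_left₀ (by linarith) (by linarith [Real.add_one_le_exp (-p)]) _

lemma prob_noCollision_le {γ : Type*} {p : ℝ} (h0 : 0 ≤ p) (h1 : p ≤ 1) {v : V} {U : Finset V}
    (hv : v ∉ U) (c : V → γ) :
    prob p (fun F => NoCollision (graphOf F) v U c) ≤
      Real.exp (-totalRate p U c) := by
  obtain ⟨A, hA⟩ : ∃ A : γ → Finset (Sym2 V) → Prop, A = fun x F =>
    ∀ u ∈ U.filter fun u => c u = x, ∀ u' ∈ U.filter fun u => c u = x,
      (graphOf F).Adj v u → (graphOf F).Adj v u' → u = u' := ⟨_, rfl⟩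
  have hdet : ∀ x, DeterminedOn (starPairs v (U.filter fun u => c u = x)) (A x) := fun x => by
    rw [hA]
    exact determinedOn_adj (fun f => ∀ u ∈ U.filter fun u => c u = x,
      ∀ u' ∈ U.filter fun u => c u = x, f u → f u' → u = u') fun f g h =>
        forall₂_congr fun u hu => forall₂_congr fun u' hu' => by
          rw [h u hu, h u' hu']
  have hprod := expect_prod_of_determinedOn p (U.image c)
    (fun x => starPairs v (U.filter fun u => c u = x))
    (fun x F => if A x F then (1 : ℝ) else 0)
    (fun x _ y _ hxy => disjoint_starPairs' (by
      rw [Finset.disjoint_left]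
      intro u hu hu'
      simp only [Finset.mem_filter] at hu hu'
      exact hxy (hu.2.symm.trans hu'.2)))
    (fun x _ => (hdet x).ite _ _)
  calc prob p (fun F => NoCollision (graphOf F) v U c)
      ≤ expect p (fun F => ∏ x ∈ U.image c, if A x F then (1 : ℝ) else 0) := by
        refine prob_le_expect h0 h1 (fun F => Finset.prod_nonneg fun x _ => by
          split_ifs <;> simp) fun F hF => ?_
        rw [Finset.prod_eq_one]
        intro x _
        rw [if_pos]
        rw [hA]
        intro u hu u' hu' ha ha'
        simp only [Finset.mem_filter] at hu hu'
        exact hF u hu.1 u' hu'.1 ha ha' (hu.2.trans hu'.2.symm)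
    _ = ∏ x ∈ U.image c, prob p (A x) := hprod
    _ ≤ ∏ x ∈ U.image c,
          Real.exp (-collisionRate (p * ((U.filter fun u => c u = x).card - 1))) := by
        refine Finset.prod_le_prod (fun x _ => prob_nonneg h0 h1 _) fun x hx => ?_
        rw [hA]
        refine prob_at_most_one_le h0 h1 (fun h => hv (Finset.mem_of_mem_filter _ h)) ?_
        obtain ⟨u, hu, rfl⟩ := Finset.mem_image.1 hx
        exact ⟨u, by simp [hu]⟩
    _ = _ := by rw [← Real.exp_sum, Finset.sum_neg_distrib, totalRate]

/-- The neighbourhood of `v` is independent of the graph with the edges at `v` removed, hence a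
colouring that depends only on the latter may be regarded as fixed. -/
lemma prob_isolate_noCollision_le {γ : Type*} {p M : ℝ} (h0 : 0 ≤ p) (h1 : p ≤ 1) (v : V)
    (U : SimpleGraph V → Finset V) (c : SimpleGraph V → V → γ) (hv : ∀ H, v ∉ U H) :
    prob p (fun F =>
        M ≤ totalRate p (U (isolate (graphOf F) {v})) (c (isolate (graphOf F) {v})) ∧
        NoCollision (graphOf F) v (U (isolate (graphOf F) {v})) (c (isolate (graphOf F) {v}))) ≤
      Real.exp (-M) := by
  set S : Finset (Sym2 V) := Finset.univ.filter fun e => v ∉ e with hS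
  have hH : ∀ F F', isolate (graphOf (splice S F F')) {v} = isolate (graphOf F) {v} := by
    intro F F'
    ext u w
    simp only [isolate_adj, graphOf_adj, mem_splice, Finset.mem_singleton, hS, Finset.mem_filter,
      Finset.mem_univ, true_and, Sym2.mem_iff, not_or]
    constructor
    · rintro ⟨⟨h | h, hne⟩, hu, hw⟩
      · exact ⟨⟨h.2, hne⟩, hu, hw⟩
      · exact absurd ⟨Ne.symm hu, Ne.symm hw⟩ h.1
    · rintro ⟨⟨h, hne⟩, hu, hw⟩
      exact ⟨⟨Or.inl ⟨⟨Ne.symm hu, Ne.symm hw⟩, h⟩, hne⟩, hu, hw⟩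
  have hN : ∀ F F' u, (graphOf (splice S F F')).Adj v u ↔ (graphOf F').Adj v u := by
    intro F F' u
    simp [graphOf_adj, mem_splice, hS]
  rw [prob, expect_splice p S]
  change expect p (fun F => prob p fun F' => _ ∧ _) ≤ _
  refine (expect_mono h0 h1 (g := fun _ => Real.exp (-M)) fun F => ?_).trans
    (expect_const p _).le
  simp only [hH, NoCollision, hN]
  by_cases hM : M ≤ totalRate p (U (isolate (graphOf F) {v})) (c (isolate (graphOf F) {v}))
  · refine (prob_mono h0 h1 fun F' hF' => hF'.2).trans
      ((prob_noCollision_le h0 h1 (hv _) (c (isolate (graphOf F) {v}))).trans ?_)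
    exact Real.exp_le_exp.2 (neg_le_neg hM)
  · simp only [hM, false_and, prob, if_false, expect_const]
    positivity

end Collisions

section Balls

open scoped Classical

/-! ### Balls and their growth -/

variable {V : Type*}

/-- A walk from `x` to `s` either avoids `v` or passes through it after at least one step. -/
lemma edist_isolate_le_or {G : SimpleGraph V} {v s : V} (hs : s ≠ v) :
    ∀ {x : V} (q : G.Walk x s), x ≠ v →
      (isolate G {v}).edist x s ≤ q.length ∨ G.edist v s + 1 ≤ q.length := by
  intro x q
  induction q with
  | nil => intro _; simp
  | @cons x y s h q ih =>
    intro hx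
    by_cases hy : y = v
    · subst hy
      right
      rw [SimpleGraph.Walk.length_cons, Nat.cast_add, Nat.cast_one]
      exact add_le_add_left (SimpleGraph.edist_le q) 1
    · rcases ih hs hy with h' | h'
      · left
        have hadj : (isolate G {v}).Adj x y := ⟨h, by simpa using hx, by simpa using hy⟩
        have h1 : (isolate G {v}).edist x y ≤ 1 :=
          SimpleGraph.edist_le_one_iff_adj_or_eq.2 (Or.inl hadj)
        rw [SimpleGraph.Walk.length_cons, Nat.cast_add, Nat.cast_one, add_comm]
        exact SimpleGraph.edist_triangle.trans (add_le_add h1 h')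
      · right
        rw [SimpleGraph.Walk.length_cons, Nat.cast_add, Nat.cast_one]
        exact h'.trans le_self_add

/-- The distance from `s` to a neighbour `u` of `v` is determined by the distance from `s` to `u`
in the graph without `v`, together with the distance from `s` to `v`. -/
lemma edist_eq_of_isolate_edist_eq {G : SimpleGraph V} {v s u u' : V} (hs : s ≠ v)
    (hu : G.Adj v u) (hu' : G.Adj v u')
    (h : (isolate G {v}).edist s u = (isolate G {v}).edist s u') : G.edist s u = G.edist s u' := by
  have key : ∀ u u' : V, G.Adj v u → G.Adj v u' →
      (isolate G {v}).edist s u = (isolate G {v}).edist s u' → G.edist s u ≤ G.edist s u' := by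
    intro u u' hu hu' h
    by_cases htop : G.edist s u' = ⊤
    · rw [htop]; exact le_top
    rw [SimpleGraph.edist_comm] at htop
    obtain ⟨q, hq⟩ := SimpleGraph.exists_walk_of_edist_ne_top htop
    rw [SimpleGraph.edist_comm (u := s) (v := u'), ← hq]
    rcases edist_isolate_le_or hs q hu'.ne' with h1 | h1
    · rw [SimpleGraph.edist_comm, ← h] at h1
      exact (SimpleGraph.edist_anti (isolate_le G {v})).trans h1
    · refine le_trans ?_ h1
      rw [SimpleGraph.edist_comm (u := v)]
      refine SimpleGraph.edist_triangle.trans (add_le_add_right ?_ _)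
      exact SimpleGraph.edist_le_one_iff_adj_or_eq.2 (Or.inl hu)
  exact le_antisymm (key u u' hu hu' h) (key u' u hu' hu h.symm)

variable [Fintype V]

/-- The vertices at distance at most `j` from the set `X`. -/
noncomputable def ball (G : SimpleGraph V) (X : Finset V) : ℕ → Finset V
  | 0 => X
  | j + 1 => ball G X j ∪ Finset.univ.filter fun u => ∃ w ∈ ball G X j, G.Adj u w

lemma mem_ball_succ {G : SimpleGraph V} {X : Finset V} {j : ℕ} {u : V} :
    u ∈ ball G X (j + 1) ↔ u ∈ ball G X j ∨ ∃ w ∈ ball G X j, G.Adj u w := by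
  simp [ball]

lemma ball_subset_succ (G : SimpleGraph V) (X : Finset V) (j : ℕ) :
    ball G X j ⊆ ball G X (j + 1) := fun _ h => mem_ball_succ.2 (Or.inl h)

lemma subset_ball (G : SimpleGraph V) (X : Finset V) (j : ℕ) : X ⊆ ball G X j := by
  induction j with
  | zero => exact subset_rfl
  | succ j ih => exact ih.trans (ball_subset_succ G X j)

lemma ball_union (G : SimpleGraph V) (X Y : Finset V) (j : ℕ) :
    ball G (X ∪ Y) j = ball G X j ∪ ball G Y j := by
  induction j with
  | zero => rfl
  | succ j ih =>
    ext u
    simp only [mem_ball_succ, ih, Finset.mem_union]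
    constructor
    · rintro ((h | h) | ⟨w, hw | hw, h⟩)
      exacts [Or.inl (Or.inl h), Or.inr (Or.inl h), Or.inl (Or.inr ⟨w, hw, h⟩),
        Or.inr (Or.inr ⟨w, hw, h⟩)]
    · rintro ((h | ⟨w, hw, h⟩) | (h | ⟨w, hw, h⟩))
      exacts [Or.inl (Or.inl h), Or.inr ⟨w, Or.inl hw, h⟩, Or.inl (Or.inr h),
        Or.inr ⟨w, Or.inr hw, h⟩]

lemma mem_ball_singleton {G : SimpleGraph V} {s u : V} {j : ℕ} :
    u ∈ ball G {s} j ↔ G.edist s u ≤ j := by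
  induction j generalizing u with
  | zero =>
    rw [ball, Finset.mem_singleton, Nat.cast_zero, nonpos_iff_eq_zero,
      SimpleGraph.edist_eq_zero_iff, eq_comm]
  | succ j ih =>
    rw [mem_ball_succ, ih]
    simp only [ih]
    constructor
    · rintro (h | ⟨w, hw, h⟩)
      · exact h.trans (by exact_mod_cast Nat.le_succ j)
      · push_cast
        exact SimpleGraph.edist_triangle.trans (add_le_add hw
          (SimpleGraph.edist_le_one_iff_adj_or_eq.2 (Or.inl h.symm)))
    · intro h
      rw [SimpleGraph.edist_comm] at h
      obtain ⟨q, hq⟩ := SimpleGraph.exists_walk_of_edist_ne_top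
        (ne_top_of_le_ne_top (ENat.natCast_ne_top _) h)
      rw [← hq, Nat.cast_le] at h
      cases q with
      | nil => left; simp
      | @cons _ w _ hadj q =>
        right
        refine ⟨w, ?_, hadj⟩
        rw [SimpleGraph.edist_comm]
        refine (SimpleGraph.edist_le q).trans ?_
        rw [SimpleGraph.Walk.length_cons] at h
        exact_mod_cast Nat.le_of_succ_le_succ h

lemma ball_disjoint_isolated {G : SimpleGraph V} {Z X : Finset V} (h : Disjoint X Z) (j : ℕ) :
    Disjoint (ball (isolate G Z) X j) Z := by
  induction j with
  | zero => exact h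
  | succ j ih =>
    rw [Finset.disjoint_left] at ih ⊢
    intro u hu huZ
    rcases mem_ball_succ.1 hu with hu | ⟨w, _, hadj⟩
    exacts [ih hu huZ, hadj.2.1 huZ]

lemma DegreeLE.isolate {G : SimpleGraph V} {D : ℝ} (h : DegreeLE G D) (Z : Finset V) :
    DegreeLE (isolate G Z) D := fun v =>
  (Nat.cast_le.2 (Finset.card_le_card (Finset.monotone_filter_right _ fun _ _ hu => hu.1))).trans
    (h v)

lemma card_ball_succ_le {G : SimpleGraph V} {D : ℝ} (h : DegreeLE G D) (X : Finset V) :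
    ((ball G X 1).card : ℝ) ≤ X.card * (1 + D) := by
  have h1 : ball G X 1 ⊆ X ∪ X.biUnion fun w => Finset.univ.filter fun u => G.Adj w u := by
    intro u hu
    rcases mem_ball_succ.1 hu with hu | ⟨w, hw, hadj⟩
    · exact Finset.mem_union_left _ hu
    · exact Finset.mem_union_right _ (Finset.mem_biUnion.2 ⟨w, hw, by simpa using hadj.symm⟩)
  have h2 := (Finset.card_le_card h1).trans ((Finset.card_union_le _ _).trans
    (Nat.add_le_add_left Finset.card_biUnion_le _))
  have h3 : ((ball G X 1).card : ℝ) ≤ X.card +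
      ∑ w ∈ X, ((Finset.univ.filter fun u => G.Adj w u).card : ℝ) := by exact_mod_cast h2
  refine h3.trans ?_
  have h4 := Finset.sum_le_sum fun w (_ : w ∈ X) => h w
  rw [Finset.sum_const, nsmul_eq_mul] at h4
  linarith

lemma ball_succ (G : SimpleGraph V) (X : Finset V) (j : ℕ) :
    ball G X (j + 1) = ball G (ball G X j) 1 := rfl

lemma card_ball_le {G : SimpleGraph V} {D : ℝ} (h : DegreeLE G D) (hD : 0 ≤ D) (X : Finset V)
    (j : ℕ) : ((ball G X j).card : ℝ) ≤ X.card * (1 + D) ^ j := by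
  induction j with
  | zero => simp [ball]
  | succ j ih =>
    rw [ball_succ, pow_succ, ← mul_assoc]
    exact (card_ball_succ_le h _).trans (mul_le_mul_of_nonneg_right ih (by linarith))

/-- Balls grow by a factor of `r` as long as they are small enough to expand in all directions. -/
lemma le_card_ball {G : SimpleGraph V} {Z X : Finset V} {p ε r : ℝ} {m : ℕ} (hr : 0 ≤ r)
    (hX : X.Nonempty) (hZ : Disjoint X Z)
    (hexp : ∀ W : Finset V, W.Nonempty → Disjoint W Z → p * W.card ≤ ε →
      r * W.card ≤ (exclusiveNbrs (isolate G Z) W ∅).card)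
    (hsmall : ∀ j < m, p * (ball (isolate G Z) X j).card ≤ ε) :
    X.card * r ^ m ≤ (ball (isolate G Z) X m).card := by
  induction m with
  | zero => simp [ball]
  | succ m ih =>
    have h1 := ih fun j hj => hsmall j (hj.trans (Nat.lt_succ_self m))
    have h2 := hexp (ball (isolate G Z) X m) (hX.mono (subset_ball _ _ _))
      (ball_disjoint_isolated hZ m) (hsmall m (Nat.lt_succ_self m))
    have h3 : exclusiveNbrs (isolate G Z) (ball (isolate G Z) X m) ∅ ⊆
        ball (isolate G Z) X (m + 1) := by
      intro u hu
      simp only [exclusiveNbrs, Finset.mem_filter] at hu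
      exact mem_ball_succ.2 (Or.inr hu.2.1)
    calc X.card * r ^ (m + 1) = r * (X.card * r ^ m) := by ring
      _ ≤ r * (ball (isolate G Z) X m).card := mul_le_mul_of_nonneg_left h1 hr
      _ ≤ _ := h2
      _ ≤ _ := Nat.cast_le.2 (Finset.card_le_card h3)

end Balls

section Game

open scoped Classical

/-! ### The localization game -/

variable {V : Type*}

lemma signature_eq_iff {G : SimpleGraph V} {S : Finset V} {u v : V} :
    signature G S u = signature G S v ↔ ∀ s ∈ S, G.edist s u = G.edist s v := by
  constructor
  · intro h s hs
    have := congrFun h s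
    simpa [signature, hs] using this
  · intro h
    funext s
    by_cases hs : s ∈ S
    · simp [signature, hs, h s hs]
    · simp [signature, hs]

/-- If every vertex has, for each choice of `k` sensors, two neighbours with the same signature,
then the robber evades `k` sensors forever. -/
theorem not_copsWin_of_collision [Nonempty V] {G : SimpleGraph V} {k : ℕ}
    (h : ∀ (v : V) (S : Finset V), S.card = k →
      ∃ u u', G.Adj v u ∧ G.Adj v u' ∧ u ≠ u' ∧ signature G S u = signature G S u') :
    ¬ CopsWin G k := by
  rintro ⟨σ, hσ⟩
  choose f f' hf hf' hne hsig using h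
  let pick : V → List (V → Option ℕ∞) → V := fun v l => f v (σ.sensors l) (σ.card_sensors l)
  -- The state of the play: the information received so far and the position of the robber.
  let state : ℕ → List (V → Option ℕ∞) × V := fun t => Nat.rec ([], Classical.arbitrary V)
    (fun _ x => (x.1 ++ [signature G (σ.sensors x.1) (pick x.2 x.1)], pick x.2 x.1)) t
  let v : ℕ → V := fun t => (state (t + 1)).2
  have hstate : ∀ t, state (t + 1) = ((state t).1 ++
      [signature G (σ.sensors (state t).1) (v t)], v t) := fun t => rfl
  have hv : ∀ t, v t = pick (state t).2 (state t).1 := fun t => rfl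
  have htrail : ∀ t, infoTrail G σ v t = (state t).1 := by
    intro t
    induction t with
    | zero => rfl
    | succ t ih => rw [infoTrail, ih, hstate]
  have hadj : ∀ t, G.Adj (state t).2 (v t) := fun t => hf _ _ _
  have hwalk : IsRobberWalk G v := fun t => Or.inr (hadj (t + 1))
  obtain ⟨t, ht⟩ := hσ v hwalk
  set u' := f' (state t).2 (σ.sensors (state t).1) (σ.card_sensors _) with hu'
  have hu'adj : G.Adj (state t).2 u' := hf' _ _ _
  refine hne _ _ (σ.card_sensors (state t).1) (?_ : v t = u')
  rw [eq_comm]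
  have hw := ht (fun j => if j < t then v j else u') ?_ ?_
  · simpa using hw
  · intro j
    by_cases h1 : j + 1 < t
    · have h2 : j < t := by omega
      simp only [h1, h2, if_true]
      exact hwalk j
    · by_cases h2 : j < t
      · have h3 : t = j + 1 := by omega
        subst h3
        simp only [h1, h2, if_true, if_false]
        exact Or.inr hu'adj
      · simp [h1, h2]
  · intro j hj
    by_cases h1 : j < t
    · simp [h1]
    · have h2 : j = t := by omega
      subst h2
      simp only [lt_irrefl, if_false, sensorsAt, htrail]
      exact (hsig _ _ (σ.card_sensors (state j).1)).symm

variable [Fintype V]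

/-- If each pair of vertices is distinguished by a proportion `q` of all vertices, then a greedily
chosen set of `k` sensors distinguishes all but a proportion `(1 - q) ^ k` of any set of pairs. -/
lemma exists_sensors_card_le {G : SimpleGraph V} {q : ℝ} (hq1 : q ≤ 1)
    (hq : ∀ u v, u ≠ v → q * Fintype.card V ≤
      (Finset.univ.filter fun s => G.edist s u ≠ G.edist s v).card)
    (P : Finset (V × V)) (hP : ∀ x ∈ P, x.1 ≠ x.2) (k : ℕ) :
    ∃ S : Finset V, S.card ≤ k ∧
      ((P.filter fun x => ∀ s ∈ S, G.edist s x.1 = G.edist s x.2).card : ℝ) ≤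
        (1 - q) ^ k * P.card := by
  induction k with
  | zero => exact ⟨∅, by simp, by simp⟩
  | succ k ih =>
    obtain ⟨S, hS, hcard⟩ := ih
    set R := P.filter fun x => ∀ s ∈ S, G.edist s x.1 = G.edist s x.2 with hR
    by_cases hV : Nonempty V
    swap
    · have : IsEmpty V := not_nonempty_iff.1 hV
      have hPe : P = ∅ := Finset.eq_empty_of_isEmpty P
      exact ⟨∅, by simp, by simp [hPe]⟩
    obtain ⟨s, hs⟩ : ∃ s : V, q * R.card ≤
        ((R.filter fun x => G.edist s x.1 ≠ G.edist s x.2).card : ℝ) := by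
      by_contra! hcon
      have h1 : ∑ s : V, ((R.filter fun x => G.edist s x.1 ≠ G.edist s x.2).card : ℝ) <
          ∑ _s : V, q * R.card :=
        Finset.sum_lt_sum_of_nonempty Finset.univ_nonempty fun s _ => hcon s
      have h2 : ∑ s : V, ((R.filter fun x => G.edist s x.1 ≠ G.edist s x.2).card : ℝ) =
          ∑ x ∈ R, ((Finset.univ.filter fun s => G.edist s x.1 ≠ G.edist s x.2).card : ℝ) := by
        simp only [Finset.card_filter, Nat.cast_sum]
        exact Finset.sum_comm
      have h3 : ∑ x ∈ R, q * (Fintype.card V : ℝ) ≤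
          ∑ x ∈ R, ((Finset.univ.filter fun s => G.edist s x.1 ≠ G.edist s x.2).card : ℝ) :=
        Finset.sum_le_sum fun x hx => hq _ _ (hP x (Finset.mem_of_mem_filter _ hx))
      simp only [Finset.sum_const, nsmul_eq_mul, Finset.card_univ] at h1 h3
      rw [h2] at h1
      linarith
    refine ⟨insert s S, (Finset.card_insert_le _ _).trans (by omega), ?_⟩
    have h4 : (P.filter fun x => ∀ t ∈ insert s S, G.edist t x.1 = G.edist t x.2) =
        R.filter fun x => G.edist s x.1 = G.edist s x.2 := by
      ext x
      simp only [hR, Finset.mem_filter, Finset.forall_mem_insert]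
      tauto
    have h5 := Finset.card_filter_add_card_filter_not
      (s := R) (fun x : V × V => G.edist s x.1 = G.edist s x.2)
    have h6 : ((R.filter fun x => G.edist s x.1 = G.edist s x.2).card : ℝ) +
        (R.filter fun x => G.edist s x.1 ≠ G.edist s x.2).card = R.card := by exact_mod_cast h5
    rw [h4, pow_succ]
    calc ((R.filter fun x => G.edist s x.1 = G.edist s x.2).card : ℝ)
        ≤ (1 - q) * R.card := by linarith
      _ ≤ (1 - q) * ((1 - q) ^ k * P.card) := mul_le_mul_of_nonneg_left hcard (by linarith)
      _ = _ := by ring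

/-- The cops win as soon as they can always choose sensors for which the neighbourhoods of all
signature classes within the set of candidate positions are smaller than this set. -/
theorem copsWin_of_shrinking {G : SimpleGraph V} {k : ℕ}
    (h : ∀ X : Finset V, ∃ S : Finset V, S.card = k ∧ ∀ f : V → Option ℕ∞,
      (X.filter fun u => signature G S u = f).card ≤ 1 ∨
        (ball G (X.filter fun u => signature G S u = f) 1).card < X.card) :
    CopsWin G k := by
  choose S hS hshrink using h
  let next : Finset V → (V → Option ℕ∞) → Finset V := fun X f =>
    ball G (X.filter fun u => signature G (S X) u = f) 1
  -- The set of possible positions of the robber, given the information received so far.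
  let cand : List (V → Option ℕ∞) → Finset V := fun l => l.foldl next Finset.univ
  let σ : CopStrategy V k := ⟨fun l => S (cand l), fun l => hS _⟩
  refine ⟨σ, fun v hv => ?_⟩
  let X : ℕ → Finset V := fun t => cand (infoTrail G σ v t)
  have hX : ∀ t, X (t + 1) = next (X t) (signature G (S (X t)) (v t)) := by
    intro t
    simp only [X, cand, infoTrail, List.foldl_append, List.foldl_cons, List.foldl_nil]
    rfl
  have hsens : ∀ t, sensorsAt G σ v t = S (X t) := fun t => rfl
  have hmem : ∀ (w : ℕ → V), IsRobberWalk G w → ∀ t, (∀ j < t,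
      signature G (sensorsAt G σ v j) (w j) = signature G (sensorsAt G σ v j) (v j)) →
        w t ∈ X t := by
    intro w hw t
    induction t with
    | zero => intro _; simp [X, cand, infoTrail]
    | succ t ih =>
      intro hj
      have h1 := ih fun j hjt => hj j (by omega)
      have h2 := hj t (by omega)
      rw [hsens] at h2
      rw [hX]
      have h3 : w t ∈ (X t).filter fun u => signature G (S (X t)) u =
          signature G (S (X t)) (v t) := Finset.mem_filter.2 ⟨h1, h2⟩
      refine mem_ball_succ.2 ?_
      rcases hw t with h4 | h4
      · left; rw [h4]; exact h3
      · exact Or.inr ⟨w t, h3, h4.symm⟩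
  by_contra! hno
  have hlt : ∀ t, (X (t + 1)).card < (X t).card := by
    intro t
    rcases hshrink (X t) (signature G (S (X t)) (v t)) with h1 | h1
    · exfalso
      refine hno t fun w hw hsig => ?_
      have h2 : w t ∈ (X t).filter fun u => signature G (S (X t)) u =
          signature G (S (X t)) (v t) :=
        Finset.mem_filter.2 ⟨hmem w hw t fun j hj => hsig j hj.le, by
          rw [← hsens]; exact hsig t le_rfl⟩
      have h3 : v t ∈ (X t).filter fun u => signature G (S (X t)) u =
          signature G (S (X t)) (v t) :=
        Finset.mem_filter.2 ⟨hmem v hv t fun _ _ => rfl, rfl⟩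
      exact Finset.card_le_one.1 h1 _ h2 _ h3
    · rw [hX]; exact h1
  have hle : ∀ t, (X t).card + t ≤ (X 0).card := by
    intro t
    induction t with
    | zero => simp
    | succ t ih => have := hlt t; omega
  have := hle ((X 0).card + 1)
  omega

/-- With sensors chosen greedily, the signature classes of a set `X` of candidates have at most
about `(1 - q) ^ (k / 2) |X|` elements. -/
theorem copsWin_of_distinguishing {G : SimpleGraph V} {q D : ℝ} {k : ℕ} (hq1 : q ≤ 1) (hD : 0 ≤ D)
    (hdeg : DegreeLE G D) (hk : k ≤ Fintype.card V)
    (hq : ∀ u v, u ≠ v → q * Fintype.card V ≤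
      (Finset.univ.filter fun s => G.edist s u ≠ G.edist s v).card)
    (hlt : 2 * (1 + D) ^ 2 * (1 - q) ^ k < 1) : CopsWin G k := by
  refine copsWin_of_shrinking fun X => ?_
  obtain ⟨S₀, hS₀, hcard⟩ := exists_sensors_card_le hq1 hq X.offDiag
    (fun x hx => (Finset.mem_offDiag.1 hx).2.2) k
  obtain ⟨S, hS, -, hSk⟩ := Finset.exists_subsuperset_card_eq (Finset.subset_univ S₀) hS₀
    (by simpa using hk)
  refine ⟨S, hSk, fun f => ?_⟩
  set C := X.filter fun u => signature G S u = f with hC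
  by_cases h1 : C.card ≤ 1
  · exact Or.inl h1
  right
  push Not at h1
  have h2 : C.offDiag ⊆ X.offDiag.filter fun x => ∀ s ∈ S₀, G.edist s x.1 = G.edist s x.2 := by
    intro x hx
    rw [Finset.mem_offDiag] at hx
    simp only [hC, Finset.mem_filter] at hx
    refine Finset.mem_filter.2 ⟨Finset.mem_offDiag.2 ⟨hx.1.1, hx.2.1.1, hx.2.2⟩, fun s hs => ?_⟩
    exact signature_eq_iff.1 (hx.1.2.trans hx.2.1.2.symm) s (hS hs)
  have h3 : (C.offDiag.card : ℝ) ≤ (1 - q) ^ k * X.offDiag.card :=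
    (Nat.cast_le.2 (Finset.card_le_card h2)).trans hcard
  rw [Finset.offDiag_card, Finset.offDiag_card, Nat.cast_sub (Nat.le_mul_self _),
    Nat.cast_sub (Nat.le_mul_self _)] at h3
  push_cast at h3
  have h4 : (2 : ℝ) ≤ C.card := by exact_mod_cast h1
  have h5 : 0 ≤ (1 - q) ^ k := pow_nonneg (by linarith) k
  have h6 : (C.card : ℝ) ^ 2 ≤ 2 * ((1 - q) ^ k * X.card ^ 2) := by nlinarith
  have h7 := card_ball_succ_le hdeg C
  have hCX : C.card ≤ X.card := Finset.card_filter_le _ _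
  have h8 : (2 : ℝ) ≤ X.card := h4.trans (by exact_mod_cast hCX)
  have h9 : ((C.card : ℝ) * (1 + D)) ^ 2 < (X.card : ℝ) ^ 2 := by
    calc ((C.card : ℝ) * (1 + D)) ^ 2 = (C.card : ℝ) ^ 2 * (1 + D) ^ 2 := by ring
      _ ≤ 2 * ((1 - q) ^ k * X.card ^ 2) * (1 + D) ^ 2 :=
        mul_le_mul_of_nonneg_right h6 (by positivity)
      _ = 2 * (1 + D) ^ 2 * (1 - q) ^ k * X.card ^ 2 := by ring
      _ < 1 * X.card ^ 2 := mul_lt_mul_of_pos_right hlt (by positivity)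
      _ = _ := one_mul _
  exact_mod_cast h7.trans_lt (lt_of_pow_lt_pow_left₀ 2 (by positivity) h9)

end Game

section Growth

open scoped Classical

/-! ### Sizes of balls in the regime of the theorem -/

/-- A quantitative form of the regime `log³ n ≪ d ≪ n`, `d ^ i / n → A` at a single `n`, where
`d = p n`; the parameter `N` is thought of as a large constant. The bounds `2 ≤ i ≤ log n` follow
from the regime for large `n`. In the sequel `κ` is a small constant, and `ε = κ / log n` is the
relative error admitted in one step of the growth of a ball, of which there are fewer than
`log n`. -/
structure RegimeAt (A N : ℝ) (n : ℕ) (p : ℝ) (i : ℕ) : Prop where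
  p_nonneg : 0 ≤ p
  p_le : p * N ≤ 1
  le_log : N ≤ Real.log n
  le_degree : N * Real.log n ^ 3 ≤ p * n
  le_ratio : A - 1 / N ≤ (p * n) ^ i / n
  ratio_le : (p * n) ^ i / n ≤ A + 1 / N
  two_le : 2 ≤ i
  le_log_n : (i : ℝ) ≤ Real.log n

lemma one_sub_pow_le {p : ℝ} (h1 : p ≤ 1) (m : ℕ) : (1 - p) ^ m ≤ Real.exp (-(p * m)) := by
  rw [mul_comm, ← mul_neg, Real.exp_nat_mul]
  exact pow_le_pow_left₀ (by linarith) (by linarith [Real.add_one_le_exp (-p)]) _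

lemma exp_le_one_sub_pow {p : ℝ} (h1 : p < 1) (m : ℕ) :
    Real.exp (-(p * m / (1 - p))) ≤ (1 - p) ^ m := by
  have h : Real.exp (-(p * m / (1 - p))) = Real.exp (-(p / (1 - p))) ^ m := by
    rw [← Real.exp_nat_mul]; congr 1; ring
  rw [h]
  refine pow_le_pow_left₀ (Real.exp_pos _).le ?_ _
  rw [Real.exp_neg]
  have h2 : 0 < 1 - p := by linarith
  refine inv_le_of_inv_le₀ h2 ?_
  have h3 := Real.add_one_le_exp (p / (1 - p))
  have h4 : (1 - p)⁻¹ = p / (1 - p) + 1 := by field_simp; ring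
  rwa [h4]

/-- Basic consequences of `RegimeAt`, for `ε = κ / log n`. -/
lemma RegimeAt.basic {A N κ p : ℝ} {n i : ℕ} (h : RegimeAt A N n p i) (hA : 0 < A) (hκ : 0 < κ)
    (hκ1 : κ ≤ 1 / 16) (hN : 16 * (A + 1) / κ ^ 2 ≤ N) :
    16 ≤ κ ^ 2 * N ∧ 16 * (A + 1) ≤ κ * N ∧ 256 ≤ N ∧ 1 / N ≤ κ ∧ p ≤ κ ∧
      0 < κ / Real.log n ∧ κ / Real.log n ≤ κ ∧ 1 ≤ p * n ∧
      16 * (A + 1) * Real.log n ≤ κ * (p * n) ∧ 16 * Real.log n ≤ (κ / Real.log n) ^ 2 * (p * n) ∧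
      1 ≤ κ / Real.log n * (p * n) := by
  have hκ2 : 0 < κ ^ 2 := by positivity
  rw [div_le_iff₀ hκ2] at hN
  have hN0 : 0 < N := by
    by_contra hneg
    have : N * κ ^ 2 ≤ 0 := mul_nonpos_of_nonpos_of_nonneg (by linarith) hκ2.le
    linarith
  have a1 : 16 ≤ κ ^ 2 * N := by nlinarith
  have a2 : 16 * (A + 1) ≤ κ * N := by
    have h1 : N * κ ^ 2 ≤ κ * N := by nlinarith [mul_pos hκ hN0]
    linarith
  have a3 : 256 ≤ N := by
    have h1 : κ * N ≤ 1 / 16 * N := mul_le_mul_of_nonneg_right hκ1 hN0.le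
    nlinarith
  have a4 : 1 / N ≤ κ := by
    rw [div_le_iff₀ hN0]; linarith
  have hL : 256 ≤ Real.log n := a3.trans h.le_log
  have hL0 : 0 < Real.log n := by linarith
  have a5 : p ≤ κ := by
    have : p ≤ 1 / N := by rw [le_div_iff₀ hN0]; exact h.p_le
    linarith
  have hd := h.le_degree
  have hκN : 16 ≤ κ * N := by linarith
  have hL1 : 1 ≤ Real.log n := by linarith
  have hL3 : Real.log n ≤ Real.log n ^ 3 := le_self_pow₀ hL1 (by norm_num)
  have hL2 : Real.log n ≤ Real.log n ^ 2 := le_self_pow₀ hL1 (by norm_num)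
  refine ⟨a1, a2, a3, a4, a5, by positivity, ?_, ?_, ?_, ?_, ?_⟩
  · exact div_le_self hκ.le hL1
  · nlinarith
  · calc 16 * (A + 1) * Real.log n ≤ κ * N * Real.log n ^ 3 :=
          mul_le_mul a2 hL3 hL0.le (by positivity)
      _ = κ * (N * Real.log n ^ 3) := by ring
      _ ≤ κ * (p * n) := mul_le_mul_of_nonneg_left hd hκ.le
  · calc 16 * Real.log n ≤ κ ^ 2 * N * Real.log n := mul_le_mul_of_nonneg_right a1 hL0.le
      _ = (κ / Real.log n) ^ 2 * (N * Real.log n ^ 3) := by field_simp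
      _ ≤ _ := mul_le_mul_of_nonneg_left hd (by positivity)
  · calc (1 : ℝ) ≤ κ * N * Real.log n ^ 2 := by nlinarith
      _ = κ / Real.log n * (N * Real.log n ^ 3) := by field_simp
      _ ≤ _ := mul_le_mul_of_nonneg_left hd (by positivity)

variable {V : Type*} [Fintype V] {G : SimpleGraph V} {A N κ p : ℝ} {i : ℕ}

/-- Sets that are not too large expand by a factor of nearly `d`, also after the removal of a
vertex. -/
lemma RegimeAt.le_card_exclusiveNbrs (h : RegimeAt A N (Fintype.card V) p i) (hA : 0 < A)
    (hκ : 0 < κ) (hκ1 : κ ≤ 1 / 16) (hN : 16 * (A + 1) / κ ^ 2 ≤ N)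
    (hexp : Expanding G p (κ / Real.log (Fintype.card V))) {Z : Finset V} (hZ : Z.card ≤ 1)
    {W : Finset V} (hW : W.Nonempty) (hWZ : Disjoint W Z)
    (hWs : p * W.card ≤ κ / Real.log (Fintype.card V)) :
    (1 - 4 * (κ / Real.log (Fintype.card V))) * (p * Fintype.card V) * W.card ≤
      (exclusiveNbrs (isolate G Z) W ∅).card := by
  obtain ⟨-, -, -, -, hpκ, hε, hεκ, hd, -, hεd, hεd1⟩ := h.basic hA hκ hκ1 hN
  set n := Fintype.card V
  set L := Real.log n
  set ε := κ / L
  set d := p * n with hd_def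
  have hm : (1 : ℝ) ≤ W.card := by exact_mod_cast hW.card_pos
  set m : ℝ := (W.card : ℝ) with hm_def
  have hε1 : ε ≤ 1 / 16 := hεκ.trans hκ1
  have hp0 := h.p_nonneg
  have hn0 : (0 : ℝ) ≤ n := Nat.cast_nonneg _
  have hmn : m ≤ ε * n := by
    have : m * d ≤ ε * n := by
      calc m * d = p * m * n := by rw [hd_def]; ring
        _ ≤ ε * n := mul_le_mul_of_nonneg_right hWs hn0
    nlinarith
  have hpm : p * m * (1 - ε) ≤ 1 - (1 - p) ^ W.card := by
    have h1 := one_sub_pow_le (p := p) (by linarith) W.card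
    have h2 := exp_neg_le (t := p * m) (by positivity)
    nlinarith [mul_nonneg hp0 (by linarith : 0 ≤ m)]
  have hmean : (1 - ε) ^ 2 * (d * m) ≤ exclusiveMean n p W.card 0 := by
    rw [exclusiveMean, Nat.cast_zero, sub_zero, pow_zero, mul_one]
    calc (1 - ε) ^ 2 * (d * m) = ((1 - ε) * n) * (p * m * (1 - ε)) := by rw [hd_def]; ring
      _ ≤ (n - W.card) * (1 - (1 - p) ^ W.card) := by
        refine mul_le_mul ?_ hpm ?_ ?_
        · linarith
        · exact mul_nonneg (by positivity) (by linarith)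
        · nlinarith
  have hdm : 0 ≤ d * m := by positivity
  have h2 := hexp W ∅ (Finset.disjoint_empty_right _) (by simpa using hW) (by
    rw [Finset.card_empty, Nat.cast_zero, add_zero]
    calc 4 * (W.card : ℝ) * L = (1 / 4) * (16 * L) * m := by rw [hm_def]; ring
      _ ≤ (1 / 4) * (ε ^ 2 * d) * m := by gcongr
      _ = ε ^ 2 * (1 / 4 * (d * m)) := by ring
      _ ≤ ε ^ 2 * exclusiveMean n p W.card 0 := by
        refine mul_le_mul_of_nonneg_left ?_ (by positivity)
        refine le_trans ?_ hmean
        refine mul_le_mul_of_nonneg_right ?_ hdm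
        nlinarith)
  rw [Finset.card_empty] at h2
  have h3 : exclusiveNbrs G W ∅ ⊆ exclusiveNbrs (isolate G Z) W ∅ ∪ Z := by
    intro u hu
    by_cases huZ : u ∈ Z
    · exact Finset.mem_union_right _ huZ
    · refine Finset.mem_union_left _ ?_
      simp only [exclusiveNbrs, Finset.mem_filter] at hu ⊢
      obtain ⟨hu, ⟨w, hw, hadj⟩, -⟩ := hu
      exact ⟨hu, ⟨w, hw, hadj, huZ, Finset.disjoint_left.1 hWZ hw⟩, by simp⟩
  have h4 : ((exclusiveNbrs G W ∅).card : ℝ) ≤ (exclusiveNbrs (isolate G Z) W ∅).card + 1 := by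
    have := (Finset.card_le_card h3).trans (Finset.card_union_le _ _)
    exact_mod_cast this.trans (Nat.add_le_add_left hZ _)
  have h5 : (1 - ε) * ((1 - ε) ^ 2 * (d * m)) ≤ (1 - ε) * exclusiveMean n p W.card 0 :=
    mul_le_mul_of_nonneg_left hmean (by linarith)
  have h6 : (1 - 3 * ε) * (d * m) ≤ (1 - ε) * ((1 - ε) ^ 2 * (d * m)) := by
    rw [← mul_assoc (1 - ε)]
    refine mul_le_mul_of_nonneg_right ?_ hdm
    nlinarith [sq_nonneg ε, mul_nonneg (sq_nonneg ε) (by linarith : 0 ≤ 3 - ε)]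
  have h7 : 1 ≤ ε * (d * m) := by nlinarith
  linarith

/-- The balls of radius `i - 1` around sets of at most two vertices have nearly `d ^ (i - 1)`
elements for each of these vertices, also after the removal of another vertex. -/
lemma RegimeAt.card_ball_bounds (h : RegimeAt A N (Fintype.card V) p i) (hA : 0 < A)
    (hκ : 0 < κ) (hκ1 : κ ≤ 1 / 16) (hN : 16 * (A + 1) / κ ^ 2 ≤ N)
    (hdeg : DegreeLE G ((1 + κ / Real.log (Fintype.card V)) * (p * Fintype.card V)))
    (hexp : Expanding G p (κ / Real.log (Fintype.card V))) {Z : Finset V} (hZ : Z.card ≤ 1)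
    {X : Finset V} (hX : X.Nonempty) (hX2 : X.card ≤ 2) (hXZ : Disjoint X Z) :
    (1 - 4 * κ) * (X.card * (p * Fintype.card V) ^ (i - 1)) ≤
        (ball (isolate G Z) X (i - 1)).card ∧
      ((ball (isolate G Z) X (i - 1)).card : ℝ) ≤
        (1 + 4 * κ) * (X.card * (p * Fintype.card V) ^ (i - 1)) := by
  have hstep := fun W => h.le_card_exclusiveNbrs hA hκ hκ1 hN hexp hZ (W := W)
  obtain ⟨-, -, hN1, hNκ, hpκ, hε, hεκ, hd, hdL, hεd, hεd1⟩ := h.basic hA hκ hκ1 hN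
  set n := Fintype.card V
  set L := Real.log n with hL
  set ε := κ / L with hε_def
  set d := p * n with hd_def
  have hε1 : ε ≤ 1 / 16 := hεκ.trans hκ1
  have hL1 : 256 ≤ L := hN1.trans h.le_log
  have hn0 : (0 : ℝ) < n := by
    rcases Nat.eq_zero_or_pos n with h0 | h0
    · rw [hL, h0] at hL1; norm_num at hL1
    · exact_mod_cast h0
  have hεL : ε * L = κ := by rw [hε_def]; field_simp
  have hεi : ε * ((i - 1 : ℕ) : ℝ) ≤ κ := by
    rw [← hεL]
    refine mul_le_mul_of_nonneg_left (le_trans ?_ h.le_log_n) hε.le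
    exact_mod_cast Nat.sub_le i 1
  have hpow : (1 + 2 * ε) ^ (i - 1) ≤ 1 + 4 * κ := by
    have h1 : (1 + 2 * ε) ^ (i - 1) ≤ Real.exp (2 * κ) := by
      calc (1 + 2 * ε) ^ (i - 1) ≤ Real.exp (2 * ε) ^ (i - 1) :=
            pow_le_pow_left₀ (by linarith) (by linarith [Real.add_one_le_exp (2 * ε)]) _
        _ = Real.exp (((i - 1 : ℕ) : ℝ) * (2 * ε)) := (Real.exp_nat_mul _ _).symm
        _ ≤ _ := Real.exp_le_exp.2 (by linarith)
    have h2 := Real.abs_exp_sub_one_le (x := 2 * κ) (by rw [abs_of_pos (by linarith)]; linarith)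
    rw [abs_of_pos (a := 2 * κ) (by linarith)] at h2
    linarith [(abs_le.1 h2).2]
  have hup : ∀ j, ((ball (isolate G Z) X j).card : ℝ) ≤ X.card * ((1 + 2 * ε) ^ j * d ^ j) := by
    intro j
    rw [← mul_pow]
    refine (card_ball_le (hdeg.isolate Z) (by positivity) X j).trans ?_
    refine mul_le_mul_of_nonneg_left (pow_le_pow_left₀ (by positivity) ?_ _) (Nat.cast_nonneg _)
    linarith
  constructor
  · have hlow := le_card_ball (G := G) (Z := Z) (X := X) (p := p) (ε := ε)
      (r := (1 - 4 * ε) * d) (m := i - 1) (mul_nonneg (by linarith) (by linarith)) hX hXZ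
      (fun W hW hWZ hWs => hstep W hW hWZ hWs) ?_
    · refine le_trans ?_ hlow
      have h1 := one_add_mul_le_pow (a := -(4 * ε)) (by linarith) (i - 1)
      rw [← sub_eq_add_neg] at h1
      have h2 : 1 - 4 * κ ≤ (1 - 4 * ε) ^ (i - 1) := by linarith
      have h3 : 0 ≤ d ^ (i - 1) := by positivity
      have h4 := mul_le_mul_of_nonneg_right h2 h3
      rw [mul_pow (1 - 4 * ε) d, mul_left_comm (1 - 4 * κ)]
      exact mul_le_mul_of_nonneg_left h4 (Nat.cast_nonneg _)
    · intro j hj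
      have hj2 : j ≤ i - 2 := by omega
      have hX2' : (X.card : ℝ) ≤ 2 := by exact_mod_cast hX2
      have hdj : d ^ j ≤ d ^ (i - 2) := pow_le_pow_right₀ hd hj2
      have hej : (1 + 2 * ε) ^ j ≤ 2 := by
        have h1 : (1 + 2 * ε) ^ j ≤ (1 + 2 * ε) ^ (i - 1) :=
          pow_le_pow_right₀ (by linarith) hj.le
        linarith
      have hdi : p * d ^ (i - 2) * d = d ^ i / n := by
        obtain ⟨l, rfl⟩ : ∃ l, i = l + 2 := ⟨i - 2, by have := h.two_le; omega⟩
        rw [Nat.add_sub_cancel, pow_add, hd_def]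
        field_simp
      have hAr : d ^ i / n ≤ A + 1 := by
        have := h.ratio_le
        linarith
      have hd0 : 0 < d := by linarith
      have hpd : p * d ^ (i - 2) ≤ (A + 1) / d := by
        rw [le_div_iff₀ hd0, hdi]; exact hAr
      calc p * ((ball (isolate G Z) X j).card : ℝ)
          ≤ p * (2 * (2 * d ^ (i - 2))) := by
            refine mul_le_mul_of_nonneg_left ((hup j).trans ?_) h.p_nonneg
            gcongr
        _ = 4 * (p * d ^ (i - 2)) := by ring
        _ ≤ 4 * ((A + 1) / d) := by linarith
        _ ≤ ε := by
            rw [hε_def, ← mul_div_assoc, div_le_div_iff₀ hd0 (by linarith)]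
            nlinarith
  · refine (hup _).trans ?_
    rw [mul_left_comm]
    refine mul_le_mul_of_nonneg_right hpow (by positivity)

end Growth

section UpperBound

open scoped Classical

/-! ### The upper bound -/

/-- A lower bound for the proportion of vertices at distance at most `i` from one, and larger than
`i` from the other of two given vertices. It tends to `(1 - exp (-A)) * exp (-A)` as `κ → 0`. -/
noncomputable def separationRate (A κ : ℝ) : ℝ :=
  (1 - κ) * ((1 - Real.exp (-((1 - 12 * κ) * (A - κ)))) *
    Real.exp (-((1 + 4 * κ) * (1 + 2 * κ) * (A + κ))))

variable {V : Type*} [Fintype V] {G : SimpleGraph V} {A N κ p : ℝ} {i : ℕ}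

lemma isolate_empty {V : Type*} (G : SimpleGraph V) : isolate G ∅ = G := by
  ext u w; simp [isolate_adj]

lemma RegimeAt.p_mul_pow_pred {n : ℕ} (h : RegimeAt A N n p i) (hn : (0 : ℝ) < n) :
    p * (p * n) ^ (i - 1) = (p * n) ^ i / n := by
  obtain ⟨l, rfl⟩ : ∃ l, i = l + 1 := ⟨i - 1, by have := h.two_le; omega⟩
  rw [Nat.add_sub_cancel, pow_succ]
  field_simp

/-- The balls of radius `i - 1` around `u` and `v` are nearly disjoint, since the ball around
`{u, v}` is nearly twice as large as each of them. -/
lemma RegimeAt.le_card_near_far (h : RegimeAt A N (Fintype.card V) p i) (hA : 0 < A)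
    (hκ : 0 < κ) (hκ1 : κ ≤ 1 / 16) (hκA : κ < A) (hN : 16 * (A + 1) / κ ^ 2 ≤ N)
    (hN2 : 16 * (A + 1) ≤ N * (κ ^ 2 * separationRate A κ))
    (hdeg : DegreeLE G ((1 + κ / Real.log (Fintype.card V)) * (p * Fintype.card V)))
    (hexp : Expanding G p (κ / Real.log (Fintype.card V))) (hexp' : Expanding G p κ)
    {u v : V} (huv : u ≠ v) :
    (1 - κ) * separationRate A κ * Fintype.card V ≤
      (Finset.univ.filter fun s => G.edist s u ≤ i ∧ ¬ G.edist s v ≤ i).card := by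
  have hb1 := h.card_ball_bounds hA hκ hκ1 hN hdeg hexp (Z := ∅) (by simp) (X := {u})
    (by simp) (by simp) (by simp)
  have hb2 := h.card_ball_bounds hA hκ hκ1 hN hdeg hexp (Z := ∅) (by simp) (X := {v})
    (by simp) (by simp) (by simp)
  have hb3 := h.card_ball_bounds hA hκ hκ1 hN hdeg hexp (Z := ∅) (by simp) (X := {u} ∪ {v})
    (by simp) (by rw [Finset.card_union_of_disjoint (by simpa using huv)]; simp) (by simp)
  rw [isolate_empty] at hb1 hb2 hb3
  rw [ball_union, Finset.card_union_of_disjoint (s := {u}) (by simpa using huv)] at hb3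
  simp only [Finset.card_singleton, Nat.cast_one, one_mul, Nat.reduceAdd, Nat.cast_ofNat]
    at hb1 hb2 hb3
  obtain ⟨-, -, hN1, hNκ, hpκ, -, -, hd, hdL, -, -⟩ := h.basic hA hκ hκ1 hN
  have hpp := h.p_mul_pow_pred
  set n := Fintype.card V
  set L := Real.log n with hL
  have hL1 : 256 ≤ L := hN1.trans h.le_log
  have hn0 : (0 : ℝ) < n := by
    rcases Nat.eq_zero_or_pos n with h0 | h0
    · rw [hL, h0] at hL1; norm_num at hL1
    · exact_mod_cast h0
  have hα := hpp hn0
  have hα1 := h.le_ratio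
  have hα2 := h.ratio_le
  have hdeg' := h.le_degree
  have hp0 := h.p_nonneg
  clear hpp
  set d := p * n with hd_def
  set D₀ := d ^ (i - 1) with hD₀
  have hD₀0 : 0 ≤ D₀ := by positivity
  set B₁ := ball G {u} (i - 1)
  set B₂ := ball G {v} (i - 1)
  have hm1 : (1 - 12 * κ) * D₀ ≤ ((B₁ \ B₂).card : ℝ) := by
    have h1 := Finset.card_sdiff_add_card B₁ B₂
    have h2 : ((B₁ \ B₂).card : ℝ) + B₂.card = (B₁ ∪ B₂).card := by exact_mod_cast h1
    have h3 := hb3.1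
    have h4 := hb2.2
    linarith
  have hm1' : ((B₁ \ B₂).card : ℝ) ≤ 2 * D₀ := by
    have h1 : ((B₁ \ B₂).card : ℝ) ≤ B₁.card :=
      Nat.cast_le.2 (Finset.card_le_card Finset.sdiff_subset)
    have h2 := mul_le_mul_of_nonneg_right (by linarith : 1 + 4 * κ ≤ 2) hD₀0
    linarith [hb1.2]
  have hm2' : (B₂.card : ℝ) ≤ 2 * D₀ := by
    have h2 := mul_le_mul_of_nonneg_right (by linarith : 1 + 4 * κ ≤ 2) hD₀0
    linarith [hb2.2]
  have hD₀d : D₀ * d ≤ (A + 1) * n := by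
    have h1 : p * D₀ ≤ A + 1 := by linarith
    calc D₀ * d = p * D₀ * n := by rw [hd_def]; ring
      _ ≤ _ := mul_le_mul_of_nonneg_right h1 hn0.le
  have hd0 : 0 < d := by linarith
  have hsize : ((B₁ \ B₂).card : ℝ) + B₂.card ≤ κ * n := by
    have h1 : (4 * D₀) * d ≤ κ * n * d := by
      have h2 : 4 * (A + 1) ≤ κ * d := by
        refine le_trans ?_ hdL
        nlinarith only [hA, hL1]
      calc 4 * D₀ * d = 4 * (D₀ * d) := by ring
        _ ≤ 4 * ((A + 1) * n) := by linarith
        _ = 4 * (A + 1) * n := by ring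
        _ ≤ κ * d * n := mul_le_mul_of_nonneg_right h2 hn0.le
        _ = _ := by ring
    have h3 := le_of_mul_le_mul_right h1 hd0
    linarith
  have hφ1 : 1 - Real.exp (-((1 - 12 * κ) * (A - κ))) ≤ 1 - (1 - p) ^ (B₁ \ B₂).card := by
    have h1 := one_sub_pow_le (p := p) (by linarith) (B₁ \ B₂).card
    have h2 : Real.exp (-(p * (B₁ \ B₂).card)) ≤ Real.exp (-((1 - 12 * κ) * (A - κ))) := by
      apply Real.exp_le_exp.2
      have h3 : (1 - 12 * κ) * (A - κ) ≤ (1 - 12 * κ) * (p * D₀) :=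
        mul_le_mul_of_nonneg_left (by linarith) (by linarith)
      have h4 := mul_le_mul_of_nonneg_left hm1 hp0
      linarith
    linarith
  have hφ1' : 0 ≤ 1 - Real.exp (-((1 - 12 * κ) * (A - κ))) := by
    have : Real.exp (-((1 - 12 * κ) * (A - κ))) ≤ 1 := by
      rw [Real.exp_le_one_iff]
      have := mul_nonneg (by linarith : 0 ≤ 1 - 12 * κ) (by linarith : 0 ≤ A - κ)
      linarith
    linarith
  have hφ2 : Real.exp (-((1 + 4 * κ) * (1 + 2 * κ) * (A + κ))) ≤ (1 - p) ^ B₂.card := by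
    refine le_trans (Real.exp_le_exp.2 (neg_le_neg ?_)) (exp_le_one_sub_pow (by linarith) _)
    rw [div_le_iff₀ (by linarith)]
    have h1 : p * B₂.card ≤ (1 + 4 * κ) * (A + κ) := by
      calc p * (B₂.card : ℝ) ≤ p * ((1 + 4 * κ) * D₀) := mul_le_mul_of_nonneg_left hb2.2 hp0
        _ = (1 + 4 * κ) * (p * D₀) := by ring
        _ ≤ _ := mul_le_mul_of_nonneg_left (by linarith) (by linarith)
    have h2 : 1 ≤ (1 + 2 * κ) * (1 - p) := by
      calc (1 : ℝ) ≤ (1 + 2 * κ) * (1 - κ) := by nlinarith only [hκ, hκ1]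
        _ ≤ _ := mul_le_mul_of_nonneg_left (by linarith) (by linarith)
    have h3 : 0 ≤ (1 + 4 * κ) * (A + κ) := by positivity
    calc p * (B₂.card : ℝ) ≤ (1 + 4 * κ) * (A + κ) * 1 := by linarith
      _ ≤ (1 + 4 * κ) * (A + κ) * ((1 + 2 * κ) * (1 - p)) := mul_le_mul_of_nonneg_left h2 h3
      _ = _ := by ring
  have hφ : separationRate A κ * n ≤ exclusiveMean n p (B₁ \ B₂).card B₂.card := by
    rw [exclusiveMean, separationRate, mul_right_comm]
    refine mul_le_mul (by linarith) (mul_le_mul hφ1 hφ2 (Real.exp_pos _).le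
      (hφ1'.trans hφ1)) (mul_nonneg hφ1' (Real.exp_pos _).le) ?_
    have h1 := mul_le_mul_of_nonneg_right (by linarith : κ ≤ 1) hn0.le
    linarith
  have hE := hexp' (B₁ \ B₂) B₂ Finset.sdiff_disjoint
    (by
      refine Finset.Nonempty.mono Finset.subset_union_right ⟨v, ?_⟩
      exact subset_ball _ _ _ (by simp)) (by
    refine le_trans ?_ (mul_le_mul_of_nonneg_left hφ (by positivity))
    have h1 : (16 * D₀ * L) * d ≤ (κ ^ 2 * (separationRate A κ * n)) * d := by
      have h2 : 16 * (A + 1) * L ≤ κ ^ 2 * separationRate A κ * d := by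
        have hL3 : L ≤ L ^ 3 := le_self_pow₀ (by linarith) (by norm_num)
        have hpos : 0 ≤ κ ^ 2 * separationRate A κ := by
          by_contra hneg
          have : N * (κ ^ 2 * separationRate A κ) ≤ 0 :=
            mul_nonpos_of_nonneg_of_nonpos (by linarith) (by linarith)
          linarith
        calc 16 * (A + 1) * L ≤ N * (κ ^ 2 * separationRate A κ) * L ^ 3 :=
              mul_le_mul hN2 hL3 (by linarith) (mul_nonneg (by linarith) hpos)
          _ = κ ^ 2 * separationRate A κ * (N * L ^ 3) := by ring
          _ ≤ _ := mul_le_mul_of_nonneg_left hdeg' hpos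
      calc 16 * D₀ * L * d = 16 * L * (D₀ * d) := by ring
        _ ≤ 16 * L * ((A + 1) * n) := mul_le_mul_of_nonneg_left hD₀d (by linarith)
        _ = 16 * (A + 1) * L * n := by ring
        _ ≤ κ ^ 2 * separationRate A κ * d * n := mul_le_mul_of_nonneg_right h2 hn0.le
        _ = _ := by ring
    have h3 := le_of_mul_le_mul_right h1 hd0
    have h4 : 4 * (((B₁ \ B₂).card : ℝ) + B₂.card) * L ≤ 16 * D₀ * L :=
      mul_le_mul_of_nonneg_right (by linarith) (by linarith)
    exact h4.trans h3)
  have hsub : exclusiveNbrs G (B₁ \ B₂) B₂ ⊆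
      Finset.univ.filter fun s => G.edist s u ≤ i ∧ ¬ G.edist s v ≤ i := by
    intro s hs
    simp only [exclusiveNbrs, Finset.mem_filter, Finset.mem_compl, Finset.mem_union, not_or] at hs
    obtain ⟨⟨-, hs2⟩, ⟨w, hw, hadj⟩, hno⟩ := hs
    obtain ⟨l, hl⟩ : ∃ l, i = l + 1 := ⟨i - 1, by have := h.two_le; omega⟩
    simp only [Finset.mem_filter, Finset.mem_univ, true_and]
    rw [SimpleGraph.edist_comm (v := u), SimpleGraph.edist_comm (v := v), ← mem_ball_singleton,
      ← mem_ball_singleton, hl, mem_ball_succ, mem_ball_succ]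
    have hl' : l = i - 1 := by omega
    rw [hl']
    refine ⟨Or.inr ⟨w, (Finset.mem_sdiff.1 hw).1, hadj⟩, ?_⟩
    rintro (h1 | ⟨w, hw, h1⟩)
    exacts [hs2 h1, hno w hw h1]
  calc (1 - κ) * separationRate A κ * n = (1 - κ) * (separationRate A κ * n) := by ring
    _ ≤ (1 - κ) * exclusiveMean n p (B₁ \ B₂).card B₂.card :=
      mul_le_mul_of_nonneg_left hφ (by linarith)
    _ ≤ _ := hE
    _ ≤ _ := Nat.cast_le.2 (Finset.card_le_card hsub)

/-- A pair of vertices is distinguished by the vertices that are close to exactly one of them. -/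
lemma RegimeAt.le_card_distinguishing (h : RegimeAt A N (Fintype.card V) p i) (hA : 0 < A)
    (hκ : 0 < κ) (hκ1 : κ ≤ 1 / 16) (hκA : κ < A) (hN : 16 * (A + 1) / κ ^ 2 ≤ N)
    (hN2 : 16 * (A + 1) ≤ N * (κ ^ 2 * separationRate A κ))
    (hdeg : DegreeLE G ((1 + κ / Real.log (Fintype.card V)) * (p * Fintype.card V)))
    (hexp : Expanding G p (κ / Real.log (Fintype.card V))) (hexp' : Expanding G p κ)
    {u v : V} (huv : u ≠ v) :
    2 * (1 - κ) * separationRate A κ * Fintype.card V ≤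
      (Finset.univ.filter fun s => G.edist s u ≠ G.edist s v).card := by
  have h1 := h.le_card_near_far hA hκ hκ1 hκA hN hN2 hdeg hexp hexp' huv
  have h2 := h.le_card_near_far hA hκ hκ1 hκA hN hN2 hdeg hexp hexp' huv.symm
  have hd : Disjoint (Finset.univ.filter fun s => G.edist s u ≤ i ∧ ¬ G.edist s v ≤ i)
      (Finset.univ.filter fun s => G.edist s v ≤ i ∧ ¬ G.edist s u ≤ i) := by
    rw [Finset.disjoint_filter]
    tauto
  have hsub : (Finset.univ.filter fun s => G.edist s u ≤ i ∧ ¬ G.edist s v ≤ i) ∪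
      (Finset.univ.filter fun s => G.edist s v ≤ i ∧ ¬ G.edist s u ≤ i) ⊆
        Finset.univ.filter fun s => G.edist s u ≠ G.edist s v := by
    intro s hs
    simp only [Finset.mem_union, Finset.mem_filter, Finset.mem_univ, true_and] at hs ⊢
    intro heq
    rw [heq] at hs
    tauto
  have h3 := Finset.card_le_card hsub
  rw [Finset.card_union_of_disjoint hd] at h3
  have h4 : ((Finset.univ.filter fun s => G.edist s u ≤ i ∧ ¬ G.edist s v ≤ i).card : ℝ) +
      (Finset.univ.filter fun s => G.edist s v ≤ i ∧ ¬ G.edist s u ≤ i).card ≤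
        (Finset.univ.filter fun s => G.edist s u ≠ G.edist s v).card := by exact_mod_cast h3
  linarith

lemma localizationNumber_le_of_copsWin {V : Type*} {G : SimpleGraph V} {k : ℕ} (h : CopsWin G k) :
    localizationNumber G ≤ k :=
  Nat.sInf_le h

lemma RegimeAt.localizationNumber_le (h : RegimeAt A N (Fintype.card V) p i) (hA : 0 < A)
    (hκ : 0 < κ) (hκ1 : κ ≤ 1 / 16) (hκA : κ < A) (hN : 16 * (A + 1) / κ ^ 2 ≤ N)
    (hN2 : 16 * (A + 1) ≤ N * (κ ^ 2 * separationRate A κ))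
    (hdeg : DegreeLE G ((1 + κ / Real.log (Fintype.card V)) * (p * Fintype.card V)))
    (hexp : Expanding G p (κ / Real.log (Fintype.card V))) (hexp' : Expanding G p κ) :
    (localizationNumber G : ℝ) ≤
      (2 * Real.log (p * Fintype.card V) + 3) / (2 * (1 - κ) * separationRate A κ) + 1 := by
  have hq := fun u v => h.le_card_distinguishing hA hκ hκ1 hκA hN hN2 hdeg hexp hexp' (u := u)
    (v := v)
  obtain ⟨hκN, -, hN1, -, -, hε, hεκ, hd, -, -, hεd⟩ := h.basic hA hκ hκ1 hN
  set n := Fintype.card V with hn_def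
  set q := 2 * (1 - κ) * separationRate A κ with hq_def
  have hL1 : 256 ≤ Real.log n := hN1.trans h.le_log
  have hn2 : 1 < n := by
    by_contra hle
    have : (n : ℝ) ≤ 1 := by exact_mod_cast not_lt.1 hle
    have := Real.log_nonpos (Nat.cast_nonneg n) this
    linarith
  have hn0 : (0 : ℝ) < n := by exact_mod_cast (by omega : 0 < n)
  have hφ : 0 < separationRate A κ := by
    by_contra hneg
    have : N * (κ ^ 2 * separationRate A κ) ≤ 0 := mul_nonpos_of_nonneg_of_nonpos (by linarith)
      (mul_nonpos_of_nonneg_of_nonpos (by positivity) (by linarith))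
    linarith
  have hq0 : 0 < q := mul_pos (by linarith) hφ
  have hq1 : q ≤ 1 := by
    obtain ⟨u, v, huv⟩ := Fintype.exists_pair_of_one_lt_card hn2
    have h1 := hq u v huv
    have h2 : ((Finset.univ.filter fun s => G.edist s u ≠ G.edist s v).card : ℝ) ≤ n :=
      Nat.cast_le.2 (Finset.card_le_univ _)
    have h3 : q * n ≤ 1 * n := by linarith
    exact le_of_mul_le_mul_right h3 hn0
  set d := p * n with hd_def
  have hlogd : 0 ≤ Real.log d := Real.log_nonneg hd
  set k := ⌊(2 * Real.log d + 3) / q⌋₊ + 1 with hk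
  have hk1 : (2 * Real.log d + 3) / q < k := by
    rw [hk]; push_cast; exact Nat.lt_floor_add_one _
  have hk2 : (k : ℝ) ≤ (2 * Real.log d + 3) / q + 1 := by
    rw [hk]; push_cast
    exact add_le_add_left (Nat.floor_le (by positivity)) 1
  refine le_trans (Nat.cast_le.2 ?_) hk2
  -- There may be fewer than `k` vertices; then all of them can carry a sensor.
  by_cases hkn : n ≤ k
  · exact (localizationNumber_le_of_copsWin (copsWin_card G)).trans hkn
  refine localizationNumber_le_of_copsWin (copsWin_of_distinguishing hq1 (by positivity) hdeg
    (by omega) hq ?_)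
  rw [div_lt_iff₀ hq0] at hk1
  have hD : 1 + (1 + κ / Real.log n) * d ≤ 2 * d := by nlinarith
  have h1 : (1 - q) ^ k ≤ Real.exp (-(q * k)) := one_sub_pow_le hq1 k
  have h2 : Real.exp (-(q * k)) < Real.exp (-(2 * Real.log d + 3)) :=
    Real.exp_lt_exp.2 (by linarith)
  have hd0 : 0 < d := by linarith
  have h3 : Real.exp (-(2 * Real.log d + 3)) = 1 / (d ^ 2 * Real.exp 3) := by
    rw [Real.exp_neg, Real.exp_add, two_mul, Real.exp_add, Real.exp_log hd0, one_div, sq]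
  have h4 : (8 : ℝ) < Real.exp 3 := by
    have h5 := Real.exp_one_gt_d9
    have h6 : Real.exp 3 = Real.exp 1 ^ 3 := by rw [← Real.exp_nat_mul]; norm_num
    rw [h6]
    calc (8 : ℝ) = 2 ^ 3 := by norm_num
      _ < _ := pow_lt_pow_left₀ (by linarith) (by norm_num) (by norm_num)
  have h5 : 0 < d ^ 2 * Real.exp 3 := by positivity
  have hD0 : (0 : ℝ) ≤ 1 + (1 + κ / Real.log n) * d := by positivity
  calc 2 * (1 + (1 + κ / Real.log n) * d) ^ 2 * (1 - q) ^ k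
      ≤ 2 * (2 * d) ^ 2 * (1 - q) ^ k := by
        have : 0 ≤ (1 - q) ^ k := pow_nonneg (by linarith) k
        gcongr
    _ ≤ 2 * (2 * d) ^ 2 * (1 / (d ^ 2 * Real.exp 3)) := by
        rw [← h3]
        exact mul_le_mul_of_nonneg_left (h1.trans h2.le) (by positivity)
    _ = 8 / Real.exp 3 := by field_simp; ring
    _ < 1 := by rw [div_lt_one (Real.exp_pos _)]; exact h4

end UpperBound

section LowerBound

open scoped Classical

/-! ### The lower bound -/

variable {V : Type*}

/-- A lower bound for the number of pairs of elements of `U` with the same colour, in terms of the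
exponential moment of the size of the colour. The estimate is the Cauchy-Schwarz inequality. -/
lemma sq_sum_pow_card_le (U S : Finset V) (T : V → Finset V) (hT : ∀ u, T u ⊆ S) (c : ℝ) :
    (∑ u ∈ U, c ^ (T u).card) ^ 2 ≤
      equalPairs U T * (1 + c ^ 2) ^ S.card := by
  have h0 : equalPairs U T =
      ∑ x ∈ U.image T, ((U.filter fun u => T u = x).card : ℝ) ^ 2 := by
    unfold equalPairs
    congr!
  rw [h0]
  have h1 : ∑ u ∈ U, c ^ (T u).card =
      ∑ x ∈ U.image T, ((U.filter fun u => T u = x).card : ℝ) * c ^ x.card := by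
    rw [← Finset.sum_fiberwise_of_maps_to (g := T) (t := U.image T)
      fun u hu => Finset.mem_image_of_mem T hu]
    refine Finset.sum_congr rfl fun x _ => ?_
    rw [Finset.sum_congr rfl (g := fun _ => c ^ x.card), Finset.sum_const, nsmul_eq_mul]
    intro u hu
    rw [(Finset.mem_filter.1 hu).2]
  rw [h1]
  refine (Finset.sum_mul_sq_le_sq_mul_sq _ _ _).trans ?_
  refine mul_le_mul_of_nonneg_left ?_ (Finset.sum_nonneg fun _ _ => sq_nonneg _)
  have h2 : U.image T ⊆ S.powerset := by
    intro x hx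
    obtain ⟨u, _, rfl⟩ := Finset.mem_image.1 hx
    exact Finset.mem_powerset.2 (hT u)
  refine (Finset.sum_le_sum_of_subset_of_nonneg h2 fun _ _ _ => sq_nonneg _).trans ?_
  have h3 := Finset.sum_pow_mul_eq_add_pow (c ^ 2) 1 S
  simp only [one_pow, mul_one] at h3
  rw [add_comm, ← h3]
  exact Finset.sum_le_sum fun x _ => by rw [← pow_mul, ← pow_mul, mul_comm]

/-- If every `R ⊆ S` is contained in the colours of at least `a y ^ |R| - b` elements of `U`, then
the exponential moment of the size of the colour is bounded below. -/
lemma le_sum_pow_card (U S : Finset V) (T : V → Finset V) (hT : ∀ u, T u ⊆ S) {a b y c : ℝ}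
    (hc : 1 ≤ c) (h : ∀ R ⊆ S, a * y ^ R.card - b ≤ ((U.filter fun u => R ⊆ T u).card : ℝ)) :
    a * (1 + (c - 1) * y) ^ S.card - b * c ^ S.card ≤ ∑ u ∈ U, c ^ (T u).card := by
  have h1 : ∀ X : Finset V, c ^ X.card = ∑ R ∈ X.powerset, (c - 1) ^ R.card := by
    intro X
    have := Finset.sum_pow_mul_eq_add_pow (c - 1) 1 X
    simp only [one_pow, mul_one, sub_add_cancel] at this
    exact this.symm
  have h2 : ∑ u ∈ U, c ^ (T u).card =
      ∑ R ∈ S.powerset, (c - 1) ^ R.card * ((U.filter fun u => R ⊆ T u).card : ℝ) := by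
    calc ∑ u ∈ U, c ^ (T u).card
        = ∑ u ∈ U, ∑ R ∈ S.powerset, if R ⊆ T u then (c - 1) ^ R.card else 0 := by
          refine Finset.sum_congr rfl fun u _ => ?_
          rw [h1, ← Finset.sum_filter]
          refine Finset.sum_congr ?_ fun _ _ => rfl
          ext R
          simp only [Finset.mem_powerset, Finset.mem_filter]
          exact ⟨fun hR => ⟨hR.trans (hT u), hR⟩, fun hR => hR.2⟩
      _ = ∑ R ∈ S.powerset, ∑ u ∈ U, if R ⊆ T u then (c - 1) ^ R.card else 0 :=
          Finset.sum_comm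
      _ = _ := by
          refine Finset.sum_congr rfl fun R _ => ?_
          rw [← Finset.sum_filter, Finset.sum_const, nsmul_eq_mul, mul_comm]
  have h3 : a * (1 + (c - 1) * y) ^ S.card - b * c ^ S.card =
      ∑ R ∈ S.powerset, (c - 1) ^ R.card * (a * y ^ R.card - b) := by
    have h4 := Finset.sum_pow_mul_eq_add_pow ((c - 1) * y) 1 S
    simp only [one_pow, mul_one] at h4
    rw [add_comm 1, ← h4, h1 S, Finset.mul_sum, Finset.mul_sum, ← Finset.sum_sub_distrib]
    refine Finset.sum_congr rfl fun R _ => ?_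
    rw [mul_pow]; ring
  rw [h2, h3]
  exact Finset.sum_le_sum fun R hR => mul_le_mul_of_nonneg_left (h R (Finset.mem_powerset.1 hR))
    (pow_nonneg (by linarith) _)

variable [Fintype V]

/-- The vertices other than `v` whose distance from each element of `S` is `i` or `i + 1`. -/
noncomputable def typicalVerts (H : SimpleGraph V) (v : V) (S : Finset V) (i : ℕ) : Finset V :=
  Finset.univ.filter fun u => u ≠ v ∧ ∀ s ∈ S, (i : ℕ∞) ≤ H.edist s u ∧ H.edist s u ≤ (i + 1 : ℕ)

/-- The elements of `S` at distance `i + 1` from `u`. -/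
noncomputable def farSensors (H : SimpleGraph V) (S : Finset V) (i : ℕ) (u : V) : Finset V :=
  S.filter fun s => H.edist s u = (i + 1 : ℕ)

/-- Each set of at most `log n / A` sensors whose total collision rate is large produces a
collision in the neighbourhood of each vertex. -/
def Colliding (G : SimpleGraph V) (p A M : ℝ) (i : ℕ) : Prop :=
  ∀ (v : V) (S : Finset V), A * S.card ≤ Real.log (Fintype.card V) →
    M ≤ totalRate p (typicalVerts (isolate G {v}) v S i) (farSensors (isolate G {v}) S i) →
      ¬ NoCollision G v (typicalVerts (isolate G {v}) v S i) (farSensors (isolate G {v}) S i)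

/-- Each set of size at most `m` contributes at least `1` to the sum of `n ^ (m - |S|)` over all
sets `S`, which is `n ^ m (1 + 1 / n) ^ n`. -/
lemma card_filter_card_le (m : ℕ) (hV : 0 < Fintype.card V) :
    ((Finset.univ.filter fun S : Finset V => S.card ≤ m).card : ℝ) ≤
      3 * (Fintype.card V : ℝ) ^ m := by
  set n := Fintype.card V with hn
  have hn0 : (0 : ℝ) < n := by exact_mod_cast hV
  have hn1 : (1 : ℝ) ≤ n := by exact_mod_cast hV
  have h1 : ((Finset.univ.filter fun S : Finset V => S.card ≤ m).card : ℝ) ≤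
      ∑ S : Finset V, (n : ℝ) ^ m * (1 / n) ^ S.card := by
    rw [Finset.card_filter, Nat.cast_sum]
    refine Finset.sum_le_sum fun S _ => ?_
    split_ifs with h
    · rw [one_div, inv_pow, ← div_eq_mul_inv, Nat.cast_one, one_le_div (by positivity)]
      exact pow_le_pow_right₀ hn1 h
    · rw [Nat.cast_zero]; positivity
  rw [← Finset.mul_sum, sum_pow_card_eq, ← hn] at h1
  have h2 : (1 + 1 / (n : ℝ)) ^ n ≤ 3 := by
    calc (1 + 1 / (n : ℝ)) ^ n ≤ Real.exp (1 / n) ^ n :=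
          pow_le_pow_left₀ (by positivity) (by linarith [Real.add_one_le_exp (1 / (n : ℝ))]) _
      _ = Real.exp 1 := by rw [← Real.exp_nat_mul]; congr 1; field_simp
      _ ≤ 3 := by linarith [Real.exp_one_lt_d9]
  calc _ ≤ _ := h1
    _ ≤ (n : ℝ) ^ m * 3 := mul_le_mul_of_nonneg_left h2 (by positivity)
    _ = _ := by ring

/-- There are at most `n` choices of `v`, and `3 exp (log² n / A)` choices of `S`. -/
lemma prob_not_colliding_le {p A M : ℝ} (h0 : 0 ≤ p) (h1 : p ≤ 1) (hA : 0 < A)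
    (hV : 0 < Fintype.card V) (i : ℕ) :
    prob p (fun F => ¬ Colliding (graphOf F : SimpleGraph V) p A M i) ≤
      3 * Real.exp (Real.log (Fintype.card V) + Real.log (Fintype.card V) ^ 2 / A - M) := by
  set n := Fintype.card V with hn
  set L := Real.log n with hL
  have hn1 : (1 : ℝ) ≤ n := by exact_mod_cast hV
  have hn0 : (0 : ℝ) < n := by linarith
  have hL0 : 0 ≤ L := Real.log_nonneg hn1
  set m := ⌊L / A⌋₊ with hm
  set I : Finset (V × Finset V) :=
    Finset.univ ×ˢ (Finset.univ.filter fun S : Finset V => S.card ≤ m) with hI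
  have key : ∀ x : V × Finset V, prob p (fun F =>
      M ≤ totalRate p (typicalVerts (isolate (graphOf F) {x.1}) x.1 x.2 i)
        (farSensors (isolate (graphOf F) {x.1}) x.2 i) ∧
      NoCollision (graphOf F) x.1 (typicalVerts (isolate (graphOf F) {x.1}) x.1 x.2 i)
        (farSensors (isolate (graphOf F) {x.1}) x.2 i)) ≤ Real.exp (-M) := by
    intro x
    have hv : ∀ H : SimpleGraph V, x.1 ∉ typicalVerts H x.1 x.2 i := by
      intro H; simp [typicalVerts]
    exact prob_isolate_noCollision_le (M := M) h0 h1 x.1 (fun H => typicalVerts H x.1 x.2 i)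
      (fun H => farSensors H x.2 i) hv
  refine (prob_mono h0 h1 (B := fun F => ∃ x ∈ I,
      M ≤ totalRate p (typicalVerts (isolate (graphOf F) {x.1}) x.1 x.2 i)
        (farSensors (isolate (graphOf F) {x.1}) x.2 i) ∧
      NoCollision (graphOf F) x.1 (typicalVerts (isolate (graphOf F) {x.1}) x.1 x.2 i)
        (farSensors (isolate (graphOf F) {x.1}) x.2 i)) fun F hF => ?_).trans
    ((prob_exists_le h0 h1 _ _).trans ((Finset.sum_le_sum fun x _ => key x).trans ?_))
  · simp only [Colliding, not_forall, not_not] at hF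
    obtain ⟨v, S, hS, hM, hno⟩ := hF
    refine ⟨(v, S), ?_, hM, hno⟩
    simp only [hI, Finset.mem_product, Finset.mem_univ, true_and, Finset.mem_filter]
    refine Nat.le_floor ?_
    rw [le_div_iff₀ hA, mul_comm]
    exact hS
  · rw [Finset.sum_const, nsmul_eq_mul, hI, Finset.card_product, Finset.card_univ, ← hn]
    push_cast
    have h2 := card_filter_card_le (V := V) m hV
    rw [← hn] at h2
    have h3 : (n : ℝ) ^ m ≤ Real.exp (L ^ 2 / A) := by
      have h4 : (n : ℝ) = Real.exp L := (Real.exp_log hn0).symm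
      rw [h4, ← Real.exp_nat_mul]
      apply Real.exp_le_exp.2
      have h5 : (m : ℝ) ≤ L / A := Nat.floor_le (by positivity)
      calc (m : ℝ) * L ≤ L / A * L := mul_le_mul_of_nonneg_right h5 hL0
        _ = _ := by ring
    have h6 : Real.exp (L + L ^ 2 / A - M) = n * Real.exp (L ^ 2 / A) * Real.exp (-M) := by
      rw [sub_eq_add_neg, Real.exp_add, Real.exp_add, Real.exp_log hn0]
    rw [h6]
    calc (n : ℝ) * _ * Real.exp (-M) ≤ n * (3 * Real.exp (L ^ 2 / A)) * Real.exp (-M) := by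
          gcongr
          exact h2.trans (by linarith)
      _ = _ := by ring

/-- The total rate is large if there are many monochromatic pairs: either a single colour class is
huge, or the quadratic parts of the rates add up. -/
lemma le_totalRate {γ : Type*} {U : Finset V} {T : V → γ} {p B Q : ℝ} (hp : 0 ≤ p)
    (hB : 1 ≤ B) (hQ : Q ≤ p ^ 2 * equalPairs U T)
    (hQB : 4 * B ^ 2 + 2 * (p ^ 2 * Fintype.card V) ≤ Q) :
    B / 4 ≤ totalRate p U T := by
  unfold totalRate
  unfold equalPairs at hQ
  set a : γ → ℝ := fun x => ((U.filter fun u => T u = x).card : ℝ) with ha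
  have ha1 : ∀ x ∈ U.image T, 1 ≤ a x := by
    intro x hx
    obtain ⟨u, hu, rfl⟩ := Finset.mem_image.1 hx
    have : 0 < (U.filter fun w => T w = T u).card := Finset.card_pos.2 ⟨u, by simp [hu]⟩
    simp only [ha]
    exact_mod_cast this
  have ht : ∀ x ∈ U.image T, 0 ≤ p * (a x - 1) := fun x hx =>
    mul_nonneg hp (by linarith [ha1 x hx])
  by_cases hbig : ∃ x ∈ U.image T, B ≤ p * (a x - 1)
  · obtain ⟨x, hx, hxB⟩ := hbig
    refine le_trans ?_ (Finset.single_le_sum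
      (f := fun x => collisionRate (p * (a x - 1))) (fun y hy => collisionRate_nonneg (ht y hy)) hx)
    simp only [collisionRate]
    set t := p * (a x - 1)
    rw [le_div_iff₀ (by linarith)]
    nlinarith
  · push Not at hbig
    have hsum : ∑ x ∈ U.image T, a x = U.card := by
      simp only [ha]
      rw [← Nat.cast_sum, ← Finset.card_eq_sum_card_image]
    have hUn : (U.card : ℝ) ≤ Fintype.card V := Nat.cast_le.2 (Finset.card_le_univ _)
    have h1 : ∀ x ∈ U.image T, p ^ 2 * (a x ^ 2 / 2 - a x) ≤
        4 * B * collisionRate (p * (a x - 1)) := by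
      intro x hx
      have h2 := hbig x hx
      have h3 := ht x hx
      have h4 : p ^ 2 * (a x ^ 2 / 2 - a x) ≤ (p * (a x - 1)) ^ 2 := by
        rw [mul_pow]
        refine mul_le_mul_of_nonneg_left ?_ (by positivity)
        nlinarith [sq_nonneg (a x - 2)]
      refine h4.trans ?_
      simp only [collisionRate]
      set t := p * (a x - 1)
      rw [← mul_div_assoc, le_div_iff₀ (by linarith)]
      nlinarith [mul_le_mul_of_nonneg_left (by linarith : 2 * (1 + t) ≤ 4 * B) (sq_nonneg t)]
    have h5 := Finset.sum_le_sum h1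
    rw [← Finset.mul_sum, ← Finset.mul_sum, Finset.sum_sub_distrib, ← Finset.sum_div, hsum] at h5
    have h6 : p ^ 2 * (U.card : ℝ) ≤ p ^ 2 * Fintype.card V :=
      mul_le_mul_of_nonneg_left hUn (by positivity)
    have h7 : B ^ 2 ≤ 4 * B *
        ∑ x ∈ U.image T, collisionRate (p * (a x - 1)) := by
      nlinarith
    have hB0 : 0 < B := by linarith
    have h8 : B * (B / 4) ≤ B * ∑ x ∈ U.image T, collisionRate (p * (a x - 1)) := by nlinarith
    exact le_of_mul_le_mul_left h8 hB0

end LowerBound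

section LowerBoundRegime

open scoped Classical

/-! ### Distances to the sensors without one vertex -/

variable {V : Type*} [Fintype V] {G : SimpleGraph V} {A N κ p : ℝ} {i : ℕ}

/-- Consequences of `RegimeAt` for the number `(p n) ^ (i - 1)`, which approximates the size of a
ball of radius `i - 1`. -/
lemma RegimeAt.scale {n : ℕ} (h : RegimeAt A N n p i) (hA : 0 < A) (hκ : 0 < κ)
    (hκ1 : κ ≤ 1 / 16) (hN : 16 * (A + 1) / κ ^ 2 ≤ N) :
    (256 : ℝ) ≤ n ∧ A - κ ≤ p * (p * n) ^ (i - 1) ∧ p * (p * n) ^ (i - 1) ≤ A + κ ∧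
      (p * n) ^ (i - 1) * (p * n) ≤ (A + 1) * n := by
  obtain ⟨-, -, hN1, hNκ, -, -, -, -, -, -, -⟩ := h.basic hA hκ hκ1 hN
  have hL1 : 256 ≤ Real.log n := hN1.trans h.le_log
  have hn0 : (0 : ℝ) < n := by
    rcases Nat.eq_zero_or_pos n with h0 | h0
    · rw [h0] at hL1; norm_num at hL1
    · exact_mod_cast h0
  have h1 := h.p_mul_pow_pred hn0
  have h2 := h.le_ratio
  have h3 := h.ratio_le
  have h4 : p * (p * n) ^ (i - 1) ≤ A + κ := by rw [h1]; linarith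
  refine ⟨?_, by rw [h1]; linarith, h4, ?_⟩
  · linarith [Real.log_le_sub_one_of_pos hn0]
  · calc (p * n) ^ (i - 1) * (p * n) = p * (p * n) ^ (i - 1) * n := by ring
      _ ≤ _ := mul_le_mul_of_nonneg_right (by linarith) hn0.le

lemma separationRate_le (hA : 0 < A) (hκ : 0 < κ) (hκ1 : κ ≤ 1 / 16) (hκA : κ < A) :
    separationRate A κ ≤ (1 - κ) * (1 - Real.exp (-((1 - 4 * κ) * (A - κ)))) := by
  unfold separationRate
  refine mul_le_mul_of_nonneg_left ?_ (by linarith)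
  have h1 : Real.exp (-((1 - 4 * κ) * (A - κ))) ≤ Real.exp (-((1 - 12 * κ) * (A - κ))) := by
    apply Real.exp_le_exp.2
    nlinarith
  have h2 : Real.exp (-((1 - 12 * κ) * (A - κ))) ≤ 1 := by
    rw [Real.exp_le_one_iff]
    have := mul_nonneg (by linarith : 0 ≤ 1 - 12 * κ) (by linarith : 0 ≤ A - κ)
    linarith
  have h3 : Real.exp (-((1 + 4 * κ) * (1 + 2 * κ) * (A + κ))) ≤ 1 := by
    rw [Real.exp_le_one_iff]
    have : 0 ≤ (1 + 4 * κ) * (1 + 2 * κ) * (A + κ) := by positivity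
    linarith
  have h4 := mul_le_mul_of_nonneg_left h3 (by linarith :
    0 ≤ 1 - Real.exp (-((1 - 12 * κ) * (A - κ))))
  linarith

/-- Balls of radius `i` in the graph without one vertex contain a positive proportion of all
vertices. -/
lemma RegimeAt.le_card_ball (h : RegimeAt A N (Fintype.card V) p i) (hA : 0 < A)
    (hκ : 0 < κ) (hκ1 : κ ≤ 1 / 16) (hκA : κ < A) (hN : 16 * (A + 1) / κ ^ 2 ≤ N)
    (hN2 : 16 * (A + 1) ≤ N * (κ ^ 2 * separationRate A κ))
    (hdeg : DegreeLE G ((1 + κ / Real.log (Fintype.card V)) * (p * Fintype.card V)))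
    (hexp : Expanding G p (κ / Real.log (Fintype.card V))) (hexp' : Expanding G p κ)
    {s v : V} (hsv : s ≠ v) :
    separationRate A κ * Fintype.card V / 4 ≤ (ball (isolate G {v}) {s} i).card := by
  have hb := h.card_ball_bounds hA hκ hκ1 hN hdeg hexp (Z := {v}) (by simp) (X := {s})
    (by simp) (by simp) (by simpa using hsv)
  have hφle := separationRate_le hA hκ hκ1 hκA
  obtain ⟨hn, hα1, hα2, hD₀d⟩ := h.scale hA hκ hκ1 hN
  obtain ⟨hκN, -, hN1, hNκ, hpκ, -, -, hd, hdL, -, -⟩ := h.basic hA hκ hκ1 hN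
  simp only [Finset.card_singleton, Nat.cast_one, one_mul] at hb
  set n := Fintype.card V
  set L := Real.log n with hL
  have hL1 : 256 ≤ L := hN1.trans h.le_log
  have hn0 : (0 : ℝ) < n := by linarith
  have hdeg' := h.le_degree
  have hp0 := h.p_nonneg
  set d := p * n with hd_def
  set D₀ := d ^ (i - 1) with hD₀
  have hD₀0 : 0 ≤ D₀ := by positivity
  have hd0 : 0 < d := by linarith
  set φ := separationRate A κ with hφ_def
  set B := ball (isolate G {v}) {s} (i - 1) with hB
  have hN0 : 0 < N := by linarith
  have hφ0 : 0 < φ := by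
    by_contra hneg
    have : N * (κ ^ 2 * φ) ≤ 0 := mul_nonpos_of_nonneg_of_nonpos hN0.le
      (mul_nonpos_of_nonneg_of_nonpos (by positivity) (by linarith))
    linarith
  have hL3 : L ≤ L ^ 3 := le_self_pow₀ (by linarith) (by norm_num)
  have hBD : (B.card : ℝ) ≤ 2 * D₀ := by
    have h2 := mul_le_mul_of_nonneg_right (by linarith : 1 + 4 * κ ≤ 2) hD₀0
    linarith [hb.2]
  have hBn : (B.card : ℝ) ≤ κ * n := by
    have h1 : (4 * D₀) * d ≤ κ * n * d := by
      have h2 : 4 * (A + 1) ≤ κ * d := by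
        refine le_trans ?_ hdL
        nlinarith only [hA, hL1]
      calc 4 * D₀ * d = 4 * (D₀ * d) := by ring
        _ ≤ 4 * ((A + 1) * n) := by linarith
        _ = 4 * (A + 1) * n := by ring
        _ ≤ κ * d * n := mul_le_mul_of_nonneg_right h2 hn0.le
        _ = _ := by ring
    have h3 := le_of_mul_le_mul_right h1 hd0
    linarith
  have hmean : φ * n ≤ exclusiveMean n p B.card 0 := by
    rw [exclusiveMean, Nat.cast_zero, sub_zero, pow_zero, mul_one]
    have h1 := one_sub_pow_le (p := p) (by linarith) B.card
    have h2 : Real.exp (-(p * B.card)) ≤ Real.exp (-((1 - 4 * κ) * (A - κ))) := by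
      apply Real.exp_le_exp.2
      have h3 : (1 - 4 * κ) * (A - κ) ≤ (1 - 4 * κ) * (p * D₀) :=
        mul_le_mul_of_nonneg_left (by linarith) (by linarith)
      have h4 := mul_le_mul_of_nonneg_left hb.1 hp0
      linarith
    have h5 : Real.exp (-((1 - 4 * κ) * (A - κ))) ≤ 1 := by
      rw [Real.exp_le_one_iff]
      have := mul_nonneg (by linarith : 0 ≤ 1 - 4 * κ) (by linarith : 0 ≤ A - κ)
      linarith
    calc φ * n ≤ (1 - κ) * (1 - Real.exp (-((1 - 4 * κ) * (A - κ)))) * n :=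
          mul_le_mul_of_nonneg_right hφle hn0.le
      _ = (n - κ * n) * (1 - Real.exp (-((1 - 4 * κ) * (A - κ)))) := by ring
      _ ≤ (n - B.card) * (1 - (1 - p) ^ B.card) := by
        refine mul_le_mul (by linarith) (by linarith) (by linarith) ?_
        have := mul_le_mul_of_nonneg_right (by linarith : κ ≤ 1) hn0.le
        linarith
  have hE := hexp' B ∅ (Finset.disjoint_empty_right _)
    (by
      rw [Finset.union_empty]
      exact ⟨s, subset_ball _ _ _ (by simp)⟩) (by
    rw [Finset.card_empty, Nat.cast_zero, add_zero]
    refine le_trans ?_ (mul_le_mul_of_nonneg_left hmean (by positivity))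
    have h1 : (16 * D₀ * L) * d ≤ (κ ^ 2 * (φ * n)) * d := by
      have h2 : 16 * (A + 1) * L ≤ κ ^ 2 * φ * d := by
        calc 16 * (A + 1) * L ≤ N * (κ ^ 2 * φ) * L ^ 3 :=
              mul_le_mul hN2 hL3 (by linarith) (by positivity)
          _ = κ ^ 2 * φ * (N * L ^ 3) := by ring
          _ ≤ _ := mul_le_mul_of_nonneg_left hdeg' (by positivity)
      calc 16 * D₀ * L * d = 16 * L * (D₀ * d) := by ring
        _ ≤ 16 * L * ((A + 1) * n) := mul_le_mul_of_nonneg_left hD₀d (by linarith)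
        _ = 16 * (A + 1) * L * n := by ring
        _ ≤ κ ^ 2 * φ * d * n := mul_le_mul_of_nonneg_right h2 hn0.le
        _ = _ := by ring
    have h3 := le_of_mul_le_mul_right h1 hd0
    have h4 : 4 * (B.card : ℝ) * L ≤ 16 * D₀ * L :=
      mul_le_mul_of_nonneg_right (by linarith) (by linarith)
    exact h4.trans h3)
  rw [Finset.card_empty] at hE
  have hsub : exclusiveNbrs G B ∅ ⊆ ball (isolate G {v}) {s} i ∪ {v} := by
    intro u hu
    by_cases huv : u = v
    · simp [huv]
    refine Finset.mem_union_left _ ?_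
    simp only [exclusiveNbrs, Finset.mem_filter] at hu
    obtain ⟨-, ⟨w, hw, hadj⟩, -⟩ := hu
    obtain ⟨l, hl⟩ : ∃ l, i = l + 1 := ⟨i - 1, by have := h.two_le; omega⟩
    have hl' : i - 1 = l := by omega
    have hwv : w ∉ ({v} : Finset V) := Finset.disjoint_left.1
      (ball_disjoint_isolated (G := G) (Z := {v}) (X := {s}) (by simpa using hsv) (i - 1)) hw
    rw [hl, mem_ball_succ]
    rw [hB, hl'] at hw
    exact Or.inr ⟨w, hw, hadj, by simpa using huv, hwv⟩
  have h1 : ((exclusiveNbrs G B ∅).card : ℝ) ≤ (ball (isolate G {v}) {s} i).card + 1 := by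
    exact_mod_cast (Finset.card_le_card hsub).trans (Finset.card_union_le _ _)
  have h2 : (1 - κ) * (φ * n) ≤ (1 - κ) * exclusiveMean n p B.card 0 :=
    mul_le_mul_of_nonneg_left hmean (by linarith)
  have hφn0 : 0 ≤ φ * n := by positivity
  have h3 : (3 / 4) * (φ * n) ≤ (1 - κ) * (φ * n) :=
    mul_le_mul_of_nonneg_right (by linarith) hφn0
  have h4 : 4 ≤ φ * n := by
    have h5 : N ≤ n := h.le_log.trans (by linarith [Real.log_le_sub_one_of_pos hn0])
    have h6 : N * (κ ^ 2 * φ) ≤ n * (1 * φ) := by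
      have : κ ^ 2 ≤ 1 := by nlinarith
      gcongr
    linarith
  linarith

/-- All but few vertices are typical: the vertices at distance less than `i` from a sensor lie in a
ball of radius `i - 1`, and those at distance larger than `i + 1` have no neighbour in the ball of
radius `i`, which is so large that only few vertices have this property. -/
lemma RegimeAt.card_le_typicalVerts (h : RegimeAt A N (Fintype.card V) p i) (hA : 0 < A)
    (hκ : 0 < κ) (hκ1 : κ ≤ 1 / 16) (hκA : κ < A) (hN : 16 * (A + 1) / κ ^ 2 ≤ N)
    (hN2 : 16 * (A + 1) ≤ N * (κ ^ 2 * separationRate A κ))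
    (hdeg : DegreeLE G ((1 + κ / Real.log (Fintype.card V)) * (p * Fintype.card V)))
    (hexp : Expanding G p (κ / Real.log (Fintype.card V))) (hexp' : Expanding G p κ)
    (hjoin : Joined G p) {v : V} {S : Finset V} (hS : v ∉ S) :
    ((typicalVerts (isolate G {v}) v S i)ᶜ.card : ℝ) ≤
      1 + S.card * (2 * (p * Fintype.card V) ^ (i - 1) + 8 / (separationRate A κ * p)) := by
  set H := isolate G {v} with hH
  have hsub : (typicalVerts H v S i)ᶜ ⊆ {v} ∪ S.biUnion fun s =>
      ball H {s} (i - 1) ∪ ((ball H {s} (i + 1))ᶜ.erase v) := by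
    intro u hu
    by_cases huv : u = v
    · simp [huv]
    refine Finset.mem_union_right _ ?_
    simp only [typicalVerts, Finset.mem_compl, Finset.mem_filter, Finset.mem_univ, true_and,
      not_and, not_forall] at hu
    obtain ⟨s, hs, hsu⟩ := hu huv
    refine Finset.mem_biUnion.2 ⟨s, hs, ?_⟩
    by_cases h1 : (i : ℕ∞) ≤ H.edist s u
    · refine Finset.mem_union_right _ (Finset.mem_erase.2 ⟨huv, ?_⟩)
      rw [Finset.mem_compl, mem_ball_singleton]
      exact hsu h1
    · refine Finset.mem_union_left _ (mem_ball_singleton.2 ?_)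
      have h2 : H.edist s u < ((i - 1 : ℕ) : ℕ∞) + 1 := by
        have : ((i - 1 : ℕ) : ℕ∞) + 1 = (i : ℕ∞) := by
          have := h.two_le
          exact_mod_cast (by omega : i - 1 + 1 = i)
        rw [this]
        exact not_le.1 h1
      exact Order.le_of_lt_add_one h2
  have hcard : ∀ s ∈ S, ((ball H {s} (i - 1) ∪ ((ball H {s} (i + 1))ᶜ.erase v)).card : ℝ) ≤
      2 * (p * Fintype.card V) ^ (i - 1) + 8 / (separationRate A κ * p) := by
    intro s hs
    have hsv : s ≠ v := fun h => hS (h ▸ hs)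
    have hb := (h.card_ball_bounds hA hκ hκ1 hN hdeg hexp (Z := {v}) (by simp) (X := {s})
      (by simp) (by simp) (by simpa using hsv)).2
    have hball := h.le_card_ball hA hκ hκ1 hκA hN hN2 hdeg hexp hexp' hsv
    obtain ⟨hn, -, -, -⟩ := h.scale hA hκ hκ1 hN
    obtain ⟨-, -, hN1, -, -, -, -, hd, -, -, -⟩ := h.basic hA hκ hκ1 hN
    rw [← hH] at hb hball
    simp only [Finset.card_singleton, Nat.cast_one, one_mul] at hb
    set n := Fintype.card V
    have hn0 : (0 : ℝ) < n := by linarith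
    have hp0 : 0 < p := by
      rcases h.p_nonneg.lt_or_eq with h0 | h0
      · exact h0
      · rw [← h0] at hd; norm_num at hd
    have hφ0 : 0 < separationRate A κ := by
      by_contra hneg
      have : N * (κ ^ 2 * separationRate A κ) ≤ 0 :=
        mul_nonpos_of_nonneg_of_nonpos (by linarith)
          (mul_nonpos_of_nonneg_of_nonpos (by positivity) (by linarith))
      linarith
    have hT : (((ball H {s} (i + 1))ᶜ.erase v).card : ℝ) ≤ 8 / (separationRate A κ * p) := by
      by_contra! hlt
      obtain ⟨w, hw, t, ht, hadj⟩ := hjoin (ball H {s} i) ((ball H {s} (i + 1))ᶜ.erase v) (by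
        rw [Finset.disjoint_left]
        intro w hw hw'
        exact Finset.mem_compl.1 (Finset.mem_of_mem_erase hw') (ball_subset_succ _ _ _ hw)) (by
        rw [div_lt_iff₀ (by positivity)] at hlt
        calc 2 * (n : ℝ) = (1 / 4) * n * 8 := by ring
          _ ≤ (1 / 4) * n * (((ball H {s} (i + 1))ᶜ.erase v).card * (separationRate A κ * p)) :=
              mul_le_mul_of_nonneg_left hlt.le (by positivity)
          _ = p * ((separationRate A κ * n / 4) * ((ball H {s} (i + 1))ᶜ.erase v).card) := by ring
          _ ≤ _ := by gcongr)
      have hwv : w ∉ ({v} : Finset V) := Finset.disjoint_left.1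
        (ball_disjoint_isolated (G := G) (Z := {v}) (X := {s}) (by simpa using hsv) i) hw
      refine Finset.mem_compl.1 (Finset.mem_of_mem_erase ht) (mem_ball_succ.2 (Or.inr ⟨w, hw, ?_⟩))
      exact ⟨hadj.symm, by simpa using Finset.ne_of_mem_erase ht, hwv⟩
    have hD : 0 ≤ (p * n) ^ (i - 1) := by positivity
    have h2 := mul_le_mul_of_nonneg_right (by linarith : 1 + 4 * κ ≤ 2) hD
    have h3 : ((ball H {s} (i - 1) ∪ ((ball H {s} (i + 1))ᶜ.erase v)).card : ℝ) ≤
        (ball H {s} (i - 1)).card + ((ball H {s} (i + 1))ᶜ.erase v).card := by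
      exact_mod_cast Finset.card_union_le _ _
    linarith
  have h1 := (Finset.card_le_card hsub).trans ((Finset.card_union_le _ _).trans
    (Nat.add_le_add_left Finset.card_biUnion_le _))
  have h2 : ((typicalVerts H v S i)ᶜ.card : ℝ) ≤ 1 + ∑ s ∈ S,
      ((ball H {s} (i - 1) ∪ ((ball H {s} (i + 1))ᶜ.erase v)).card : ℝ) := by
    rw [Finset.card_singleton] at h1
    exact_mod_cast h1
  refine h2.trans ?_
  have h3 := Finset.sum_le_sum hcard
  rw [Finset.sum_const, nsmul_eq_mul] at h3
  linarith

/-- The number of typical vertices that are far from all elements of `R`: these are the typical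
vertices without a neighbour in the union of the balls of radius `i - 1` around `R`. -/
lemma RegimeAt.le_card_far (h : RegimeAt A N (Fintype.card V) p i) (hA : 0 < A)
    (hκ : 0 < κ) (hκ1 : κ ≤ 1 / 16) (hN : 16 * (A + 1) / κ ^ 2 ≤ N)
    (hdeg : DegreeLE G ((1 + κ / Real.log (Fintype.card V)) * (p * Fintype.card V)))
    (hexp : Expanding G p (κ / Real.log (Fintype.card V)))
    (havoid : Avoidable G p) {v : V} {R S : Finset V} (hS : v ∉ S) (hRS : R ⊆ S) :
    (Fintype.card V / 2 : ℝ) *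
          Real.exp (-((1 + 4 * κ) * (1 + 2 * κ) * (A + κ))) ^ R.card -
        18 * S.card * (p * Fintype.card V) ^ (i - 1) * Real.log (Fintype.card V) -
        (typicalVerts (isolate G {v}) v S i)ᶜ.card ≤
      ((typicalVerts (isolate G {v}) v S i).filter fun u =>
        R ⊆ farSensors (isolate G {v}) S i u).card := by
  set H := isolate G {v} with hH
  set U := typicalVerts H v S i with hU
  obtain ⟨hn, -, hα2, -⟩ := h.scale hA hκ hκ1 hN
  obtain ⟨-, -, hN1, -, hpκ, -, -, hd, -, -, -⟩ := h.basic hA hκ hκ1 hN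
  have hball : ∀ s ∈ R, ((ball H {s} (i - 1)).card : ℝ) ≤
      (1 + 4 * κ) * (p * Fintype.card V) ^ (i - 1) := by
    intro s hs
    have hsv : s ≠ v := fun h => hS (h ▸ hRS hs)
    have hb := (h.card_ball_bounds hA hκ hκ1 hN hdeg hexp (Z := {v}) (by simp) (X := {s})
      (by simp) (by simp) (by simpa using hsv)).2
    simpa using hb
  set n := Fintype.card V with hn_def
  set L := Real.log n with hL
  have hL1 : 256 ≤ L := hN1.trans h.le_log
  have hp0 := h.p_nonneg
  set D₀ := (p * n) ^ (i - 1) with hD₀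
  have hD₀0 : 0 ≤ D₀ := by positivity
  set W := R.biUnion fun s => ball H {s} (i - 1) with hW
  have hWcard : (W.card : ℝ) ≤ R.card * ((1 + 4 * κ) * D₀) := by
    have h1 : (W.card : ℝ) ≤ ∑ s ∈ R, ((ball H {s} (i - 1)).card : ℝ) := by
      exact_mod_cast Finset.card_biUnion_le
    have h2 := Finset.sum_le_sum hball
    rw [Finset.sum_const, nsmul_eq_mul] at h2
    linarith
  have hWS : (W.card : ℝ) ≤ 2 * S.card * D₀ := by
    have h1 : (R.card : ℝ) ≤ S.card := Nat.cast_le.2 (Finset.card_le_card hRS)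
    have h2 : (1 + 4 * κ) * D₀ ≤ 2 * D₀ := mul_le_mul_of_nonneg_right (by linarith) hD₀0
    calc (W.card : ℝ) ≤ R.card * ((1 + 4 * κ) * D₀) := hWcard
      _ ≤ S.card * (2 * D₀) := mul_le_mul h1 h2 (by positivity) (Nat.cast_nonneg _)
      _ = _ := by ring
  have hpow : Real.exp (-((1 + 4 * κ) * (1 + 2 * κ) * (A + κ))) ^ R.card ≤ (1 - p) ^ W.card := by
    rw [← Real.exp_nat_mul]
    refine le_trans (Real.exp_le_exp.2 ?_) (exp_le_one_sub_pow (by linarith) _)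
    rw [mul_neg, neg_le_neg_iff, div_le_iff₀ (by linarith)]
    have h2 : 1 ≤ (1 + 2 * κ) * (1 - p) := by
      calc (1 : ℝ) ≤ (1 + 2 * κ) * (1 - κ) := by nlinarith only [hκ, hκ1]
        _ ≤ _ := mul_le_mul_of_nonneg_left (by linarith) (by linarith)
    have h3 : 0 ≤ R.card * ((1 + 4 * κ) * (A + κ)) := by positivity
    calc p * (W.card : ℝ) ≤ p * (R.card * ((1 + 4 * κ) * D₀)) :=
          mul_le_mul_of_nonneg_left hWcard hp0
      _ = R.card * ((1 + 4 * κ) * (p * D₀)) := by ring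
      _ ≤ R.card * ((1 + 4 * κ) * (A + κ)) * 1 := by rw [mul_one]; gcongr
      _ ≤ R.card * ((1 + 4 * κ) * (A + κ)) * ((1 + 2 * κ) * (1 - p)) :=
          mul_le_mul_of_nonneg_left h2 h3
      _ = _ := by ring
  have hpow1 : (1 - p) ^ W.card ≤ 1 := pow_le_one₀ (by linarith) (by linarith)
  have hnon : (n : ℝ) / 2 * (1 - p) ^ W.card - 9 * W.card * L ≤ (nonNbrs G W).card := by
    rcases W.eq_empty_or_nonempty with hWe | hWne
    · have h1 : nonNbrs G W = Finset.univ := by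
        rw [hWe]; ext u; simp [nonNbrs]
      rw [h1, hWe, Finset.card_univ, ← hn_def]
      simp only [Finset.card_empty, pow_zero, Nat.cast_zero]
      linarith
    · have h1 : (W.card : ℝ) * (1 - p) ^ W.card ≤ W.card :=
        mul_le_of_le_one_right (Nat.cast_nonneg _) hpow1
      have h2 : (W.card : ℝ) * 1 ≤ W.card * L :=
        mul_le_mul_of_nonneg_left (by linarith) (Nat.cast_nonneg _)
      by_cases hcase : 16 * W.card * L ≤ (n - W.card) * (1 - p) ^ W.card
      · have h3 := havoid W hWne hcase
        have h4 : (n - W.card) * (1 - p) ^ W.card / 2 =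
          (n : ℝ) / 2 * (1 - p) ^ W.card - W.card * (1 - p) ^ W.card / 2 := by ring
        linarith
      · push Not at hcase
        have h4 : (n - W.card) * (1 - p) ^ W.card =
          (n : ℝ) * (1 - p) ^ W.card - W.card * (1 - p) ^ W.card := by ring
        have h5 : (0 : ℝ) ≤ (nonNbrs G W).card := Nat.cast_nonneg _
        linarith
  have hsub : nonNbrs G W ⊆ (U.filter fun u => R ⊆ farSensors H S i u) ∪ Uᶜ := by
    intro u hu
    by_cases huU : u ∈ U
    · refine Finset.mem_union_left _ (Finset.mem_filter.2 ⟨huU, fun s hs => ?_⟩)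
      simp only [hU, typicalVerts, Finset.mem_filter, Finset.mem_univ, true_and] at huU
      simp only [nonNbrs, Finset.mem_filter, Finset.mem_compl] at hu
      refine Finset.mem_filter.2 ⟨hRS hs, le_antisymm (huU.2 s (hRS hs)).2 ?_⟩
      have hnot : u ∉ ball H {s} i := by
        obtain ⟨l, hl⟩ : ∃ l, i = l + 1 := ⟨i - 1, by have := h.two_le; omega⟩
        have hl' : i - 1 = l := by omega
        rw [hl, mem_ball_succ]
        rintro (hu' | ⟨w, hw, hadj⟩)
        · exact hu.1 (Finset.mem_biUnion.2 ⟨s, hs, by rw [hl']; exact hu'⟩)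
        · exact hu.2 w (Finset.mem_biUnion.2 ⟨s, hs, by rw [hl']; exact hw⟩) hadj.1
      rw [mem_ball_singleton, not_le] at hnot
      push_cast
      exact Order.add_one_le_of_lt hnot
    · exact Finset.mem_union_right _ (Finset.mem_compl.2 huU)
  have h1 : ((nonNbrs G W).card : ℝ) ≤
      (U.filter fun u => R ⊆ farSensors H S i u).card + Uᶜ.card := by
    exact_mod_cast (Finset.card_le_card hsub).trans (Finset.card_union_le _ _)
  have h2 : (n : ℝ) / 2 * Real.exp (-((1 + 4 * κ) * (1 + 2 * κ) * (A + κ))) ^ R.card ≤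
      n / 2 * (1 - p) ^ W.card := mul_le_mul_of_nonneg_left hpow (by positivity)
  have h3 : 9 * W.card * L ≤ 9 * (2 * S.card * D₀) * L := by gcongr
  linarith

end LowerBoundRegime

section LowerBoundConclusion

open scoped Classical

/-! ### Monochromatic pairs -/

variable {V : Type*} [Fintype V] {G : SimpleGraph V} {A N κ p c : ℝ} {i : ℕ}

/-- Few sensors leave many monochromatic pairs of typical vertices. The weight `c ^ |T|` on the
set `T` of far sensors of a vertex changes the relative importance of the colours. For `k` sensors
the weighted count of the vertices is of order `n g ^ k`, where `g` is the right-hand side of `hc1`: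
by `hc1` the error terms, at most a small multiple of `n (c exp (-A)) ^ k`, are smaller, and by
`hc2` the Cauchy-Schwarz inequality yields at least of order `n ^ 2 exp (-A) ^ (2 k)` pairs. -/
lemma RegimeAt.le_totalRate (h : RegimeAt A N (Fintype.card V) p i) (hA : 0 < A)
    (hκ : 0 < κ) (hκ1 : κ ≤ 1 / 16) (hκA : κ < A) (hN : 16 * (A + 1) / κ ^ 2 ≤ N)
    (hN2 : 16 * (A + 1) ≤ N * (κ ^ 2 * separationRate A κ))
    (hN3 : 4 * ((20 * (A + 1) + 8 / separationRate A κ) / A + 1) ≤ N)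
    (hc : 1 ≤ c)
    (hc1 : c * Real.exp (-A) ≤
      1 + (c - 1) * Real.exp (-((1 + 4 * κ) * (1 + 2 * κ) * (A + κ))))
    (hc2 : Real.exp (-A) ^ 2 * (1 + c ^ 2) ≤
      (1 + (c - 1) * Real.exp (-((1 + 4 * κ) * (1 + 2 * κ) * (A + κ)))) ^ 2)
    (hdeg : DegreeLE G ((1 + κ / Real.log (Fintype.card V)) * (p * Fintype.card V)))
    (hexp : Expanding G p (κ / Real.log (Fintype.card V))) (hexp' : Expanding G p κ)
    (havoid : Avoidable G p) (hjoin : Joined G p) {v : V} {S : Finset V} (hS : v ∉ S)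
    (hk : A * S.card ≤ Real.log (p * Fintype.card V) - 3 * Real.log (Real.log (Fintype.card V))) :
    Real.log (Fintype.card V) ^ 3 / 64 ≤
      totalRate p (typicalVerts (isolate G {v}) v S i) (farSensors (isolate G {v}) S i) := by
  have hcompl := h.card_le_typicalVerts hA hκ hκ1 hκA hN hN2 hdeg hexp hexp' hjoin hS
  have hfar := fun R (hR : R ⊆ S) => h.le_card_far hA hκ hκ1 hN hdeg hexp havoid hS hR
  obtain ⟨hn, -, -, hD₀d⟩ := h.scale hA hκ hκ1 hN
  obtain ⟨-, hκN, hN1, -, hpκ, -, -, hd, -, -, -⟩ := h.basic hA hκ hκ1 hN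
  have hratio := h.ratio_le
  have hp0 := h.p_nonneg
  set U := typicalVerts (isolate G {v}) v S i
  set T := farSensors (isolate G {v}) S i
  set y := Real.exp (-((1 + 4 * κ) * (1 + 2 * κ) * (A + κ))) with hy
  set n := Fintype.card V with hn_def
  set L := Real.log n with hL
  set φ := separationRate A κ with hφ
  have hL1 : 256 ≤ L := hN1.trans h.le_log
  have hNL : N ≤ L := h.le_log
  set D₀ := (p * n) ^ (i - 1) with hD₀
  set d := p * n with hd_def
  set k := S.card with hk_def
  set x := Real.exp (-A) with hx
  set g := 1 + (c - 1) * y with hg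
  have hn0 : (0 : ℝ) < n := by linarith
  have hd0 : 0 < d := by linarith
  have hL0 : 0 < L := by linarith
  have hy0 : 0 < y := Real.exp_pos _
  have hx0 : 0 < x := Real.exp_pos _
  have hg1 : 1 ≤ g := by
    have := mul_nonneg (by linarith : 0 ≤ c - 1) hy0.le
    linarith
  have hφ0 : 0 < φ := by
    by_contra hneg
    have : N * (κ ^ 2 * φ) ≤ 0 := mul_nonpos_of_nonneg_of_nonpos (by linarith)
      (mul_nonpos_of_nonneg_of_nonpos (by positivity) (by linarith))
    linarith
  have hpn0 : 0 < p := by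
    rcases hp0.lt_or_eq with h0 | h0
    · exact h0
    · rw [hd_def, ← h0] at hd; norm_num at hd
  have hdn : d ≤ n := by
    have := mul_le_mul_of_nonneg_right (by linarith : p ≤ 1) hn0.le
    linarith
  -- The hypothesis on the number of sensors reads `exp (-A) ^ k ≥ log³ n / d`.
  have hxk : L ^ 3 / d ≤ x ^ k := by
    have h1 : L ^ 3 / d = Real.exp (-(Real.log d - 3 * Real.log L)) := by
      rw [neg_sub, Real.exp_sub, Real.exp_log hd0]
      congr 1
      have : 3 * Real.log L = ((3 : ℕ) : ℝ) * Real.log L := by norm_num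
      rw [this, Real.exp_nat_mul, Real.exp_log hL0]
    rw [h1, hx, ← Real.exp_nat_mul]
    apply Real.exp_le_exp.2
    linarith
  have hkL : (k : ℝ) ≤ L / A := by
    rw [le_div_iff₀ hA]
    have h1 : Real.log d ≤ L := Real.log_le_log hd0 hdn
    have h2 : 0 ≤ Real.log L := Real.log_nonneg (by linarith)
    linarith
  set E : ℝ := 18 * k * D₀ * L + (1 + k * (2 * D₀ + 8 / (φ * p))) with hE
  set C := (20 * (A + 1) + 8 / φ) / A + 1 with hC
  have hC0 : 0 < C := by positivity
  have hEle : E ≤ C * (n / d) * L ^ 2 := by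
    have h1 : D₀ ≤ (A + 1) * (n / d) := by
      rw [← mul_div_assoc, le_div_iff₀ hd0]; exact hD₀d
    have h2 : 8 / (φ * p) = 8 / φ * (n / d) := by
      rw [hd_def]; field_simp
    have h3 : 1 ≤ n / d := by rw [le_div_iff₀ hd0]; linarith
    have hkD : (k : ℝ) * D₀ ≤ L / A * ((A + 1) * (n / d)) :=
      mul_le_mul hkL h1 (by positivity) (by positivity)
    have hkφ : (k : ℝ) * (8 / φ * (n / d)) ≤ L / A * (8 / φ * (n / d)) :=
      mul_le_mul_of_nonneg_right hkL (by positivity)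
    have h4 : (k : ℝ) * D₀ ≤ k * D₀ * L := le_mul_of_one_le_right (by positivity) (by linarith)
    have h5 : L / A * (8 / φ * (n / d)) ≤ L / A * (8 / φ * (n / d)) * L :=
      le_mul_of_one_le_right (by positivity) (by linarith)
    have h6 : (1 : ℝ) ≤ n / d * L ^ 2 := one_le_mul_of_one_le_of_one_le h3
      (one_le_pow₀ (by linarith))
    have h7 := mul_le_mul_of_nonneg_right hkD hL0.le
    have h8 : C * (n / d) * L ^ 2 = 20 * (L / A * ((A + 1) * (n / d)) * L) +
        L / A * (8 / φ * (n / d)) * L + n / d * L ^ 2 := by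
      rw [hC]; field_simp
    rw [hE, h8, h2]
    linarith
  have hEc : E * c ^ k ≤ n / 4 * g ^ k := by
    have h1 : L ^ 2 / d ≤ x ^ k / L := by
      rw [le_div_iff₀ hL0]
      calc L ^ 2 / d * L = L ^ 3 / d := by ring
        _ ≤ _ := hxk
    have hck : 0 ≤ c ^ k := by positivity
    have hCL : C / L ≤ 1 / 4 := by
      rw [div_le_iff₀ hL0]; linarith
    calc E * c ^ k ≤ C * (n / d) * L ^ 2 * c ^ k := mul_le_mul_of_nonneg_right hEle hck
      _ = C * n * (L ^ 2 / d) * c ^ k := by ring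
      _ ≤ C * n * (x ^ k / L) * c ^ k := by gcongr
      _ = (C / L) * n * (c * x) ^ k := by rw [mul_pow]; ring
      _ ≤ (1 / 4) * n * g ^ k := by gcongr
      _ = _ := by ring
  have hsum := le_sum_pow_card U S T (fun u => Finset.filter_subset _ _) (a := n / 2) (b := E)
    (y := y) hc (fun R hR => by
      refine le_trans ?_ (hfar R hR)
      linarith)
  have hsum' : n / 4 * g ^ k ≤ ∑ u ∈ U, c ^ (T u).card := by linarith
  have hCS := sq_sum_pow_card_le U S T (fun u => Finset.filter_subset _ _) c
  have hpairs : (n : ℝ) ^ 2 / 16 * (L ^ 3 / d) ^ 2 ≤ equalPairs U T := by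
    have h1 : (n / 4 * g ^ k) ^ 2 ≤ equalPairs U T * (1 + c ^ 2) ^ k :=
      (pow_le_pow_left₀ (by positivity) hsum' 2).trans hCS
    have h2 : (x ^ 2 * (1 + c ^ 2)) ^ k ≤ (g ^ 2) ^ k := pow_le_pow_left₀ (by positivity) hc2 k
    have h3 : (n : ℝ) ^ 2 / 16 * (x ^ k) ^ 2 * (1 + c ^ 2) ^ k ≤
        equalPairs U T * (1 + c ^ 2) ^ k := by
      calc (n : ℝ) ^ 2 / 16 * (x ^ k) ^ 2 * (1 + c ^ 2) ^ k
          = (n : ℝ) ^ 2 / 16 * (x ^ 2 * (1 + c ^ 2)) ^ k := by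
            rw [mul_pow (x ^ 2), ← pow_mul, ← pow_mul, mul_comm k 2]
            ring
        _ ≤ (n : ℝ) ^ 2 / 16 * (g ^ 2) ^ k := mul_le_mul_of_nonneg_left h2 (by positivity)
        _ = (n / 4 * g ^ k) ^ 2 := by
            rw [← pow_mul, mul_pow (n / 4 : ℝ), ← pow_mul, mul_comm k 2]
            ring
        _ ≤ _ := h1
    have h4 := le_of_mul_le_mul_right h3 (by positivity)
    refine le_trans (mul_le_mul_of_nonneg_left ?_ (by positivity)) h4
    exact pow_le_pow_left₀ (by positivity) hxk 2
  have hpn : p ^ 2 * n ≤ A + 1 := by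
    have h1 : p ^ 2 * n = d ^ 2 / n := by rw [hd_def]; field_simp
    have h2 : d ^ 2 ≤ d ^ i := pow_le_pow_right₀ hd h.two_le
    have h3 : d ^ 2 / n ≤ d ^ i / n := div_le_div_of_nonneg_right h2 hn0.le
    have h4 : 1 / N ≤ 1 := by rw [div_le_one (by linarith)]; linarith
    linarith
  have hB : (1 : ℝ) ≤ L ^ 3 / 16 := by
    have : L ≤ L ^ 3 := le_self_pow₀ (by linarith) (by norm_num)
    linarith
  have hQ : L ^ 6 / 16 ≤ p ^ 2 * equalPairs U T := by
    calc L ^ 6 / 16 = p ^ 2 * ((n : ℝ) ^ 2 / 16 * (L ^ 3 / d) ^ 2) := by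
          rw [hd_def]; field_simp
      _ ≤ _ := mul_le_mul_of_nonneg_left hpairs (by positivity)
  have hres := Localization.le_totalRate hp0 hB hQ (by
    rw [← hn_def]
    have h1 : 16 * (A + 1) ≤ L := by
      have : κ * N ≤ 1 * N := mul_le_mul_of_nonneg_right (by linarith) (by linarith)
      linarith
    have h2 : 256 * L ≤ L ^ 6 := by
      have h3 : 256 ≤ L ^ 5 := hL1.trans (le_self_pow₀ (by linarith) (by norm_num))
      calc 256 * L ≤ L ^ 5 * L := mul_le_mul_of_nonneg_right h3 hL0.le
        _ = _ := by ring
    have h4 : 4 * (L ^ 3 / 16) ^ 2 = L ^ 6 / 64 := by ring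
    rw [h4]
    linarith)
  linarith

/-- Whichever sensors are used, the robber finds two neighbours of the current position with the
same signature. -/
lemma RegimeAt.le_localizationNumber (h : RegimeAt A N (Fintype.card V) p i) (hA : 0 < A)
    (hκ : 0 < κ) (hκ1 : κ ≤ 1 / 16) (hκA : κ < A) (hN : 16 * (A + 1) / κ ^ 2 ≤ N)
    (hN2 : 16 * (A + 1) ≤ N * (κ ^ 2 * separationRate A κ))
    (hN3 : 4 * ((20 * (A + 1) + 8 / separationRate A κ) / A + 1) ≤ N)
    (hc : 1 ≤ c)
    (hc1 : c * Real.exp (-A) ≤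
      1 + (c - 1) * Real.exp (-((1 + 4 * κ) * (1 + 2 * κ) * (A + κ))))
    (hc2 : Real.exp (-A) ^ 2 * (1 + c ^ 2) ≤
      (1 + (c - 1) * Real.exp (-((1 + 4 * κ) * (1 + 2 * κ) * (A + κ)))) ^ 2)
    (hdeg : DegreeLE G ((1 + κ / Real.log (Fintype.card V)) * (p * Fintype.card V)))
    (hexp : Expanding G p (κ / Real.log (Fintype.card V))) (hexp' : Expanding G p κ)
    (havoid : Avoidable G p) (hjoin : Joined G p)
    (hcoll : Colliding G p A (Real.log (Fintype.card V) ^ 3 / 64) i) :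
    (Real.log (p * Fintype.card V) - 3 * Real.log (Real.log (Fintype.card V))) * (1 / A) ≤
      localizationNumber G := by
  have hrate := fun v S (hS : v ∉ S) => h.le_totalRate hA hκ hκ1 hκA hN hN2 hN3 hc hc1 hc2 hdeg hexp
    hexp' havoid hjoin hS
  obtain ⟨hn, -, -, -⟩ := h.scale hA hκ hκ1 hN
  obtain ⟨-, -, hN1, -, hpκ, -, -, hd, -, -, -⟩ := h.basic hA hκ hκ1 hN
  have hp0 := h.p_nonneg
  have hL1 : 256 ≤ Real.log (Fintype.card V) := hN1.trans h.le_log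
  have hne : Nonempty V := by
    rw [← Fintype.card_pos_iff]
    have : (0 : ℝ) < Fintype.card V := by linarith
    exact_mod_cast this
  have hwin : CopsWin G (localizationNumber G) :=
    Nat.sInf_mem (s := {k | CopsWin G k}) ⟨_, copsWin_card G⟩
  rw [mul_one_div, div_le_iff₀ hA]
  by_contra! hlt
  have hdn : p * Fintype.card V ≤ Fintype.card V := by
    have := mul_le_mul_of_nonneg_right (by linarith : p ≤ 1)
      (Nat.cast_nonneg (α := ℝ) (Fintype.card V))
    linarith
  have hlog : Real.log (p * Fintype.card V) - 3 * Real.log (Real.log (Fintype.card V)) ≤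
      Real.log (Fintype.card V) := by
    have h1 := Real.log_le_log (by linarith) hdn
    have h2 : 0 ≤ Real.log (Real.log (Fintype.card V)) := Real.log_nonneg (by linarith)
    linarith
  refine not_copsWin_of_collision (fun v S hS => ?_) hwin
  -- A sensor at `v` does not distinguish the neighbours of `v`.
  have hcard : A * (S.erase v).card ≤
      Real.log (p * Fintype.card V) - 3 * Real.log (Real.log (Fintype.card V)) := by
    have h1 : ((S.erase v).card : ℝ) ≤ localizationNumber G := by
      rw [← hS]; exact Nat.cast_le.2 (Finset.card_le_card (Finset.erase_subset _ _))
    have h2 := mul_le_mul_of_nonneg_left h1 hA.le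
    linarith
  have hno := hcoll v (S.erase v) (hcard.trans hlog)
    (hrate v (S.erase v) (Finset.notMem_erase v S) hcard)
  unfold NoCollision at hno
  push Not at hno
  obtain ⟨u, hu, u', hu', hadj, hadj', heq, hne'⟩ := hno
  refine ⟨u, u', hadj, hadj', hne', signature_eq_iff.2 fun s hs => ?_⟩
  by_cases hsv : s = v
  · rw [hsv, SimpleGraph.edist_eq_one_iff_adj.2 hadj, SimpleGraph.edist_eq_one_iff_adj.2 hadj']
  refine edist_eq_of_isolate_edist_eq hsv hadj hadj' ?_
  have hs' : s ∈ S.erase v := Finset.mem_erase.2 ⟨hsv, hs⟩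
  simp only [typicalVerts, Finset.mem_filter, Finset.mem_univ, true_and] at hu hu'
  have key : ∀ w, (i : ℕ∞) ≤ (isolate G {v}).edist s w →
      (isolate G {v}).edist s w ≤ (i + 1 : ℕ) → (isolate G {v}).edist s w ≠ (i + 1 : ℕ) →
        (isolate G {v}).edist s w = i := by
    intro w h1 h2 h3
    refine le_antisymm (Order.le_of_lt_add_one ?_) h1
    have := lt_of_le_of_ne h2 h3
    push_cast at this
    exact this
  have hmem : (isolate G {v}).edist s u = (i + 1 : ℕ) ↔
      (isolate G {v}).edist s u' = (i + 1 : ℕ) := by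
    have h1 : s ∈ farSensors (isolate G {v}) (S.erase v) i u ↔
        s ∈ farSensors (isolate G {v}) (S.erase v) i u' := by rw [heq]
    simpa only [farSensors, Finset.mem_filter, hs', true_and] using h1
  by_cases hfar : (isolate G {v}).edist s u = (i + 1 : ℕ)
  · rw [hfar, hmem.1 hfar]
  · rw [key u (hu.2 s hs').1 (hu.2 s hs').2 hfar,
      key u' (hu'.2 s hs').1 (hu'.2 s hs').2 fun h => hfar (hmem.2 h)]

end LowerBoundConclusion

section Asymptotics

open scoped Classical

/-! ### From explicit bounds to asymptotic ones -/

variable {A : ℝ} {p : ℕ → unitInterval} {i : ℕ → ℕ}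

lemma one_sub_exp_neg_pos (hA : 0 < A) : 0 < 1 - Real.exp (-A) := by
  rw [sub_pos, Real.exp_lt_one_iff]
  linarith

lemma tendsto_log_natCast : Tendsto (fun n : ℕ => Real.log n) atTop atTop :=
  Real.tendsto_log_atTop.comp tendsto_natCast_atTop_atTop

lemma InRegime.eventually_regimeAt (h : InRegime A p i) (hA : 0 < A) {N : ℝ} (hN : 0 < N) :
    ∀ᶠ n in atTop, RegimeAt A N n (p n) (i n) := by
  obtain ⟨h1, h2, h3⟩ := h
  have hN' : 0 < 1 / N := by positivity
  have hA2 : 0 < A / 2 := by positivity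
  filter_upwards [h1.bound hN', h2.bound hN', h1.bound one_pos, h2.bound hA2,
    h3.eventually (Icc_mem_nhds (sub_lt_self A hN') (lt_add_of_pos_right A hN')),
    h3.eventually (Ioo_mem_nhds (half_lt_self hA) (lt_add_one A)),
    tendsto_log_natCast.eventually_ge_atTop N, tendsto_log_natCast.eventually_ge_atTop 8,
    tendsto_log_natCast.eventually_ge_atTop (Real.log (A + 1)),
    tendsto_natCast_atTop_atTop.eventually_ge_atTop (2 / A : ℝ),
    eventually_gt_atTop 0] with n e1 e2 e3 e4 e5 e6 e7 e8 e9 e10 e11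
  have hn : (0 : ℝ) < n := by exact_mod_cast e11
  have hp := (p n).2.1
  have hd : 0 ≤ degreeParam p n := mul_nonneg hp hn.le
  rw [Real.norm_of_nonneg hd, Real.norm_of_nonneg (pow_nonneg (by linarith) _)] at e1 e3
  rw [Real.norm_of_nonneg hd, Real.norm_of_nonneg hn.le] at e2 e4
  rw [one_div, inv_mul_eq_div, le_div_iff₀ hN] at e1 e2
  have hd512 : 512 ≤ degreeParam p n := by
    have : (8 : ℝ) ^ 3 ≤ Real.log n ^ 3 := pow_le_pow_left₀ (by norm_num) e8 3
    linarith
  refine ⟨hp, ?_, e7, ?_, e5.1, e5.2, ?_, ?_⟩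
  · have : (p n : ℝ) * N * n ≤ 1 * n := by
      rw [degreeParam] at e2; linarith
    exact le_of_mul_le_mul_right this hn
  · rw [degreeParam] at e1; linarith
  · by_contra! hi
    have h4 := e6.1
    have : degreeParam p n ^ i n / n ≤ A / 2 := by
      rw [div_le_iff₀ hn]
      interval_cases hin : i n
      · rw [pow_zero]
        rw [div_le_iff₀ hA] at e10
        linarith
      · rw [pow_one]; exact e4
    linarith
  · have hlog : 2 ≤ Real.log (degreeParam p n) := by
      rw [Real.le_log_iff_exp_le (by linarith), show (2 : ℝ) = 1 + 1 by norm_num, Real.exp_add]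
      have := Real.exp_one_lt_d9
      nlinarith [Real.exp_pos 1]
    have h4 : degreeParam p n ^ i n ≤ (A + 1) * n := by
      have := e6.2.le
      rwa [div_le_iff₀ hn] at this
    have h5 := Real.log_le_log (by positivity) h4
    rw [Real.log_pow, Real.log_mul (by positivity) hn.ne'] at h5
    have h6 := mul_le_mul_of_nonneg_left hlog (Nat.cast_nonneg (α := ℝ) (i n))
    linarith

/-- The conditions on the auxiliary constant `κ` hold at `κ = 0` with strict inequalities, for the
weight `c = 1 / (1 - exp (-A))`. -/
lemma exists_small_constant (hA : 0 < A) {η : ℝ} (hη : 0 < η) :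
    ∃ κ, 0 < κ ∧ κ ≤ 1 / 16 ∧ κ < A ∧ 0 < separationRate A κ ∧
      1 / ((1 - κ) * separationRate A κ) ≤
        (1 + η) * (Real.exp A / (1 - Real.exp (-A))) ∧
      1 / (1 - Real.exp (-A)) * Real.exp (-A) ≤ 1 + (1 / (1 - Real.exp (-A)) - 1) *
        Real.exp (-((1 + 4 * κ) * (1 + 2 * κ) * (A + κ))) ∧
      Real.exp (-A) ^ 2 * (1 + (1 / (1 - Real.exp (-A))) ^ 2) ≤
        (1 + (1 / (1 - Real.exp (-A)) - 1) *
          Real.exp (-((1 + 4 * κ) * (1 + 2 * κ) * (A + κ)))) ^ 2 := by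
  set x := Real.exp (-A) with hx
  have hx0 : 0 < x := Real.exp_pos _
  have hx1 : 0 < 1 - x := one_sub_exp_neg_pos hA
  set c := 1 / (1 - x) with hc
  have hy : Tendsto (fun κ : ℝ => Real.exp (-((1 + 4 * κ) * (1 + 2 * κ) * (A + κ))))
      (𝓝[>] 0) (𝓝 x) := by
    have : Continuous fun κ : ℝ => Real.exp (-((1 + 4 * κ) * (1 + 2 * κ) * (A + κ))) := by
      fun_prop
    have h := (this.tendsto 0).mono_left (nhdsWithin_le_nhds (s := Set.Ioi 0))
    simpa [hx] using h
  have hg : Tendsto (fun κ : ℝ =>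
      1 + (c - 1) * Real.exp (-((1 + 4 * κ) * (1 + 2 * κ) * (A + κ))))
      (𝓝[>] 0) (𝓝 (1 + (c - 1) * x)) := tendsto_const_nhds.add (tendsto_const_nhds.mul hy)
  have hs : Tendsto (separationRate A) (𝓝[>] 0) (𝓝 ((1 - x) * x)) := by
    have : Continuous (separationRate A) := by
      unfold separationRate; fun_prop
    have h := (this.tendsto 0).mono_left (nhdsWithin_le_nhds (s := Set.Ioi 0))
    simpa [separationRate, hx] using h
  have hid : Tendsto (fun κ : ℝ => κ) (𝓝[>] 0) (𝓝 0) :=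
    tendsto_id.mono_left nhdsWithin_le_nhds
  have hr : Tendsto (fun κ : ℝ => 1 / ((1 - κ) * separationRate A κ)) (𝓝[>] 0)
      (𝓝 (1 / ((1 - 0) * ((1 - x) * x)))) :=
    tendsto_const_nhds.div ((tendsto_const_nhds.sub hid).mul hs) (by positivity)
  have hlim : Real.exp A / (1 - x) = 1 / ((1 - 0) * ((1 - x) * x)) := by
    rw [hx, Real.exp_neg] at *
    field_simp
    ring
  have hpos : 0 < Real.exp A / (1 - x) := by positivity
  have l1 : c * x < 1 + (c - 1) * x := by nlinarith
  have l2 : x ^ 2 * (1 + c ^ 2) < (1 + (c - 1) * x) ^ 2 := by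
    have : (1 + (c - 1) * x) ^ 2 - x ^ 2 * (1 + c ^ 2) = 1 := by
      rw [hc]; field_simp; ring
    linarith
  have l3 : 1 / ((1 - 0) * ((1 - x) * x)) < (1 + η) * (Real.exp A / (1 - x)) := by
    rw [← hlim]; nlinarith
  have hev := ((((((hid.eventually (gt_mem_nhds (by norm_num : (0 : ℝ) < 1 / 16))).and
    (hid.eventually (gt_mem_nhds hA))).and
    (hs.eventually (lt_mem_nhds (by positivity : 0 < (1 - x) * x)))).and
    (hr.eventually (gt_mem_nhds l3))).and
    (hg.eventually (lt_mem_nhds l1))).and ((hg.pow 2).eventually (lt_mem_nhds l2))).and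
    (eventually_mem_nhdsWithin (a := (0 : ℝ)) (s := Set.Ioi 0))
  obtain ⟨κ, ⟨⟨⟨⟨⟨a1, a2⟩, a3⟩, a4⟩, a5⟩, a6⟩, a7⟩ := hev.exists
  exact ⟨κ, a7, a1.le, a2, a3, a4.le, a5.le, a6.le⟩

lemma tendsto_four_div_natCast : Tendsto (fun n : ℕ => 4 / (n : ℝ)) atTop (𝓝 0) :=
  tendsto_const_div_atTop_nhds_zero_nat 4

lemma InRegime.holdsAAS_degreeLE (h : InRegime A p i) (hA : 0 < A) {κ : ℝ} (hκ : 0 < κ) :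
    HoldsAAS p fun n G => DegreeLE G
      ((1 + κ / Real.log (Fintype.card (Fin n))) * ((p n : ℝ) * Fintype.card (Fin n))) := by
  have hN : 0 < max κ (8 / κ ^ 2) := lt_max_of_lt_left hκ
  refine holdsAAS_of_prob_not_le tendsto_one_div_atTop_nhds_zero_nat ?_
  filter_upwards [h.eventually_regimeAt hA hN, tendsto_log_natCast.eventually_ge_atTop 1,
    eventually_gt_atTop 0] with n hn hL hn0
  have hn1 : (0 : ℝ) < n := by exact_mod_cast hn0
  have hL0 : 0 < Real.log n := by linarith
  have hκL : κ ≤ Real.log n := (le_max_left _ _).trans hn.le_log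
  refine (prob_not_degreeLE_le (p n).2.1 (p n).2.2 ?_ ?_).trans ?_
  · rw [Fintype.card_fin]; positivity
  · rw [Fintype.card_fin]; exact (div_le_one hL0).2 hκL
  rw [Fintype.card_fin]
  have h1 : 2 * Real.log n ≤ (κ / Real.log n) ^ 2 * ((p n : ℝ) * n) / 4 := by
    calc 2 * Real.log n = (κ / Real.log n) ^ 2 * (8 / κ ^ 2 * Real.log n ^ 3) / 4 := by
          field_simp; norm_num
      _ ≤ (κ / Real.log n) ^ 2 * ((p n : ℝ) * n) / 4 := by
          have h2 := mul_le_mul_of_nonneg_right (le_max_right κ (8 / κ ^ 2))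
            (pow_nonneg hL0.le 3)
          have h3 := mul_le_mul_of_nonneg_left (h2.trans hn.le_degree)
            (sq_nonneg (κ / Real.log n))
          linarith
  calc (n : ℝ) * Real.exp (-((κ / Real.log n) ^ 2 * ((p n : ℝ) * n) / 4))
      ≤ n * Real.exp (-(2 * Real.log n)) :=
        mul_le_mul_of_nonneg_left (Real.exp_le_exp.2 (neg_le_neg h1)) hn1.le
    _ = 1 / n := by
        rw [two_mul, neg_add, Real.exp_add, Real.exp_neg, Real.exp_log hn1]
        field_simp

lemma holdsAAS_expanding (p : ℕ → unitInterval) {δ : ℕ → ℝ} (hδ : ∀ᶠ n in atTop, 0 ≤ δ n) :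
    HoldsAAS p fun n G => Expanding G (p n : ℝ) (δ n) := by
  refine holdsAAS_of_prob_not_le tendsto_four_div_natCast ?_
  filter_upwards [hδ, eventually_ge_atTop 2] with n hn h2
  simpa using prob_not_expanding_le (V := Fin n) (p n).2.1 (p n).2.2 hn (by simpa using h2)

lemma holdsAAS_avoidable (p : ℕ → unitInterval) :
    HoldsAAS p fun n G => Avoidable G (p n : ℝ) := by
  refine holdsAAS_of_prob_not_le tendsto_four_div_natCast ?_
  filter_upwards [eventually_ge_atTop 2] with n h2
  simpa using prob_not_avoidable_le (V := Fin n) (p n).2.1 (p n).2.2 (by simpa using h2)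

lemma holdsAAS_joined (p : ℕ → unitInterval) :
    HoldsAAS p fun n G => Joined G (p n : ℝ) := by
  have h1 : 4 * Real.exp (-2) < 1 := by
    have h2 : Real.exp (-2) * (Real.exp 1 * Real.exp 1) = 1 := by
      rw [← Real.exp_add, ← Real.exp_add]; norm_num
    have h3 := Real.exp_one_gt_d9
    have h4 : 4 < Real.exp 1 * Real.exp 1 := by nlinarith
    nlinarith [Real.exp_pos (-2)]
  refine holdsAAS_of_prob_not_le
    (tendsto_pow_atTop_nhds_zero_of_lt_one (by positivity) h1) (Eventually.of_forall fun n => ?_)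
  simpa using prob_not_joined_le (V := Fin n) (p n).2.1 (p n).2.2

lemma holdsAAS_colliding (hA : 0 < A) (p : ℕ → unitInterval) (i : ℕ → ℕ) :
    HoldsAAS p fun n G =>
      Colliding G (p n : ℝ) A (Real.log (Fintype.card (Fin n)) ^ 3 / 64) (i n) := by
  have hlim : Tendsto (fun n : ℕ => 3 * Real.exp (-Real.log n)) atTop (𝓝 0) := by
    have := (Real.tendsto_exp_neg_atTop_nhds_zero.comp tendsto_log_natCast).const_mul 3
    simpa using this
  refine holdsAAS_of_prob_not_le hlim ?_
  filter_upwards [tendsto_log_natCast.eventually_ge_atTop 1,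
    tendsto_log_natCast.eventually_ge_atTop (64 * (2 + 1 / A)), eventually_gt_atTop 0]
    with n h1 h2 h3
  refine (prob_not_colliding_le (V := Fin n) (p n).2.1 (p n).2.2 hA (by simpa using h3)
    (i n)).trans ?_
  rw [Fintype.card_fin]
  refine mul_le_mul_of_nonneg_left (Real.exp_le_exp.2 ?_) (by norm_num)
  have h4 : 64 * (2 + 1 / A) * Real.log n ^ 2 ≤ Real.log n * Real.log n ^ 2 :=
    mul_le_mul_of_nonneg_right h2 (sq_nonneg _)
  have h5 : Real.log n ≤ Real.log n ^ 2 := le_self_pow₀ h1 (by norm_num)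
  have h6 : Real.log n ^ 2 / A = 1 / A * Real.log n ^ 2 := by ring
  have h7 : Real.log n ^ 3 = Real.log n * Real.log n ^ 2 := by ring
  rw [h6, h7]
  linarith

/-- Both bounds, with a fixed relative error in the upper one. -/
lemma InRegime.holdsAAS_bounds (h : InRegime A p i) (hA : 0 < A) {η : ℝ} (hη : 0 < η) :
    HoldsAAS p fun n G =>
      (Real.log (degreeParam p n) - 3 * Real.log (Real.log n)) * (1 / A) ≤
        (localizationNumber G : ℝ) ∧
      (localizationNumber G : ℝ) ≤ (1 + η) *
        (Real.log (degreeParam p n) + 2 * Real.log (Real.log n)) *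
        (Real.exp A / (1 - Real.exp (-A))) := by
  obtain ⟨κ, hκ, hκ1, hκA, hs, hs', hc1, hc2⟩ :=
    exists_small_constant hA (by positivity : 0 < η / 2)
  set c := 1 / (1 - Real.exp (-A)) with hc
  have hx0 : 0 < Real.exp (-A) := Real.exp_pos _
  have hx1 : 0 < 1 - Real.exp (-A) := one_sub_exp_neg_pos hA
  have hc0 : 1 ≤ c := by rw [hc, le_div_iff₀ hx1]; linarith
  set B := Real.exp A / (1 - Real.exp (-A)) with hB
  have hB0 : 0 < B := by positivity
  set K := (1 + (1 + η / 2) * B * (3 / 2)) / (η / 2 * B) with hK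
  -- For `log d ≥ K` the additive constants in the upper bound are absorbed by a factor.
  obtain ⟨N, hN⟩ : ∃ N : ℝ, N = max (max (max (16 * (A + 1) / κ ^ 2)
    (16 * (A + 1) / (κ ^ 2 * separationRate A κ)))
    (4 * ((20 * (A + 1) + 8 / separationRate A κ) / A + 1))) (Real.exp K) := ⟨_, rfl⟩
  have hN1 : 16 * (A + 1) / κ ^ 2 ≤ N :=
    hN ▸ (le_max_left _ _).trans ((le_max_left _ _).trans (le_max_left _ _))
  have hN2 : 16 * (A + 1) / (κ ^ 2 * separationRate A κ) ≤ N :=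
    hN ▸ (le_max_right _ _).trans ((le_max_left _ _).trans (le_max_left _ _))
  have hN3 : 4 * ((20 * (A + 1) + 8 / separationRate A κ) / A + 1) ≤ N :=
    hN ▸ (le_max_right _ _).trans (le_max_left _ _)
  have hN4 : Real.exp K ≤ N := hN ▸ le_max_right _ _
  rw [div_le_iff₀ (by positivity)] at hN2
  have hN0 : 0 < N := (Real.exp_pos _).trans_le hN4
  have hδ : ∀ᶠ n : ℕ in atTop, 0 ≤ κ / Real.log (Fintype.card (Fin n)) := by
    filter_upwards with n
    rw [Fintype.card_fin]
    exact div_nonneg hκ.le (Real.log_natCast_nonneg n)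
  refine HoldsAAS.mono ((((((h.holdsAAS_degreeLE hA hκ).and (holdsAAS_expanding p hδ)).and
    (holdsAAS_expanding p (δ := fun _ => κ) (Eventually.of_forall fun _ => hκ.le))).and
    (holdsAAS_avoidable p)).and (holdsAAS_joined p)).and (holdsAAS_colliding hA p i)) ?_
  filter_upwards [h.eventually_regimeAt hA hN0, tendsto_log_natCast.eventually_ge_atTop 1]
    with n hn hL G ⟨⟨⟨⟨⟨g1, g2⟩, g3⟩, g4⟩, g5⟩, g6⟩
  have hn' : RegimeAt A N (Fintype.card (Fin n)) (p n) (i n) := by rwa [Fintype.card_fin]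
  have hlow := hn'.le_localizationNumber hA hκ hκ1 hκA hN1 hN2 hN3 hc0 hc1 hc2 g1 g2 g3 g4 g5 g6
  have hup := hn'.localizationNumber_le hA hκ hκ1 hκA hN1 hN2 g1 g2 g3
  rw [Fintype.card_fin] at hlow hup
  change (Real.log (degreeParam p n) - _) * _ ≤ _ at hlow
  change _ ≤ (2 * Real.log (degreeParam p n) + 3) / _ + 1 at hup
  refine ⟨hlow, hup.trans ?_⟩
  have hd : Real.exp K ≤ degreeParam p n := by
    have h1 : N * 1 ≤ N * Real.log n ^ 3 :=
      mul_le_mul_of_nonneg_left (one_le_pow₀ hL) hN0.le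
    have h2 : N * Real.log n ^ 3 ≤ degreeParam p n := hn.le_degree
    linarith
  have hlogd : K ≤ Real.log (degreeParam p n) :=
    (Real.le_log_iff_exp_le ((Real.exp_pos _).trans_le hd)).2 hd
  have hK0 : 0 ≤ K := by positivity
  rw [hK, div_le_iff₀ (by positivity)] at hlogd
  have hll : 0 ≤ Real.log (Real.log n) := Real.log_nonneg hL
  set D := Real.log (degreeParam p n)
  have hD0 : 0 ≤ D := by
    by_contra hneg
    have h1 : D * (η / 2 * B) ≤ 0 :=
      mul_nonpos_of_nonpos_of_nonneg (by linarith) (by positivity)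
    have h2 : 0 < 1 + (1 + η / 2) * B * (3 / 2) := by positivity
    linarith
  have hrw : (2 * D + 3) / (2 * (1 - κ) * separationRate A κ) =
      (D + 3 / 2) * (1 / ((1 - κ) * separationRate A κ)) := by
    have : 0 < 1 - κ := by linarith
    field_simp
  rw [hrw]
  have h1 := mul_le_mul_of_nonneg_left hs' (by linarith : 0 ≤ D + 3 / 2)
  have h2 : 0 ≤ (1 + η) * (2 * Real.log (Real.log n)) * B := by positivity
  linarith

/-- If an event with a fixed error parameter holds a.a.s. for every positive value of the
parameter, then the parameter can be made to tend to zero. -/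
lemma exists_tendsto_zero_holdsAAS {P : ℝ → ∀ n : ℕ, SimpleGraph (Fin n) → Prop}
    (h : ∀ η > 0, HoldsAAS p (P η)) :
    ∃ δ : ℕ → ℝ, Tendsto δ atTop (𝓝 0) ∧ HoldsAAS p fun n => P (δ n) n := by
  set f : ℕ → ℕ → ℝ := fun k n =>
    prob (p n : ℝ) (fun F => ¬ P (1 / ((k : ℝ) + 1)) n (graphOf F)) with hf
  have hev : ∀ k : ℕ, ∀ᶠ n in atTop, f k n ≤ 1 / ((k : ℝ) + 1) := fun k =>
    ((h _ Nat.one_div_pos_of_nat).tendsto_prob_not.eventually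
      (gt_mem_nhds Nat.one_div_pos_of_nat)).mono fun n hn => le_of_lt hn
  set K : ℕ → ℕ := fun n => Nat.findGreatest (fun k => f k n ≤ 1 / ((k : ℝ) + 1)) n with hK
  have hKt : Tendsto K atTop atTop := by
    refine tendsto_atTop.2 fun k => ?_
    filter_upwards [hev k, eventually_ge_atTop k] with n h1 h2
    exact Nat.le_findGreatest h2 h1
  have hlim : Tendsto (fun n => 1 / ((K n : ℝ) + 1)) atTop (𝓝 0) :=
    tendsto_one_div_add_atTop_nhds_zero_nat.comp hKt
  refine ⟨_, hlim, holdsAAS_of_prob_not_le hlim ?_⟩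
  -- `findGreatest` has the default value `0`, at which the bound has to be checked separately.
  filter_upwards [hev 0] with n hn
  exact Nat.findGreatest_spec (P := fun k => f k n ≤ 1 / ((k : ℝ) + 1)) (Nat.zero_le n) hn

/-- If `d ≥ (log n) ^ (3 + ε)` then the lower and the upper bound are of the same order. -/
lemma InRegime.holdsAAS_order (h : InRegime A p i) (hA : 0 < A) {ε : ℝ} (hε : 0 < ε)
    (hd : ∀ᶠ n : ℕ in atTop, Real.log n ^ (3 + ε) ≤ degreeParam p n) :
    HoldsAAS p fun n G =>
      ε / (2 * (3 + ε)) * (n * Real.log (degreeParam p n) / degreeParam p n ^ i n) ≤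
        (localizationNumber G : ℝ) ∧
      (localizationNumber G : ℝ) ≤ 8 * A * (Real.exp A / (1 - Real.exp (-A))) *
        (n * Real.log (degreeParam p n) / degreeParam p n ^ i n) := by
  refine (h.holdsAAS_bounds hA one_pos).mono ?_
  have hinv : Tendsto (fun n : ℕ => (n : ℝ) / degreeParam p n ^ i n) atTop (𝓝 (1 / A)) := by
    have := h.2.2.inv₀ hA.ne'
    simpa only [inv_div, one_div] using this
  have hlt : 1 / (2 * A) < 1 / A := one_div_lt_one_div_of_lt hA (by linarith)
  have hgt : 1 / A < 2 / A := by gcongr; norm_num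
  filter_upwards [hd, hinv.eventually (Ioo_mem_nhds hlt hgt),
    tendsto_log_natCast.eventually_ge_atTop 1] with n e1 e2 e3 G ⟨g1, g2⟩
  have hL0 : 0 < Real.log n := by linarith
  have hlog : (3 + ε) * Real.log (Real.log n) ≤ Real.log (degreeParam p n) := by
    rw [← Real.log_rpow hL0]
    exact Real.log_le_log (by positivity) e1
  have hll : 0 ≤ Real.log (Real.log n) := Real.log_nonneg e3
  have hx1 : 0 < 1 - Real.exp (-A) := one_sub_exp_neg_pos hA
  set B := Real.exp A / (1 - Real.exp (-A)) with hB
  have hB0 : 0 < B := by positivity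
  set D := Real.log (degreeParam p n)
  set ℓ := Real.log (Real.log n)
  set q := (n : ℝ) / degreeParam p n ^ i n with hq
  have hD0 : 0 ≤ D := le_trans (by positivity) hlog
  have hrw : n * D / degreeParam p n ^ i n = q * D := by rw [hq]; ring
  rw [hrw]
  constructor
  · refine le_trans ?_ g1
    have h1 : ε / (3 + ε) * D ≤ D - 3 * ℓ := by
      rw [div_mul_eq_mul_div, div_le_iff₀ (by positivity)]
      nlinarith
    have h2 : q * D ≤ 2 / A * D := mul_le_mul_of_nonneg_right e2.2.le hD0
    calc ε / (2 * (3 + ε)) * (q * D) ≤ ε / (2 * (3 + ε)) * (2 / A * D) :=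
          mul_le_mul_of_nonneg_left h2 (by positivity)
      _ = ε / (3 + ε) * D * (1 / A) := by field_simp
      _ ≤ _ := mul_le_mul_of_nonneg_right h1 (by positivity)
  · refine g2.trans ?_
    have h1 : D + 2 * ℓ ≤ 2 * D := by nlinarith
    have h2 : D ≤ 2 * A * (q * D) := by
      have := mul_le_mul_of_nonneg_right e2.1.le hD0
      calc D = 2 * A * (1 / (2 * A) * D) := by field_simp
        _ ≤ _ := mul_le_mul_of_nonneg_left this (by positivity)
    calc (1 + 1) * (D + 2 * ℓ) * B ≤ (1 + 1) * (2 * (2 * A * (q * D))) * B := by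
          refine mul_le_mul_of_nonneg_right ?_ hB0.le
          linarith
      _ = _ := by ring

end Asymptotics

end Localization

theorem theorem2p2 (A : ℝ) (hA : 0 < A) :
    (∀ (p : ℕ → unitInterval) (i : ℕ → ℕ), Localization.InRegime A p i →
      ∃ δ : ℕ → ℝ, Tendsto δ atTop (𝓝 0) ∧
        Localization.HoldsAAS p fun n G =>
          (Real.log (Localization.degreeParam p n) - 3 * Real.log (Real.log n)) * (1 / A)
              ≤ (Localization.localizationNumber G : ℝ) ∧
            (Localization.localizationNumber G : ℝ)
              ≤ (1 + δ n) *
                (Real.log (Localization.degreeParam p n) + 2 * Real.log (Real.log n)) *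
                (Real.exp A / (1 - Real.exp (-A)))) ∧
    (∀ ε : ℝ, 0 < ε → ∃ a b : ℝ, 0 < a ∧ 0 < b ∧
      ∀ (p : ℕ → unitInterval) (i : ℕ → ℕ), Localization.InRegime A p i →
        (∀ᶠ n : ℕ in atTop, Real.log n ^ (3 + ε) ≤ Localization.degreeParam p n) →
        Localization.HoldsAAS p fun n G =>
          a * (n * Real.log (Localization.degreeParam p n) / Localization.degreeParam p n ^ i n)
              ≤ (Localization.localizationNumber G : ℝ) ∧
            (Localization.localizationNumber G : ℝ)
              ≤ b * (n * Real.log (Localization.degreeParam p n) /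
                  Localization.degreeParam p n ^ i n)) := by
  refine ⟨fun p i h => Localization.exists_tendsto_zero_holdsAAS
      fun η hη => h.holdsAAS_bounds hA hη, fun ε hε => ?_⟩
  have hx1 := Localization.one_sub_exp_neg_pos hA
  exact ⟨ε / (2 * (3 + ε)), 8 * A * (Real.exp A / (1 - Real.exp (-A))), by positivity,
    by positivity, fun p i h hd => h.holdsAAS_order hA hε hd⟩
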